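/- Let $\mathcal H$ be a complex Hilbert space (the one-particle space), $s=+1$ (Bosons) or $s=-1$ (Fermions), and let $P_s=\frac1{n!}\sum_{\pi\in S_n}s^\pi V_\pi$ be the projection of $\mathcal H^{\otimes n}$ onto its symmetric, resp. antisymmetric, subspace ($s^\pi=1$ for $s=1$, $s^\pi=\operatorname{sgn}\pi$ for $s=-1$, and $V_\pi$ permutes the tensor factors). Let $\sigma\ge 0$ be a trace class operator on $\mathcal H$, with $\|\sigma\|<1$ if $s=1$. Let $\Gamma_s(\sigma)=\bigoplus_n P_s\sigma^{\otimes n}P_s$ and let $\rho=\Gamma_s(\sigma)/\operatorname{tr}\Gamma_s(\sigma)$ be the associated gauge invariant quasi-free state, with $n$-particle components $\rho_n$. Put $\hat\sigma=\sigma(1-s\sigma)^{-1}$. Let $F$ be an observable on a measurable space $X$, i.e. a weakly countably additive measure with values in the positive operators on $\mathcal H$ and $F(X)\le 1$. It is measured on every particle: if $F^+$ is the normalized extension of $F$ to $X\sqcup\{\infty\}$ with $F^+(\{\infty\})=1-F(X)$, then $n$ particles with outcomes $x_1,\dots,x_n\in X\sqcup\{\infty\}$ are found with distribution $\operatorname{tr}\rho_n\,F^+(dx_1)\otimes\cdots\otimes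 F^+(dx_n)$, and the outcomes lying in $X$ form a point process in $X$. Its $k$-th factorial moment $\hat m_k$ is the measure on $X^k$ for which $\int f\,d\hat m_k$ is the expectation of $\sum f(x_{i_1},\dots,x_{i_k})$ over all $k$-tuples of distinct indices with $x_{i_1},\dots,x_{i_k}\in X$. Then: (1) For every $k\ge 0$ the $k$-particle reduced density operator of $\rho$ is $$\hat\rho_k:=\sum_{N\ge k}\binom Nk\operatorname{tr}_{[k+1,\dots,N]}\rho_N=P_s\hat\sigma^{\otimes k}P_s ,$$ the sum converges in norm, and $\hat\rho_k$ is trace class. (2) The probability distribution described above exists, every $\hat m_k$ is a finite measure, and for measurable $A_1,\dots,A_k\subset X$ $$\hat m_k(A_1\times\cdots\times A_k)=k!\,\operatorname{tr}\bigl(P_s\hat\sigma^{\otimes k}P_s\,F(A_1)\otimes\cdots\otimes F(A_k)\bigr).$$ (3) For measurable $A,B\subset X$: $\hat m_1(A)=\operatorname{tr}(\hat\sigma F(A))$ and $$\hat m_2(A\times B)=\hat m_1(A)\,\hat m_1(B)+s\operatorname{tr}\bigl(\hat\sigma F(A)\hat\sigma F(B)\bigr).$$ (4) There is a finite positive measure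 $\mu$ on $X\times X$ with $\mu(A\times B)=\operatorname{tr}(\hat\sigma F(A)\hat\sigma F(B))$ for all measurable $A,B$, so that $\hat m_2=\hat m_1\otimes\hat m_1+s\mu$. It is positive definite: $\int\overline{f(x)}f(y)\,\mu(dx\,dy)\ge 0$ for every measurable $f:X\to\mathbb C$ for which the integrand is $\mu$-integrable. (5) Consequently, if $\nu$ is a $\sigma$-finite measure on $X$ such that $\hat m_1(dx)=h^{(1)}(x)\,\nu(dx)$ and $\hat m_2(dx\,dy)=h^{(2)}(x,y)\,\nu(dx)\nu(dy)$ with measurable densities $h^{(1)},h^{(2)}\ge0$, then $g^{(2)}(x,y)=\dfrac{h^{(2)}(x,y)}{h^{(1)}(x)h^{(1)}(y)}$ satisfies $g^{(2)}\ge 1$ for Bosons (bunching) and $g^{(2)}\le 1$ for Fermions (antibunching), at $\nu\otimes\nu$-almost every $(x,y)$ with $h^{(1)}(x)\ne0\ne h^{(1)}(y)$. -/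

import Mathlib

open MeasureTheory
open scoped InnerProductSpace ENNReal ComplexConjugate

noncomputable section

namespace Beam

/-! ### Traces on a complex Hilbert space -/

section Trace

variable {E : Type*} [NormedAddCommGroup E] [InnerProductSpace ℂ E] [CompleteSpace E]

variable (E) in
/-- The index set of a fixed Hilbert basis of `E`. -/
def basisIndex : Set E := (exists_hilbertBasis ℂ E).choose

variable (E) in
/-- A fixed Hilbert basis (complete orthonormal system) of `E`. -/
def hilbertBasis : HilbertBasis (basisIndex E) ℂ E :=
  (exists_hilbertBasis ℂ E).choose_spec.choose

/-- `A` is trace class: `tr √(A* A) < ∞`. -/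
def IsTraceClass (A : E →L[ℂ] E) : Prop :=
  Summable fun i => ⟪hilbertBasis E i, CFC.abs A (hilbertBasis E i)⟫_ℂ

/-- The trace `∑ᵢ ⟪eᵢ, A eᵢ⟫`. For trace class `A` the sum converges absolutely and does not
depend on the Hilbert basis. -/
def opTrace (A : E →L[ℂ] E) : ℂ :=
  ∑' i, ⟪hilbertBasis E i, A (hilbertBasis E i)⟫_ℂ

end Trace

/-! ### Positivity of Gram matrices and their entrywise products -/

section Gram

open scoped ComplexOrder

theorem sum_gram {𝕜 κ E : Type*} [RCLike 𝕜] [NormedAddCommGroup E] [InnerProductSpace 𝕜 E]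
    (v : κ → E) (c : κ →₀ 𝕜) :
    c.sum (fun i xi => c.sum fun j xj => star xi * ⟪v i, v j⟫_𝕜 * xj)
      = ((‖Finsupp.linearCombination 𝕜 v c‖ ^ 2 : ℝ) : 𝕜) := by
  have := inner_self_eq_norm_sq_to_K (𝕜 := 𝕜) (Finsupp.linearCombination 𝕜 v c)
  push_cast
  refine Eq.trans ?_ this
  simp only [Finsupp.linearCombination_apply, Finsupp.sum, sum_inner]
  refine Finset.sum_congr rfl fun i _ => ?_
  rw [inner_sum]
  refine Finset.sum_congr rfl fun j _ => ?_
  simp only [inner_smul_left, inner_smul_right, RCLike.star_def]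
  ring

theorem posSemidef_gram {𝕜 κ E : Type*} [RCLike 𝕜] [NormedAddCommGroup E] [InnerProductSpace 𝕜 E]
    (v : κ → E) : (Matrix.gram 𝕜 v).PosSemidef := by
  refine ⟨Matrix.isHermitian_gram 𝕜 v, fun x => ?_⟩
  have h := sum_gram v x
  simp only [Matrix.gram_apply]
  rw [h]
  exact RCLike.ofReal_nonneg.mpr (sq_nonneg _)

theorem posSemidef_prod {𝕜 ι κ : Type*} [RCLike 𝕜] (t : Finset ι)
    (G : ι → Matrix κ κ 𝕜) (hG : ∀ i, (G i).PosSemidef) :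
    (Matrix.of fun a b => ∏ i ∈ t, G i a b : Matrix κ κ 𝕜).PosSemidef := by
  classical
  induction t using Finset.induction_on with
  | empty =>
    have := posSemidef_gram (𝕜 := 𝕜) (fun _ : κ => (1 : 𝕜))
    convert! this using 1
    ext a b
    simp [Matrix.gram]
  | insert i t hi ih =>
    have := (hG i).hadamard ih
    convert! this using 1
    ext a b
    simp [Finset.prod_insert hi]

theorem posSemidef_prod_sub {𝕜 ι κ : Type*} [RCLike 𝕜] (t : Finset ι)
    (G G' : ι → Matrix κ κ 𝕜) (hG : ∀ i, (G i).PosSemidef) (hG' : ∀ i, (G' i).PosSemidef)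
    (h : ∀ i, (G i - G' i).PosSemidef) :
    (Matrix.of fun a b => ∏ i ∈ t, G i a b - ∏ i ∈ t, G' i a b : Matrix κ κ 𝕜).PosSemidef := by
  classical
  induction t using Finset.induction_on with
  | empty =>
    convert! (Matrix.PosSemidef.zero : (0 : Matrix κ κ 𝕜).PosSemidef) using 1
    ext a b
    simp
  | insert i t hi ih =>
    have := ((hG i).hadamard ih).add ((h i).hadamard (posSemidef_prod t G' hG'))
    convert! this using 1
    ext a b
    simp [Finset.prod_insert hi]
    ring

end Gram

/-! ### Hilbert space tensor powers -/

section Tensor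

open scoped ComplexOrder

variable (H : Type*) [NormedAddCommGroup H] [InnerProductSpace ℂ H]

/-- The kernel `∏ i, ⟪x i, y i⟫` on `n`-tuples of vectors. -/
def tensorKernel (n : ℕ) : Matrix (Fin n → H) (Fin n → H) (ℂ →L[ℂ] ℂ) :=
  .of fun x y => (∏ i, ⟪x i, y i⟫_ℂ) • (1 : ℂ →L[ℂ] ℂ)

theorem posSemidef_tensorKernel (n : ℕ) : (tensorKernel H n).PosSemidef := by
  have key := posSemidef_prod (𝕜 := ℂ) Finset.univ
    (fun i => Matrix.gram ℂ fun x : Fin n → H => x i) (fun i => posSemidef_gram _)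
  refine ((RKHS.posSemidef_tfae (K := tensorKernel H n)).out 0 2 :
    (tensorKernel H n).PosSemidef ↔ (tensorKernel H n).IsHermitian ∧ _).mpr ⟨?_, fun vv => ?_⟩
  · ext a b
    simp [tensorKernel]
  · have h2 := (RCLike.nonneg_iff.mp (key.2 vv)).1
    convert! h2 using 2
    simp only [Finsupp.sum]
    refine Finset.sum_congr rfl fun i _ => Finset.sum_congr rfl fun j _ => ?_
    simp [tensorKernel]
    ring

instance (n : ℕ) : Fact (tensorKernel H n).PosSemidef := ⟨posSemidef_tensorKernel H n⟩

/-- The Hilbert space tensor power `H ⊗ ⋯ ⊗ H` (`n` factors): the completion of the span of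
formal product vectors `x 0 ⊗ ⋯ ⊗ x (n-1)`, modulo null vectors, with the inner product
`⟪x 0 ⊗ ⋯ ⊗ x (n-1), y 0 ⊗ ⋯ ⊗ y (n-1)⟫ = ∏ i, ⟪x i, y i⟫`. -/
def HTensor (n : ℕ) : Type _ := RKHS.OfKernel (tensorKernel H n)

instance (n : ℕ) : NormedAddCommGroup (HTensor H n) :=
  inferInstanceAs (NormedAddCommGroup (RKHS.OfKernel (tensorKernel H n)))

instance (n : ℕ) : InnerProductSpace ℂ (HTensor H n) :=
  inferInstanceAs (InnerProductSpace ℂ (RKHS.OfKernel (tensorKernel H n)))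

instance (n : ℕ) : CompleteSpace (HTensor H n) :=
  inferInstanceAs (CompleteSpace (RKHS.OfKernel (tensorKernel H n)))

variable {H} {n : ℕ}

/-- The product vector `x 0 ⊗ ⋯ ⊗ x (n-1)`. -/
def tprod (x : Fin n → H) : HTensor H n :=
  RKHS.kerFun (RKHS.OfKernel (tensorKernel H n)) x (1 : ℂ)

theorem inner_tprod (x y : Fin n → H) : ⟪tprod x, tprod y⟫_ℂ = ∏ i, ⟪x i, y i⟫_ℂ := by
  have := RKHS.kernel_inner (RKHS.OfKernel (tensorKernel H n)) y x (1 : ℂ) (1 : ℂ)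
  rw [RKHS.OfKernel.kernel_ofKernel] at this
  refine Eq.trans this.symm ?_
  simp [tensorKernel]

theorem denseRange_tprod :
    DenseRange (Finsupp.linearCombination ℂ (tprod : (Fin n → H) → HTensor H n)) := by
  have h : Dense ((Submodule.span ℂ {RKHS.kerFun (RKHS.OfKernel (tensorKernel H n)) x v | (x) (v)} :
      Submodule ℂ (RKHS.OfKernel (tensorKernel H n))) : Set (RKHS.OfKernel (tensorKernel H n))) :=
    Submodule.dense_iff_topologicalClosure_eq_top.mpr (RKHS.kerFun_dense _)
  have h2 : (Submodule.span ℂ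
      {RKHS.kerFun (RKHS.OfKernel (tensorKernel H n)) x v | (x) (v)} : Submodule ℂ (HTensor H n))
      ≤ LinearMap.range (Finsupp.linearCombination ℂ (tprod : (Fin n → H) → HTensor H n)) := by
    refine Submodule.span_le.mpr ?_
    rintro _ ⟨x, v, rfl⟩
    refine ⟨Finsupp.single x v, ?_⟩
    rw [Finsupp.linearCombination_single]
    have := (RKHS.kerFun (RKHS.OfKernel (tensorKernel H n)) x).map_smul v 1
    rw [smul_eq_mul, mul_one] at this
    exact this.symm
  exact Dense.mono (s₁ := ((Submodule.span ℂ
      {RKHS.kerFun (RKHS.OfKernel (tensorKernel H n)) x v | (x) (v)} :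
      Submodule ℂ (HTensor H n)) : Set (HTensor H n))) h2 h

variable {E : Type*} [NormedAddCommGroup E] [InnerProductSpace ℂ E] [CompleteSpace E]

/-- The bounded operator on `H ⊗ ⋯ ⊗ H` with prescribed (boundedly extendable) values `φ x` on
product vectors `x 0 ⊗ ⋯ ⊗ x (n-1)`. -/
def tensorLift (φ : (Fin n → H) → E) : HTensor H n →L[ℂ] E :=
  (Finsupp.linearCombination ℂ φ).extendOfNorm
    (Finsupp.linearCombination ℂ (tprod : (Fin n → H) → HTensor H n))

theorem tensorLift_tprod (φ : (Fin n → H) → E) (C : ℝ)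
    (hφ : (Matrix.of fun x y => (C : ℂ) ^ 2 * ∏ i, ⟪x i, y i⟫_ℂ - ⟪φ x, φ y⟫_ℂ :
      Matrix (Fin n → H) (Fin n → H) ℂ).PosSemidef) (x : Fin n → H) :
    tensorLift φ (tprod x) = φ x := by
  have hb : ∃ C, ∀ c, ‖Finsupp.linearCombination ℂ φ c‖ ≤
      C * ‖Finsupp.linearCombination ℂ (tprod : (Fin n → H) → HTensor H n) c‖ := by
    refine ⟨|C|, fun c => ?_⟩
    have h := (Complex.nonneg_iff.mp (hφ.2 c)).1
    refine le_of_sq_le_sq ?_ (by positivity)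
    have e2 : c.sum (fun i xi => c.sum fun j xj => star xi *
        ((C : ℂ) ^ 2 * ∏ k, ⟪i k, j k⟫_ℂ - ⟪φ i, φ j⟫_ℂ) * xj)
        = (((|C| * ‖Finsupp.linearCombination ℂ (tprod : (Fin n → H) → HTensor H n) c‖) ^ 2
          - ‖Finsupp.linearCombination ℂ φ c‖ ^ 2 : ℝ) : ℂ) := by
      have e1 := sum_gram (tprod : (Fin n → H) → HTensor H n) c
      have e1' := sum_gram φ c
      simp only [Complex.coe_algebraMap] at e1 e1'
      rw [mul_pow, sq_abs, Complex.ofReal_sub, Complex.ofReal_mul]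
      refine Eq.trans ?_ (congrArg₂ (fun a b => ((C ^ 2 : ℝ) : ℂ) * a - b) e1 e1')
      simp only [Finsupp.sum, Finset.mul_sum, ← Finset.sum_sub_distrib, inner_tprod]
      refine Finset.sum_congr rfl fun i _ => Finset.sum_congr rfl fun j _ => ?_
      push_cast
      ring
    have h3 : 0 ≤ (c.sum (fun i xi => c.sum fun j xj => star xi *
        ((C : ℂ) ^ 2 * ∏ k, ⟪i k, j k⟫_ℂ - ⟪φ i, φ j⟫_ℂ) * xj)).re := h
    rw [e2, Complex.ofReal_re] at h3
    linarith
  have := LinearMap.extendOfNorm_eq denseRange_tprod hb (Finsupp.single x 1)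
  rw [Finsupp.linearCombination_single, Finsupp.linearCombination_single, one_smul, one_smul]
    at this
  exact this

/-- The product operator `A 0 ⊗ ⋯ ⊗ A (n-1)`. -/
def tensorMap (A : Fin n → H →L[ℂ] H) : HTensor H n →L[ℂ] HTensor H n :=
  tensorLift fun x => tprod fun i => A i (x i)

theorem tensorMap_tprod (A : Fin n → H →L[ℂ] H) (x : Fin n → H) :
    tensorMap A (tprod x) = tprod fun i => A i (x i) := by
  refine tensorLift_tprod _ (∏ i, ‖A i‖) ?_ x
  have h := posSemidef_prod_sub (𝕜 := ℂ) Finset.univ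
    (fun i => Matrix.gram ℂ fun x : Fin n → H => (‖A i‖ : ℂ) • x i)
    (fun i => Matrix.gram ℂ fun x : Fin n → H => A i (x i))
    (fun i => posSemidef_gram _) (fun i => posSemidef_gram _) (fun i => ?_)
  · convert! h using 1
    ext a b
    simp only [inner_tprod, Matrix.of_apply, Matrix.gram_apply, inner_smul_left, inner_smul_right,
      Finset.prod_mul_distrib, Complex.conj_ofReal]
    push_cast
    ring
  · refine ⟨(posSemidef_gram _).1.sub (posSemidef_gram _).1, fun c => ?_⟩
    have e1 := sum_gram (𝕜 := ℂ) (fun x : Fin n → H => (‖A i‖ : ℂ) • x i) c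
    have e2 := sum_gram (𝕜 := ℂ) (fun x : Fin n → H => A i (x i)) c
    have e3 : c.sum (fun j xj => c.sum fun k xk => star xj *
        (Matrix.gram ℂ (fun x : Fin n → H => (‖A i‖ : ℂ) • x i) -
          Matrix.gram ℂ (fun x : Fin n → H => A i (x i))) j k * xk) =
        ((‖Finsupp.linearCombination ℂ (fun x : Fin n → H => (‖A i‖ : ℂ) • x i) c‖ ^ 2 -
          ‖Finsupp.linearCombination ℂ (fun x : Fin n → H => A i (x i)) c‖ ^ 2 : ℝ) : ℂ) := by
      rw [Complex.ofReal_sub]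
      refine Eq.trans ?_ (congrArg₂ (fun a b => a - b) e1 e2)
      simp only [Finsupp.sum, ← Finset.sum_sub_distrib, Matrix.sub_apply, Matrix.gram_apply]
      refine Finset.sum_congr rfl fun i _ => Finset.sum_congr rfl fun j _ => ?_
      ring
    rw [e3]
    refine Complex.zero_le_real.mpr (sub_nonneg.mpr ?_)
    have f1 : Finsupp.linearCombination ℂ (fun x : Fin n → H => (‖A i‖ : ℂ) • x i) c =
        (‖A i‖ : ℂ) • Finsupp.linearCombination ℂ (fun x : Fin n → H => x i) c := by
      simp only [Finsupp.linearCombination_apply, Finsupp.sum, Finset.smul_sum]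
      exact Finset.sum_congr rfl fun j _ => smul_comm _ _ _
    have f2 : Finsupp.linearCombination ℂ (fun x : Fin n → H => A i (x i)) c =
        A i (Finsupp.linearCombination ℂ (fun x : Fin n → H => x i) c) := by
      simp [Finsupp.linearCombination_apply, Finsupp.sum]
    rw [f1, f2, norm_smul]
    simp only [Complex.norm_real, norm_norm]
    gcongr
    exact (A i).le_opNorm _

/-- The unitary permuting the tensor factors. -/
def permOp (π : Equiv.Perm (Fin n)) : HTensor H n →L[ℂ] HTensor H n :=
  tensorLift fun x => tprod fun i => x (π i)

theorem permOp_tprod (π : Equiv.Perm (Fin n)) (x : Fin n → H) :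
    permOp π (tprod x) = tprod fun i => x (π i) := by
  refine tensorLift_tprod _ 1 ?_ x
  convert! (Matrix.PosSemidef.zero : (0 : Matrix (Fin n → H) (Fin n → H) ℂ).PosSemidef) using 1
  ext a b
  simp [inner_tprod, Equiv.prod_comp π fun i => ⟪a i, b i⟫_ℂ]

/-- The operator `u ↦ u ⊗ (y 0 ⊗ ⋯ ⊗ y (m-1))` from the `n`-fold to the `(n+m)`-fold tensor
power. -/
def appendOp {m : ℕ} (y : Fin m → H) : HTensor H n →L[ℂ] HTensor H (n + m) :=
  tensorLift fun x => tprod (Fin.append x y)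

theorem appendOp_tprod {m : ℕ} (y : Fin m → H) (x : Fin n → H) :
    appendOp y (tprod x) = tprod (Fin.append x y) := by
  refine tensorLift_tprod _ (∏ j, ‖y j‖) ?_ x
  convert! (Matrix.PosSemidef.zero : (0 : Matrix (Fin n → H) (Fin n → H) ℂ).PosSemidef) using 1
  ext a b
  simp [inner_tprod, Fin.prod_univ_add, inner_self_eq_norm_sq_to_K, Finset.prod_pow, mul_comm]

end Tensor

/-! ### Bose and Fermi statistics, quasi-free states -/

section States

variable {H : Type*} [NormedAddCommGroup H] [InnerProductSpace ℂ H]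

/-- `1` for Bosons (`s = 1`), the sign of the permutation for Fermions (`s = -1`). -/
def statSign (s : ℤˣ) {n : ℕ} (π : Equiv.Perm (Fin n)) : ℤˣ :=
  if s = 1 then 1 else Equiv.Perm.sign π

variable (H) in
/-- The projection `P_s` of the `n`-fold tensor power onto its symmetric (`s = 1`) or
antisymmetric (`s = -1`) subspace. -/
def symProj (s : ℤˣ) (n : ℕ) : HTensor H n →L[ℂ] HTensor H n :=
  (n.factorial : ℂ)⁻¹ • ∑ π : Equiv.Perm (Fin n), ((statSign s π : ℤ) : ℂ) • permOp π

/-- `P_s (A ⊗ ⋯ ⊗ A) P_s` on the `n`-fold tensor power: the `n`-particle component of the second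
quantized operator `Γ_s(A)`, extended by zero to the orthogonal complement of the
(anti-)symmetric subspace. -/
def secondQuant (s : ℤˣ) (A : H →L[ℂ] H) (n : ℕ) : HTensor H n →L[ℂ] HTensor H n :=
  symProj H s n * tensorMap (fun _ => A) * symProj H s n

/-- `tr Γ_s(A)`, the trace over Fock space. -/
def fockTrace (s : ℤˣ) (A : H →L[ℂ] H) : ℂ :=
  ∑' n, opTrace (secondQuant s A n)

/-- The gauge invariant quasi-free state `ρ = Γ_s(σ) / tr Γ_s(σ)`. It commutes with the particle
number, and is given by its `n`-particle components `ρ_n`. -/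
def quasiFree (s : ℤˣ) (σ : H →L[ℂ] H) (n : ℕ) : HTensor H n →L[ℂ] HTensor H n :=
  (fockTrace s σ)⁻¹ • secondQuant s σ n

/-- `σ̂ = σ / (1 - s σ)`. -/
def sigmaHat (s : ℤˣ) (σ : H →L[ℂ] H) : H →L[ℂ] H :=
  σ * Ring.inverse (1 - ((s : ℤ) : ℂ) • σ)

variable [CompleteSpace H]

/-- The partial trace over the last `m` of `k + m` tensor factors,
`∑_J (1 ⊗ ⟨e_J|) A (1 ⊗ |e_J⟩)` with `e_J = e_{J 0} ⊗ ⋯ ⊗ e_{J (m-1)}` running through a product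
Hilbert basis of the `m`-fold tensor power. -/
def partialTrace (k m : ℕ) (A : HTensor H (k + m) →L[ℂ] HTensor H (k + m)) :
    HTensor H k →L[ℂ] HTensor H k :=
  ∑' J : Fin m → basisIndex H,
    (appendOp (n := k) fun j => hilbertBasis H (J j)).adjoint ∘L A ∘L
      (appendOp (n := k) fun j => hilbertBasis H (J j))

/-- `T` is the `k`-particle reduced density operator of the state with `n`-particle components
`ρ n`: the sum over `N = k + m` of `(N choose k)` times the partial trace of `ρ N` over the last
`m = N - k` factors converges in norm to `T`, and `T` is trace class. -/
def IsReducedDensity (ρ : ∀ n, HTensor H n →L[ℂ] HTensor H n) (k : ℕ)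
    (T : HTensor H k →L[ℂ] HTensor H k) : Prop :=
  IsTraceClass T ∧
    HasSum (fun m => ((k + m).choose k : ℂ) • partialTrace k m (ρ (k + m))) T

end States

/-! ### Observables and counting statistics -/

section Counting

/-- A (possibly subnormalized) observable with outcomes in `X`: a weakly countably additive
measure whose values are positive operators, with `F(X) ≤ 1`. -/
structure Observable (X H : Type*) [MeasurableSpace X] [NormedAddCommGroup H]
    [InnerProductSpace ℂ H] [CompleteSpace H] where
  op : Set X → H →L[ℂ] H
  nonneg : ∀ A, MeasurableSet A → 0 ≤ op A
  univ_le_one : op Set.univ ≤ 1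
  hasSum_iUnion : ∀ A : ℕ → Set X, (∀ i, MeasurableSet (A i)) →
    Pairwise (Function.onFun Disjoint A) → ∀ φ ψ : H,
      HasSum (fun i => ⟪φ, op (A i) ψ⟫_ℂ) ⟪φ, op (⋃ i, A i) ψ⟫_ℂ

variable {X H : Type*} [MeasurableSpace X] [NormedAddCommGroup H] [InnerProductSpace ℂ H]
  [CompleteSpace H]

open Classical in
/-- The normalized observable on `X ⊕ Unit` obtained by adjoining the outcome `inr ()` (the
particle is never detected), which is assigned the operator `1 - F(X)`. -/
def Observable.completed (F : Observable X H) (B : Set (X ⊕ Unit)) : H →L[ℂ] H :=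
  F.op (Sum.inl ⁻¹' B) + if Sum.inr () ∈ B then 1 - F.op Set.univ else 0

/-- Finite numbered lists of points of `X`. -/
abbrev Config (X : Type*) : Type _ := Σ n : ℕ, (Fin n → X)

/-- `P` is the law of the outcome list when `F` is measured on every particle in the state with
`n`-particle components `ρ n`: on the `n`-particle space the outcomes `x 0, …, x (n-1)` are
distributed according to `tr ρ_n F(dx 0) ⊗ ⋯ ⊗ F(dx (n-1))`. The associated point process in `X`
is the collection of those entries of the list which lie in `X`, with multiplicities. -/
structure IsCountingLaw (F : Observable X H) (ρ : ∀ n, HTensor H n →L[ℂ] HTensor H n)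
    (P : Measure (Config (X ⊕ Unit))) : Prop where
  isProbabilityMeasure : IsProbabilityMeasure P
  rect : ∀ (n : ℕ) (B : Fin n → Set (X ⊕ Unit)), (∀ i, MeasurableSet (B i)) →
    ((P.real (Sigma.mk n '' Set.univ.pi B) : ℝ) : ℂ) =
      opTrace (ρ n * tensorMap fun i => F.completed (B i))

/-- The `k`-th factorial moment measure of the point process in `X`:
`m̂_k(B)` is the expectation of the number of `k`-tuples of distinct indices `i 0, …, i (k-1)`
such that the points `x (i 0), …, x (i (k-1))` all lie in `X` and form an element of `B`. -/
def factorialMoment (P : Measure (Config (X ⊕ Unit))) (k : ℕ) : Measure (Fin k → X) :=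
  (P.bind fun ω => ∑ i : Fin k ↪ Fin ω.1, Measure.dirac fun j => ω.2 (i j)).comap
    fun y j => Sum.inl (y j)

/-- The first factorial moment as a measure on `X`. -/
def moment₁ (P : Measure (Config (X ⊕ Unit))) : Measure X :=
  (factorialMoment P 1).map fun y => y 0

/-- The second factorial moment as a measure on `X × X`. -/
def moment₂ (P : Measure (Config (X ⊕ Unit))) : Measure (X × X) :=
  (factorialMoment P 2).map fun y => (y 0, y 1)

/-- The normalized correlation function `g⁽²⁾(x, y) = h⁽²⁾(x, y) / (h⁽¹⁾(x) h⁽¹⁾(y))`. -/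
def g2 (h₁ : X → ℝ≥0∞) (h₂ : X × X → ℝ≥0∞) (z : X × X) : ℝ≥0∞ :=
  h₂ z / (h₁ z.1 * h₁ z.2)

end Counting

end Beam

end

/-! Everything rests on one expansion. Write σ = D*D with D Hilbert–Schmidt. The n-particle
component of Γ_s(σ) is Q*Q with Q = D^{⊗n} P_s, and its trace against X_1 ⊗ ⋯ ⊗ X_n is 1/n! times
`permTrace` of the operators σ X_l, a signed sum over permutations of products of traces over cycles
(`opTrace_secondQuant_mul_tensorMap`). Such a sum can be expanded along one operator A_0: either A_0
is a cycle by itself and contributes tr A_0, or it follows some A_x in a cycle, and then A_x is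
replaced by A_x A_0 at the price of a factor s (`permTrace_option`).

For n copies of σ, with value z_n, the expansion gives z_{n+1} ≤ (tr σ + n q) z_n, where q = ‖σ‖ for
Bosons and q = 0 for Fermions. As q < 1, all series Σ_m z_{k+m}/m! converge by the ratio test.

For observed particles X and m unobserved ones, summed with weight 1/m! to R(X), the expansion along
X_0 reads R(X_0, X) = tr(σ X_0) R(X) + s Σ_x R(…, X_x σ X_0, …) + s R(σ X_0, X). The last term
collects the m equal contributions in which X_0 is attached to an unobserved particle. Moving it to
the left and replacing X_0 by (1 − sσ)⁻¹ X_0 leaves exactly the expansion of `permTrace` with σ̂ in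
place of σ. Hence R(X) = tr Γ_s(σ) · permTrace(σ̂ X) (`reducedSum_eq`). With rank one X this is the
formula for the reduced density operators; with X_j = F(A_j) it is the formula for the factorial
moments, and k = 1, 2 are read off from it.

Existence of the joint distributions needs an argument, because on an arbitrary measurable space a
positive multiadditive function of rectangles need not extend to a measure. Compressed to countably
many vectors u_i with Σ‖u_i‖² < ∞, F has a positive semidefinite matrix density t(x) with respect to
a finite measure (`exists_density`). By Schur's product theorem the entrywise products of such
matrices are again positive semidefinite, which makes the candidate joint densities nonnegative. The
same device with σ̂ = D'*D' and u_i = D'* e_i gives the exchange term the density Σ_{ij} t(x)_{ij}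
t(y)_{ji} ≥ 0, and ∫ conj f(x) f(y) μ(dx dy) becomes a sum of squares. Bunching and antibunching
compare the densities of m̂_2 and m̂_1 ⊗ m̂_1, which differ by sμ. -/

namespace Beam

/-! ### Hilbert–Schmidt operators and traces -/

section HilbertSchmidt

variable {E : Type*} [NormedAddCommGroup E] [InnerProductSpace ℂ E] [CompleteSpace E]
variable {ι κ : Type*}

omit [CompleteSpace E] in
theorem hasSum_norm_inner_sq (b : HilbertBasis ι ℂ E) (x : E) :
    HasSum (fun i => ‖⟪b i, x⟫_ℂ‖ ^ 2) (‖x‖ ^ 2) := by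
  have h := b.hasSum_inner_mul_inner x x
  rw [inner_self_eq_norm_sq_to_K] at h
  have e : ∀ i, ⟪x, b i⟫_ℂ * ⟪b i, x⟫_ℂ = ((‖⟪b i, x⟫_ℂ‖ ^ 2 : ℝ) : ℂ) := fun i => by
    rw [← inner_conj_symm, RCLike.conj_mul]
    norm_cast
  simp only [e] at h
  exact Complex.hasSum_ofReal.mp (by simpa using h)

omit [CompleteSpace E] in
theorem summable_norm_inner_sq_of_summable (b : HilbertBasis ι ℂ E) (b' : HilbertBasis κ ℂ E)
    {A : E →L[ℂ] E} (h : Summable fun i => ‖A (b i)‖ ^ 2) :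
    Summable fun p : ι × κ => ‖⟪b' p.2, A (b p.1)⟫_ℂ‖ ^ 2 := by
  rw [summable_prod_of_nonneg fun p => (by positivity)]
  refine ⟨fun i => (hasSum_norm_inner_sq b' (A (b i))).summable, ?_⟩
  exact h.congr fun i => ((hasSum_norm_inner_sq b' (A (b i))).tsum_eq).symm

/-- Both sums of squares are iterated sums of the same matrix entries |⟪b'_j, A b_i⟫|², in opposite
orders. Applied twice, this makes the Hilbert–Schmidt property independent of the basis. -/
theorem summable_norm_star_sq (b : HilbertBasis ι ℂ E) (b' : HilbertBasis κ ℂ E)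
    {A : E →L[ℂ] E} (h : Summable fun i => ‖A (b i)‖ ^ 2) :
    Summable fun j => ‖star A (b' j)‖ ^ 2 := by
  have h2 : Summable fun j => ∑' i, ‖⟪b' j, A (b i)⟫_ℂ‖ ^ 2 :=
    (summable_norm_inner_sq_of_summable b b' h).prod_symm.prod
  have e : ∀ j, ∑' i, ‖⟪b' j, A (b i)⟫_ℂ‖ ^ 2 = ‖star A (b' j)‖ ^ 2 := fun j => by
    rw [← (hasSum_norm_inner_sq b (star A (b' j))).tsum_eq]
    refine tsum_congr fun i => ?_
    rw [ContinuousLinearMap.star_eq_adjoint, ContinuousLinearMap.adjoint_inner_right,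
      norm_inner_symm]
  simpa only [e] using h2

/-- `A` is a Hilbert–Schmidt operator. -/
def IsHilbertSchmidt (A : E →L[ℂ] E) : Prop :=
  Summable fun i => ‖A (hilbertBasis E i)‖ ^ 2

theorem IsHilbertSchmidt.adj {A : E →L[ℂ] E} (hA : IsHilbertSchmidt A) :
    IsHilbertSchmidt (star A) :=
  summable_norm_star_sq _ _ hA

theorem IsHilbertSchmidt.summable {A : E →L[ℂ] E} (hA : IsHilbertSchmidt A)
    (b : HilbertBasis ι ℂ E) : Summable fun i => ‖A (b i)‖ ^ 2 := by
  simpa using summable_norm_star_sq (hilbertBasis E) b hA.adj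

theorem isHilbertSchmidt_of_summable (b : HilbertBasis ι ℂ E) {A : E →L[ℂ] E}
    (hA : Summable fun i => ‖A (b i)‖ ^ 2) : IsHilbertSchmidt A := by
  have := summable_norm_star_sq b (hilbertBasis E) hA
  simpa using IsHilbertSchmidt.adj (A := star A) this

theorem IsHilbertSchmidt.lmul {A : E →L[ℂ] E} (hA : IsHilbertSchmidt A) (B : E →L[ℂ] E) :
    IsHilbertSchmidt (B * A) := by
  refine Summable.of_nonneg_of_le (fun _ => sq_nonneg _) (fun i => ?_) (Summable.mul_left (‖B‖ ^ 2) hA)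
  rw [← mul_pow]
  exact pow_le_pow_left₀ (norm_nonneg _) (B.le_opNorm _) 2

theorem IsHilbertSchmidt.rmul {A : E →L[ℂ] E} (hA : IsHilbertSchmidt A) (B : E →L[ℂ] E) :
    IsHilbertSchmidt (A * B) := by
  have := (hA.adj.lmul (star B)).adj
  simpa using this

theorem IsHilbertSchmidt.summable_norm_mul {A B : E →L[ℂ] E} (hA : IsHilbertSchmidt A)
    (hB : IsHilbertSchmidt B) (b : HilbertBasis ι ℂ E) :
    Summable fun i => ‖A (b i)‖ * ‖B (b i)‖ := by
  refine Summable.of_nonneg_of_le (fun _ => by positivity) (fun i => ?_)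
    ((hA.summable b).add (hB.summable b))
  nlinarith [sq_nonneg (‖A (b i)‖ - ‖B (b i)‖), sq_nonneg (‖A (b i)‖), sq_nonneg (‖B (b i)‖)]

theorem IsHilbertSchmidt.summable_inner {A B : E →L[ℂ] E} (hA : IsHilbertSchmidt A)
    (hB : IsHilbertSchmidt B) (b : HilbertBasis ι ℂ E) :
    Summable fun i => ⟪A (b i), B (b i)⟫_ℂ :=
  Summable.of_norm_bounded (hA.summable_norm_mul hB b) fun _ => norm_inner_le_norm _ _

theorem IsHilbertSchmidt.summable_prod {A B : E →L[ℂ] E} (hA : IsHilbertSchmidt A)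
    (hB : IsHilbertSchmidt B) (b : HilbertBasis ι ℂ E) (b' : HilbertBasis κ ℂ E) :
    Summable fun p : ι × κ => ⟪A (b p.1), b' p.2⟫_ℂ * ⟪b' p.2, B (b p.1)⟫_ℂ := by
  refine Summable.of_norm_bounded ((summable_norm_inner_sq_of_summable b b' (hA.summable b)).add
    (summable_norm_inner_sq_of_summable b b' (hB.summable b))) fun p => ?_
  rw [norm_mul, norm_inner_symm]
  nlinarith [sq_nonneg (‖⟪b' p.2, A (b p.1)⟫_ℂ‖ - ‖⟪b' p.2, B (b p.1)⟫_ℂ‖),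
    sq_nonneg (‖⟪b' p.2, A (b p.1)⟫_ℂ‖), sq_nonneg (‖⟪b' p.2, B (b p.1)⟫_ℂ‖)]

/-- Parseval in `b'`, exchange of the absolutely convergent double sum, Parseval in `b`. Basis
independence and cyclicity of the trace both follow from this exchange. -/
theorem IsHilbertSchmidt.tsum_inner_eq {A B : E →L[ℂ] E} (hA : IsHilbertSchmidt A)
    (hB : IsHilbertSchmidt B) (b : HilbertBasis ι ℂ E) (b' : HilbertBasis κ ℂ E) :
    ∑' i, ⟪A (b i), B (b i)⟫_ℂ = ∑' j, ⟪star B (b' j), star A (b' j)⟫_ℂ := by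
  have h : Summable (Function.uncurry fun i j => ⟪A (b i), b' j⟫_ℂ * ⟪b' j, B (b i)⟫_ℂ) :=
    hA.summable_prod hB b b'
  calc ∑' i, ⟪A (b i), B (b i)⟫_ℂ
      = ∑' i, ∑' j, ⟪A (b i), b' j⟫_ℂ * ⟪b' j, B (b i)⟫_ℂ :=
        tsum_congr fun i => (b'.tsum_inner_mul_inner _ _).symm
    _ = ∑' j, ∑' i, ⟪A (b i), b' j⟫_ℂ * ⟪b' j, B (b i)⟫_ℂ := h.tsum_comm.symm
    _ = _ := tsum_congr fun j => by
        rw [← b.tsum_inner_mul_inner]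
        refine tsum_congr fun i => ?_
        rw [ContinuousLinearMap.star_eq_adjoint, ContinuousLinearMap.star_eq_adjoint,
          ContinuousLinearMap.adjoint_inner_right, ContinuousLinearMap.adjoint_inner_left]
        exact mul_comm _ _

theorem IsHilbertSchmidt.opTrace_star_mul {A B : E →L[ℂ] E} (hA : IsHilbertSchmidt A)
    (hB : IsHilbertSchmidt B) (b : HilbertBasis ι ℂ E) :
    opTrace (star A * B) = ∑' i, ⟪A (b i), B (b i)⟫_ℂ := by
  have h : opTrace (star A * B) = ∑' i, ⟪A (hilbertBasis E i), B (hilbertBasis E i)⟫_ℂ :=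
    tsum_congr fun i => by
      rw [mul_apply_eq_comp, ContinuousLinearMap.star_eq_adjoint,
        ContinuousLinearMap.adjoint_inner_right]
  rw [h, hA.tsum_inner_eq hB _ b, hB.adj.tsum_inner_eq hA.adj b b]
  simp

/-- Cyclicity of the trace. -/
theorem IsHilbertSchmidt.opTrace_mul_comm {A B : E →L[ℂ] E} (hA : IsHilbertSchmidt A)
    (hB : IsHilbertSchmidt B) : opTrace (A * B) = opTrace (B * A) := by
  have h1 := hA.adj.opTrace_star_mul hB (hilbertBasis E)
  have h2 := hB.adj.opTrace_star_mul hA (hilbertBasis E)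
  rw [star_star] at h1 h2
  rw [h1, h2, hA.adj.tsum_inner_eq hB _ (hilbertBasis E), star_star]

theorem inner_star_mul_self (A : E →L[ℂ] E) (x : E) :
    ⟪x, (star A * A) x⟫_ℂ = ((‖A x‖ ^ 2 : ℝ) : ℂ) := by
  rw [mul_apply_eq_comp, ContinuousLinearMap.star_eq_adjoint,
    ContinuousLinearMap.adjoint_inner_right, inner_self_eq_norm_sq_to_K]
  norm_cast

/-- `‖A‖²` in Hilbert–Schmidt norm, computed in any basis. -/
theorem IsHilbertSchmidt.opTrace_star_mul_self {A : E →L[ℂ] E} (hA : IsHilbertSchmidt A)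
    (b : HilbertBasis ι ℂ E) : opTrace (star A * A) = ((∑' i, ‖A (b i)‖ ^ 2 : ℝ) : ℂ) := by
  rw [hA.opTrace_star_mul hA b, Complex.ofReal_tsum]
  refine tsum_congr fun i => ?_
  rw [inner_self_eq_norm_sq_to_K]
  norm_cast

theorem isTraceClass_star_mul_self_iff (A : E →L[ℂ] E) :
    IsTraceClass (star A * A) ↔ IsHilbertSchmidt A := by
  rw [IsTraceClass, CFC.abs_of_nonneg _ (star_mul_self_nonneg A)]
  simp only [inner_star_mul_self]
  exact Complex.summable_ofReal

/-- Every positive trace class operator is the square of a positive Hilbert–Schmidt operator. -/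
theorem exists_sqrt_of_isTraceClass {A : E →L[ℂ] E} (hA : 0 ≤ A) (h : IsTraceClass A) :
    ∃ D : E →L[ℂ] E, 0 ≤ D ∧ star D = D ∧ D * D = A ∧ IsHilbertSchmidt D := by
  have h0 : 0 ≤ CFC.sqrt A := CFC.sqrt_nonneg A
  have h1 : star (CFC.sqrt A) = CFC.sqrt A := (IsSelfAdjoint.of_nonneg h0).star_eq
  have h2 : CFC.sqrt A * CFC.sqrt A = A := CFC.sqrt_mul_sqrt_self A hA
  refine ⟨CFC.sqrt A, h0, h1, h2, ?_⟩
  rw [← isTraceClass_star_mul_self_iff, h1, h2]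
  exact h

/-- `|tr (D* D B)| ≤ ‖B‖ tr (D* D)`. -/
theorem IsHilbertSchmidt.norm_opTrace_star_mul_self_mul_le {D : E →L[ℂ] E}
    (hD : IsHilbertSchmidt D) (B : E →L[ℂ] E) :
    ‖opTrace (star D * D * B)‖ ≤ ‖B‖ * (opTrace (star D * D)).re := by
  -- Passing to adjoints turns the summands into ⟪B* D* b, D* b⟫, in which `B` is sandwiched and can
  -- be bounded by its norm.
  rw [mul_assoc, ← star_star D, hD.adj.adj.opTrace_star_mul (hD.adj.adj.rmul B)
    (hilbertBasis E), star_star, hD.tsum_inner_eq (hD.rmul B) _ (hilbertBasis E),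
    hD.opTrace_star_mul_self (hilbertBasis E), Complex.ofReal_re, ← tsum_mul_left]
  have hs := hD.adj.summable (hilbertBasis E)
  have e : ∑' i, ‖B‖ * ‖D (hilbertBasis E i)‖ ^ 2 =
      ∑' i, ‖B‖ * ‖star D (hilbertBasis E i)‖ ^ 2 := by
    rw [tsum_mul_left, tsum_mul_left]
    congr 1
    have := hD.tsum_inner_eq hD (hilbertBasis E) (hilbertBasis E)
    simp only [inner_self_eq_norm_sq_to_K] at this
    exact_mod_cast this
  rw [e]
  refine tsum_of_norm_bounded (hs.mul_left ‖B‖).hasSum fun i => ?_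
  refine (norm_inner_le_norm _ _).trans ?_
  rw [star_mul, mul_apply_eq_comp]
  have := (star B).le_opNorm (star D (hilbertBasis E i))
  rw [norm_star] at this
  nlinarith [norm_nonneg (star D (hilbertBasis E i))]

-- After passing to adjoints the trace is the sum of the expectations of `B` in the vectors D* b.
open scoped ComplexOrder in
theorem IsHilbertSchmidt.opTrace_star_mul_self_mul_nonneg {D : E →L[ℂ] E}
    (hD : IsHilbertSchmidt D) {B : E →L[ℂ] E} (hB : 0 ≤ B) :
    0 ≤ opTrace (star D * D * B) := by
  rw [mul_assoc, hD.opTrace_star_mul (hD.rmul B)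
    (hilbertBasis E), hD.tsum_inner_eq (hD.rmul B) _ (hilbertBasis E)]
  refine tsum_nonneg fun i => ?_
  rw [star_mul, mul_apply_eq_comp, (IsSelfAdjoint.of_nonneg hB).star_eq]
  exact ((ContinuousLinearMap.nonneg_iff_isPositive B).mp hB).inner_nonneg_left _

end HilbertSchmidt

/-! ### Operators on Hilbert space tensor powers -/

section TensorOperators

variable {H : Type*} [NormedAddCommGroup H] [InnerProductSpace ℂ H] {n : ℕ}

theorem ext_on_tprod {E : Type*} [NormedAddCommGroup E] [InnerProductSpace ℂ E]
    {A B : HTensor H n →L[ℂ] E} (h : ∀ x, A (tprod x) = B (tprod x)) : A = B := by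
  have : (A : HTensor H n → E) = B := by
    refine denseRange_tprod.equalizer A.continuous B.continuous (funext fun c => ?_)
    simp [Finsupp.linearCombination_apply, Finsupp.sum, h]
  exact DFunLike.coe_injective this

theorem ext_inner_tprod {u v : HTensor H n} (h : ∀ x, ⟪tprod x, u⟫_ℂ = ⟪tprod x, v⟫_ℂ) :
    u = v := by
  have h' : innerSL ℂ u = innerSL ℂ v := ext_on_tprod fun x => by
    have := congrArg (starRingEnd ℂ) (h x)
    simpa using this
  exact (innerSL_inj (𝕜 := ℂ)).mp h'

theorem ext_inner_tprod_apply {A B : HTensor H n →L[ℂ] HTensor H n}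
    (h : ∀ x y, ⟪tprod x, A (tprod y)⟫_ℂ = ⟪tprod x, B (tprod y)⟫_ℂ) : A = B :=
  ext_on_tprod fun y => ext_inner_tprod fun x => h x y

theorem inner_tprod_update (z x : Fin n → H) (j : Fin n) (y : H) :
    ⟪tprod z, tprod (Function.update x j y)⟫_ℂ =
      ⟪z j, y⟫_ℂ * ∏ i ∈ Finset.univ.erase j, ⟪z i, x i⟫_ℂ := by
  rw [inner_tprod, ← Finset.mul_prod_erase _ _ (Finset.mem_univ j), Function.update_self]
  congr 1
  exact Finset.prod_congr rfl fun i hi => by rw [Function.update_of_ne (Finset.ne_of_mem_erase hi)]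

theorem norm_tprod (x : Fin n → H) : ‖tprod x‖ = ∏ i, ‖x i‖ := by
  have h : ‖tprod x‖ ^ 2 = (∏ i, ‖x i‖) ^ 2 := by
    have := inner_tprod x x
    simp only [inner_self_eq_norm_sq_to_K, Finset.prod_pow] at this
    exact_mod_cast this
  exact (sq_eq_sq₀ (norm_nonneg _) (by positivity)).mp h

/-- The product vector as a function of its `j`-th factor. -/
noncomputable def tprodUpdate (x : Fin n → H) (j : Fin n) : H →L[ℂ] HTensor H n :=
  LinearMap.mkContinuous
    { toFun := fun y => tprod (Function.update x j y)
      map_add' := fun y y' => ext_inner_tprod fun z => by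
        simp only [inner_add_right, inner_tprod_update, add_mul]
      map_smul' := fun c y => ext_inner_tprod fun z => by
        simp only [inner_smul_right, inner_tprod_update, RingHom.id_apply, mul_assoc] }
    (∏ i ∈ Finset.univ.erase j, ‖x i‖) fun y => le_of_eq <| by
      change ‖tprod (Function.update x j y)‖ = _
      rw [norm_tprod, ← Finset.mul_prod_erase _ _ (Finset.mem_univ j), Function.update_self,
        mul_comm]
      congr 1
      exact Finset.prod_congr rfl fun i hi => by
        rw [Function.update_of_ne (Finset.ne_of_mem_erase hi)]

theorem tprodUpdate_apply (x : Fin n → H) (j : Fin n) (y : H) :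
    tprodUpdate x j y = tprod (Function.update x j y) := rfl

theorem orthonormal_tprod {κ : Type*} {b : κ → H} (hb : Orthonormal ℂ b) :
    Orthonormal ℂ fun I : Fin n → κ => tprod fun l => b (I l) := by
  classical
  rw [orthonormal_iff_ite] at hb ⊢
  intro I J
  rw [inner_tprod]
  simp only [hb]
  by_cases h : I = J
  · simp [h]
  · rw [if_neg h]
    obtain ⟨l, hl⟩ := Function.ne_iff.mp h
    exact Finset.prod_eq_zero (Finset.mem_univ l) (if_neg hl)

/-- One slot at a time: `t` is the set of slots with arbitrary entries, and a new slot is freed by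
expanding its entry in the basis, using that a product vector is linear and continuous in each
factor. -/
theorem inner_tprod_eq_zero_of_basis {κ : Type*} (b : HilbertBasis κ ℂ H) {u : HTensor H n}
    (hu : ∀ I : Fin n → κ, ⟪u, tprod fun l => b (I l)⟫_ℂ = 0) (x : Fin n → H) :
    ⟪u, tprod x⟫_ℂ = 0 := by
  classical
  suffices ∀ (t : Finset (Fin n)) (x : Fin n → H), (∀ l ∉ t, ∃ i, x l = b i) →
      ⟪u, tprod x⟫_ℂ = 0 from this Finset.univ x fun l hl => absurd (Finset.mem_univ l) hl
  intro t
  induction t using Finset.induction_on with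
  | empty =>
    intro x hx
    choose I hI using fun l => hx l (Finset.notMem_empty l)
    rw [funext hI]
    exact hu I
  | insert j t hj ih =>
    intro x hx
    have h1 := (b.hasSum_repr (x j)).mapL ((innerSL ℂ u) ∘L (tprodUpdate x j))
    have h2 : ∀ i, (innerSL ℂ u ∘L tprodUpdate x j) (b.repr (x j) i • b i) = 0 := fun i => by
      rw [map_smul, ContinuousLinearMap.comp_apply, tprodUpdate_apply, innerSL_apply_apply,
        ih, smul_zero]
      intro l hl
      by_cases hlj : l = j
      · exact ⟨i, by simp [hlj]⟩
      · rw [Function.update_of_ne hlj]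
        exact hx l (by simp [hlj, hl])
    simp only [h2] at h1
    have h3 := h1.unique hasSum_zero
    rwa [ContinuousLinearMap.comp_apply, tprodUpdate_apply, innerSL_apply_apply,
      Function.update_eq_self] at h3

/-- The product basis of a tensor power. -/
noncomputable def productBasis {κ : Type*} (b : HilbertBasis κ ℂ H) (n : ℕ) :
    HilbertBasis (Fin n → κ) ℂ (HTensor H n) :=
  HilbertBasis.mkOfOrthogonalEqBot (orthonormal_tprod b.orthonormal) <| by
    rw [Submodule.eq_bot_iff]
    intro u hu
    have h : ∀ x, ⟪u, tprod x⟫_ℂ = 0 := inner_tprod_eq_zero_of_basis b fun I =>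
      Submodule.mem_orthogonal' _ _ |>.mp hu _ (Submodule.subset_span ⟨I, rfl⟩)
    refine ext_inner_tprod fun x => ?_
    rw [inner_zero_right, ← inner_conj_symm, h, map_zero]

theorem productBasis_apply {κ : Type*} (b : HilbertBasis κ ℂ H) (I : Fin n → κ) :
    productBasis b n I = tprod fun l => b (I l) := by
  rw [productBasis, HilbertBasis.coe_mkOfOrthogonalEqBot]

theorem tensorMap_mul (A B : Fin n → H →L[ℂ] H) :
    tensorMap A * tensorMap B = tensorMap fun i => A i * B i :=
  ext_on_tprod fun x => by simp only [mul_apply_eq_comp, tensorMap_tprod]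

theorem tensorMap_one : tensorMap (fun _ : Fin n => (1 : H →L[ℂ] H)) = 1 :=
  ext_on_tprod fun x => by simp [tensorMap_tprod]

theorem star_tensorMap [CompleteSpace H] (A : Fin n → H →L[ℂ] H) :
    star (tensorMap A) = tensorMap fun i => star (A i) :=
  ext_inner_tprod_apply fun x y => by
    rw [ContinuousLinearMap.star_eq_adjoint, ContinuousLinearMap.adjoint_inner_right,
      tensorMap_tprod, tensorMap_tprod, inner_tprod, inner_tprod]
    exact Finset.prod_congr rfl fun i _ => by
      rw [ContinuousLinearMap.star_eq_adjoint, ContinuousLinearMap.adjoint_inner_right]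

/-- Substitution of indices is contravariant, hence the reversed order. -/
theorem permOp_mul (π τ : Equiv.Perm (Fin n)) :
    (permOp π * permOp τ : HTensor H n →L[ℂ] HTensor H n) = permOp (τ * π) :=
  ext_on_tprod fun x => by simp only [mul_apply_eq_comp, permOp_tprod, Equiv.Perm.mul_apply]

theorem star_permOp (π : Equiv.Perm (Fin n)) :
    star (permOp π : HTensor H n →L[ℂ] HTensor H n) = permOp π⁻¹ :=
  ext_inner_tprod_apply fun x y => by
    rw [ContinuousLinearMap.star_eq_adjoint, ContinuousLinearMap.adjoint_inner_right,
      permOp_tprod, permOp_tprod, inner_tprod, inner_tprod,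
      ← Equiv.prod_comp π fun i => ⟪x i, y (π⁻¹ i)⟫_ℂ]
    simp

theorem permOp_mul_tensorMap (π : Equiv.Perm (Fin n)) (A : Fin n → H →L[ℂ] H) :
    permOp π * tensorMap A = tensorMap (fun i => A (π i)) * permOp π :=
  ext_on_tprod fun x => by simp only [mul_apply_eq_comp, permOp_tprod, tensorMap_tprod]

/-- The factor `s^π` attached to a permutation of an arbitrary finite set. -/
noncomputable def permWeight {ι : Type*} [Fintype ι] [DecidableEq ι] (s : ℤˣ)
    (π : Equiv.Perm ι) : ℂ :=
  (((if s = 1 then 1 else Equiv.Perm.sign π : ℤˣ) : ℤ) : ℂ)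

theorem permWeight_mul {ι : Type*} [Fintype ι] [DecidableEq ι] (s : ℤˣ) (π τ : Equiv.Perm ι) :
    permWeight s (π * τ) = permWeight s π * permWeight s τ := by
  unfold permWeight
  split_ifs <;> simp

theorem permWeight_inv {ι : Type*} [Fintype ι] [DecidableEq ι] (s : ℤˣ) (π : Equiv.Perm ι) :
    permWeight s π⁻¹ = permWeight s π := by
  unfold permWeight
  split_ifs <;> simp

theorem permWeight_mul_self {ι : Type*} [Fintype ι] [DecidableEq ι] (s : ℤˣ)
    (π : Equiv.Perm ι) : permWeight s π * permWeight s π = 1 := by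
  unfold permWeight
  rw [← Int.cast_mul, ← Units.val_mul, Int.units_mul_self]
  simp

theorem star_permWeight {ι : Type*} [Fintype ι] [DecidableEq ι] (s : ℤˣ) (π : Equiv.Perm ι) :
    star (permWeight s π) = permWeight s π := by
  simp [permWeight]

theorem symProj_eq (s : ℤˣ) :
    symProj H s n = (n.factorial : ℂ)⁻¹ • ∑ π, permWeight s π • permOp π := rfl

theorem star_symProj (s : ℤˣ) : star (symProj H s n) = symProj H s n := by
  rw [symProj_eq, star_smul, star_sum]
  simp only [star_smul, star_permWeight, star_permOp, star_inv₀, star_natCast]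
  congr 1
  refine Fintype.sum_equiv (Equiv.inv _) _ _ fun π => ?_
  simp [permWeight_inv]

theorem permOp_mul_symProj (s : ℤˣ) (π : Equiv.Perm (Fin n)) :
    permOp π * symProj H s n = permWeight s π • symProj H s n := by
  rw [symProj_eq, mul_smul_comm, smul_comm]
  congr 1
  rw [Finset.mul_sum, Finset.smul_sum]
  refine Fintype.sum_equiv (Equiv.mulRight π) _ _ fun τ => ?_
  rw [mul_smul_comm, permOp_mul, smul_smul, Equiv.coe_mulRight, permWeight_mul, mul_comm, mul_assoc,
    permWeight_mul_self, mul_one]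

theorem symProj_mul_self (s : ℤˣ) : symProj H s n * symProj H s n = symProj H s n := by
  conv_lhs => enter [1]; rw [symProj_eq]
  rw [smul_mul_assoc, Finset.sum_mul]
  simp only [smul_mul_assoc, permOp_mul_symProj, smul_smul, permWeight_mul_self, one_smul]
  rw [Finset.sum_const, Finset.card_univ, Fintype.card_perm, Fintype.card_fin,
    ← Nat.cast_smul_eq_nsmul ℂ, smul_smul, inv_mul_cancel₀, one_smul]
  exact_mod_cast n.factorial_ne_zero

theorem symProj_mul_tensorMap (s : ℤˣ) (A : H →L[ℂ] H) :
    symProj H s n * tensorMap (fun _ => A) = tensorMap (fun _ => A) * symProj H s n := by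
  rw [symProj_eq, smul_mul_assoc, mul_smul_comm, Finset.sum_mul, Finset.mul_sum]
  simp only [smul_mul_assoc, mul_smul_comm, permOp_mul_tensorMap]

theorem secondQuant_eq (s : ℤˣ) (A : H →L[ℂ] H) :
    secondQuant s A n = symProj H s n * tensorMap fun _ => A := by
  rw [secondQuant, symProj_mul_tensorMap, mul_assoc, symProj_mul_self]

/-- This displays the n-particle component as Q*Q with Q Hilbert–Schmidt, the form in which traces,
positivity and norm bounds are accessible. -/
theorem secondQuant_star_mul_self [CompleteSpace H] (s : ℤˣ) (D : H →L[ℂ] H) :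
    secondQuant s (star D * D) n =
      star (tensorMap (fun _ => D) * symProj H s n) * (tensorMap (fun _ => D) * symProj H s n) := by
  rw [secondQuant, ← tensorMap_mul, star_mul, star_symProj, star_tensorMap]
  simp only [mul_assoc]

end TensorOperators

/-! ### Products of summable families -/

theorem summable_prod_pi {ι κ : Type*} [Fintype ι] {g : ι → κ → ℝ} (hg0 : ∀ l i, 0 ≤ g l i)
    (hg : ∀ l, Summable (g l)) : Summable fun I : ι → κ => ∏ l, g l (I l) := by
  -- The index type and its `Fintype` instance are generalised for the induction on finite types; a
  -- product over `Option α` splits off one factor.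
  suffices ∀ (ι : Type _) [Finite ι] [Fintype ι] (g : ι → κ → ℝ), (∀ l i, 0 ≤ g l i) →
      (∀ l, Summable (g l)) → Summable fun I : ι → κ => ∏ l, g l (I l) from this ι g hg0 hg
  clear hg hg0 g
  intro ι hι
  induction ι using Finite.induction_empty_option with
  | of_equiv e ih =>
    intro _ g hg0 hg
    have := Fintype.ofEquiv _ e.symm
    have h := ih (fun l => g (e l)) (fun l => hg0 _) fun l => hg _
    refine (Equiv.summable_iff (Equiv.arrowCongr e (Equiv.refl κ))).mp (h.congr fun I => ?_)
    simp only [Function.comp_apply]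
    rw [← Equiv.prod_comp e]
    simp
  | h_empty =>
    intro _ g hg0 hg
    exact Summable.of_finite
  | @h_option α _ ih =>
    intro i g hg0 hg
    obtain rfl : i = instFintypeOption := Subsingleton.elim _ _
    have h := ih (fun l => g (some l)) (fun l => hg0 _) fun l => hg _
    refine (Equiv.summable_iff (Equiv.piOptionEquivProd (β := fun _ => κ)).symm).mp ?_
    refine ((hg none).mul_of_nonneg h (fun i => hg0 _ _) fun I =>
      Finset.prod_nonneg fun l _ => hg0 _ _).congr fun I => ?_
    simp [Fintype.prod_option]

/-! ### Nuclear operators -/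

section Nuclear

variable {H : Type*} [NormedAddCommGroup H] [InnerProductSpace ℂ H] [CompleteSpace H]

/-- `A` is a product of two Hilbert–Schmidt operators. -/
def IsNuclear (A : H →L[ℂ] H) : Prop :=
  ∃ B C, IsHilbertSchmidt B ∧ IsHilbertSchmidt C ∧ A = B * C

theorem IsNuclear.rmul {A : H →L[ℂ] H} (hA : IsNuclear A) (X : H →L[ℂ] H) :
    IsNuclear (A * X) := by
  obtain ⟨B, C, hB, hC, rfl⟩ := hA
  exact ⟨B, C * X, hB, hC.rmul X, by rw [mul_assoc]⟩

theorem IsNuclear.summable {A : H →L[ℂ] H} (hA : IsNuclear A) {κ : Type*}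
    (b : HilbertBasis κ ℂ H) : Summable fun i => ⟪b i, A (b i)⟫_ℂ := by
  obtain ⟨B, C, hB, hC, rfl⟩ := hA
  refine (hB.adj.summable_inner hC b).congr fun i => ?_
  rw [ContinuousLinearMap.star_eq_adjoint, ContinuousLinearMap.adjoint_inner_left,
    mul_apply_eq_comp]

/-! ### Sums over permutations of products of traces -/

variable {ι : Type*} [Fintype ι]

/-- With A_l = B_l C_l, each factor is at most ‖B_l* b_{I l}‖ ‖C_l b_{I(π l)}‖. Regrouping the
second factors along π gives a product of functions of the single indices I l, each of them summable
as a product of two square summable families. -/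
theorem summable_prod_inner {A : ι → H →L[ℂ] H} (hA : ∀ l, IsNuclear (A l))
    {κ : Type*} (b : HilbertBasis κ ℂ H) (π : Equiv.Perm ι) :
    Summable fun I : ι → κ => ∏ l, ⟪b (I l), A l (b (I (π l)))⟫_ℂ := by
  choose B C hB hC hBC using hA
  refine Summable.of_norm_bounded (summable_prod_pi
    (g := fun l i => ‖star (B l) (b i)‖ * ‖C (π⁻¹ l) (b i)‖) (fun l i => by positivity)
    fun l => (hB l).adj.summable_norm_mul (hC _) b) fun I => ?_
  rw [norm_prod, Finset.prod_mul_distrib, ← Equiv.prod_comp π fun l => ‖C (π⁻¹ l) (b (I l))‖,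
    ← Finset.prod_mul_distrib]
  refine Finset.prod_le_prod (fun _ _ => norm_nonneg _) fun l _ => ?_
  rw [hBC, mul_apply_eq_comp, ← ContinuousLinearMap.adjoint_inner_left,
    ← ContinuousLinearMap.star_eq_adjoint, show π⁻¹ (π l) = l from π.symm_apply_apply l]
  exact norm_inner_le_norm _ _

variable [DecidableEq ι]

/-- `∑_π s^π` times the product over the cycles `(l₁ … l_r)` of `π` of
`tr (A l₁ ⋯ A l_r)`. -/
noncomputable def permTrace (s : ℤˣ) (A : ι → H →L[ℂ] H) : ℂ :=
  ∑ π : Equiv.Perm ι, permWeight s π * ∑' I : ι → basisIndex H,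
    ∏ l, ⟪hilbertBasis H (I l), A l (hilbertBasis H (I (π l)))⟫_ℂ

theorem permTrace_isEmpty [IsEmpty ι] (s : ℤˣ) (A : ι → H →L[ℂ] H) : permTrace s A = 1 := by
  simp [permTrace, permWeight]

theorem permTrace_comp_equiv {ι' : Type*} [Fintype ι'] [DecidableEq ι'] (s : ℤˣ) (f : ι ≃ ι')
    (A : ι' → H →L[ℂ] H) : permTrace s (fun l => A (f l)) = permTrace s A := by
  refine Fintype.sum_equiv f.permCongr _ _ fun π => ?_
  congr 1
  · simp [permWeight]
  · rw [← Equiv.tsum_eq (Equiv.arrowCongr f (Equiv.refl (basisIndex H)))]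
    refine tsum_congr fun I => ?_
    rw [← Equiv.prod_comp f]
    simp

/-- `decomposeOption` factors a permutation into an extension of `e` and a swap of the adjoined
point with `p`; only a nontrivial swap contributes a factor `s`. -/
theorem permWeight_decomposeOption (s : ℤˣ) (e : Equiv.Perm ι) (p : Option ι) :
    permWeight s (Equiv.Perm.decomposeOption.symm (p, e)) =
      if p = none then permWeight s e else ((s : ℤ) : ℂ) * permWeight s e := by
  rcases p with _ | q
  · simp [permWeight]
  · rcases Int.units_eq_one_or s with rfl | rfl
    · simp [permWeight]
    · simp [permWeight]

theorem tsum_decomposeOption_none {A : Option ι → H →L[ℂ] H} (hA : ∀ l, IsNuclear (A l))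
    {κ : Type*} (b : HilbertBasis κ ℂ H) (e : Equiv.Perm ι) :
    ∑' I : Option ι → κ, ∏ l, ⟪b (I l),
      A l (b (I (Equiv.Perm.decomposeOption.symm (none, e) l)))⟫_ℂ =
    (∑' i, ⟪b i, A none (b i)⟫_ℂ) *
      ∑' I : ι → κ, ∏ l, ⟪b (I l), A (some l) (b (I (e l)))⟫_ℂ := by
  rw [← Equiv.tsum_eq (Equiv.piOptionEquivProd (β := fun _ => κ)).symm,
    tsum_mul_tsum_of_summable_norm ((hA none).summable b).norm
      (summable_prod_inner (fun l => hA (some l)) b e).norm]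
  refine tsum_congr fun I => ?_
  simp [Fintype.prod_option]

/-- The permutation inserts the adjoined point into a cycle of `e`, as x → none → e x. Summation
over the index at `none` is Parseval's identity, which composes `A (some x)` with `A none`. -/
theorem tsum_decomposeOption_some {A : Option ι → H →L[ℂ] H} (hA : ∀ l, IsNuclear (A l))
    {κ : Type*} (b : HilbertBasis κ ℂ H) (e : Equiv.Perm ι) (x : ι) :
    ∑' I : Option ι → κ, ∏ l, ⟪b (I l),
      A l (b (I (Equiv.Perm.decomposeOption.symm (some (e x), e) l)))⟫_ℂ =
    ∑' I : ι → κ, ∏ l, ⟪b (I l),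
      Function.update (fun l => A (some l)) x (A (some x) * A none) l (b (I (e l)))⟫_ℂ := by
  have hs := summable_prod_inner hA b (Equiv.Perm.decomposeOption.symm (some (e x), e))
  let E : κ × (ι → κ) ≃ (Option ι → κ) := (Equiv.piOptionEquivProd (β := fun _ => κ)).symm
  have hs' := ((Equiv.summable_iff E).mpr hs).prod_symm
  rw [← Equiv.tsum_eq E, ← Equiv.tsum_eq (Equiv.prodComm (ι → κ) κ)]
  refine hs'.tsum_prod.trans (tsum_congr fun I => ?_)
  rw [← Finset.mul_prod_erase _ _ (Finset.mem_univ x), Function.update_self, mul_apply_eq_comp,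
    ← ContinuousLinearMap.adjoint_inner_left, ← b.tsum_inner_mul_inner, ← tsum_mul_right]
  refine tsum_congr fun i => ?_
  rw [Function.comp_apply, Fintype.prod_option, ← Finset.mul_prod_erase _ _ (Finset.mem_univ x)]
  have h1 : ∀ y ∈ Finset.univ.erase x,
      (Equiv.Perm.decomposeOption.symm (some (e x), e)) (some y) = some (e y) := fun y hy => by
    simp [Equiv.swap_apply_def, Finset.ne_of_mem_erase hy]
  have h2 : (Equiv.Perm.decomposeOption.symm (some (e x), e)) (some x) = none := by simp
  have h3 : (Equiv.Perm.decomposeOption.symm (some (e x), e)) none = some (e x) := by simp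
  have h4 : ∏ y ∈ Finset.univ.erase x, ⟪b (E (i, I) (some y)), A (some y) (b (E (i, I)
        ((Equiv.Perm.decomposeOption.symm (some (e x), e)) (some y))))⟫_ℂ =
      ∏ y ∈ Finset.univ.erase x, ⟪b (I y), Function.update (fun l => A (some l)) x
        (A (some x) * A none) y (b (I (e y)))⟫_ℂ :=
    Finset.prod_congr rfl fun y hy => by
      rw [h1 y hy, Function.update_of_ne (Finset.ne_of_mem_erase hy)]
      rfl
  refine Eq.trans (congrArg _ (congrArg _ h4)) ?_
  rw [h2, h3, ContinuousLinearMap.adjoint_inner_left]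
  change ⟪b i, A none (b (I (e x)))⟫_ℂ * (⟪b (I x), A (some x) (b i)⟫_ℂ * _) = _
  ring

/-- Expansion of a `permTrace` with respect to one of the operators. -/
theorem permTrace_option (s : ℤˣ) {A : Option ι → H →L[ℂ] H} (hA : ∀ l, IsNuclear (A l)) :
    permTrace s A = opTrace (A none) * permTrace s (fun l => A (some l)) +
      ((s : ℤ) : ℂ) * ∑ x, permTrace s
        (Function.update (fun l => A (some l)) x (A (some x) * A none)) := by
  unfold permTrace
  rw [← Equiv.sum_comp Equiv.Perm.decomposeOption.symm, Fintype.sum_prod_type_right]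
  simp only [Fintype.sum_option, permWeight_decomposeOption, if_true, reduceCtorEq, if_false,
    tsum_decomposeOption_none hA, Finset.sum_add_distrib]
  congr 1
  · rw [Finset.mul_sum]
    exact Finset.sum_congr rfl fun e _ => mul_left_comm _ _ _
  · conv_rhs => rw [Finset.sum_comm, Finset.mul_sum]
    refine Finset.sum_congr rfl fun e _ => ?_
    -- The image of the adjoined point is written as `e x`, where `x` is the point preceding `none`
    -- in its cycle.
    rw [← Equiv.sum_comp e, Finset.mul_sum]
    refine Finset.sum_congr rfl fun x _ => ?_
    rw [tsum_decomposeOption_some hA, mul_assoc]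

end Nuclear

/-! ### Traces of second quantized operators -/

section FockTraces

variable {H : Type*} [NormedAddCommGroup H] [InnerProductSpace ℂ H] [CompleteSpace H] {n : ℕ}

omit [CompleteSpace H] in
theorem tensorMap_update_one_tprod (j : Fin n) (A : H →L[ℂ] H) (x : Fin n → H) :
    tensorMap (Function.update (fun _ => (1 : H →L[ℂ] H)) j A) (tprod x) =
      tprodUpdate x j (A (x j)) := by
  rw [tensorMap_tprod, tprodUpdate_apply]
  congr 1
  funext i
  by_cases h : i = j
  · subst h; simp
  · simp [h]

/-- `A ↦ 1 ⊗ ⋯ ⊗ A ⊗ ⋯ ⊗ 1`, with `A` in the `j`-th factor. -/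
noncomputable def slotHom (j : Fin n) :
    (H →L[ℂ] H) →⋆ₐ[ℂ] (HTensor H n →L[ℂ] HTensor H n) where
  toFun A := tensorMap (Function.update (fun _ => 1) j A)
  map_one' := by
    rw [Function.update_eq_self_iff.mpr rfl, tensorMap_one]
  map_mul' A B := by
    rw [tensorMap_mul]
    congr 1
    funext i
    by_cases h : i = j
    · subst h; simp
    · simp [h]
  map_zero' := ext_on_tprod fun x => by
    rw [tensorMap_update_one_tprod]; simp
  map_add' A B := ext_on_tprod fun x => by
    simp only [tensorMap_update_one_tprod, add_apply, map_add]
  commutes' r := ext_on_tprod fun x => by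
    rw [tensorMap_update_one_tprod, Algebra.algebraMap_eq_smul_one, Algebra.algebraMap_eq_smul_one]
    simp [tprodUpdate_apply]
  map_star' A := by
    rw [star_tensorMap]
    congr 1
    funext i
    by_cases h : i = j
    · subst h; simp
    · simp [h]

theorem slotHom_apply (j : Fin n) (A : H →L[ℂ] H) :
    slotHom j A = tensorMap (Function.update (fun _ => 1) j A) := rfl

/-- The product operator is a product of operators acting in single slots, and `slotHom`, as a star
homomorphism of C*-algebras, is contractive. -/
theorem norm_tensorMap_le (A : Fin n → H →L[ℂ] H) : ‖tensorMap A‖ ≤ ∏ i, ‖A i‖ := by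
  classical
  suffices ∀ t : Finset (Fin n),
      ‖tensorMap fun i => if i ∈ t then A i else 1‖ ≤ ∏ i ∈ t, ‖A i‖ by
    simpa using this Finset.univ
  intro t
  induction t using Finset.induction_on with
  | empty =>
    simp only [Finset.notMem_empty, if_false, tensorMap_one, Finset.prod_empty]
    exact ContinuousLinearMap.norm_id_le
  | insert j t hj ih =>
    have e : (tensorMap fun i => if i ∈ insert j t then A i else 1) =
        slotHom j (A j) * tensorMap fun i => if i ∈ t then A i else 1 := by
      rw [slotHom_apply, tensorMap_mul]
      congr 1
      funext i
      by_cases h : i = j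
      · subst h; simp [hj]
      · simp [h]
    rw [e, Finset.prod_insert hj]
    refine (norm_mul_le _ _).trans (mul_le_mul ?_ ih (norm_nonneg _) (norm_nonneg _))
    exact NonUnitalStarAlgHom.norm_apply_le (slotHom j) (A j)

theorem IsHilbertSchmidt.tensorMap {D : H →L[ℂ] H} (hD : IsHilbertSchmidt D) (n : ℕ) :
    IsHilbertSchmidt (tensorMap fun _ : Fin n => D) := by
  refine isHilbertSchmidt_of_summable (productBasis (hilbertBasis H) n) ?_
  refine (summable_prod_pi (ι := Fin n) (g := fun _ i => ‖D (hilbertBasis H i)‖ ^ 2)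
    (fun _ _ => by positivity) fun _ => hD).congr fun I => ?_
  rw [productBasis_apply, tensorMap_tprod, norm_tprod, Finset.prod_pow]

theorem IsHilbertSchmidt.isNuclear {D : H →L[ℂ] H} (hD : IsHilbertSchmidt D) :
    IsNuclear (star D * D) := ⟨_, _, hD.adj, hD, rfl⟩

/-- The bridge from Fock space to `permTrace`: the trace of Q*Q X is evaluated in the product basis
as the trace of P_s (σX_1 ⊗ ⋯ ⊗ σX_n), one permutation at a time. -/
theorem opTrace_secondQuant_mul_tensorMap (s : ℤˣ) {D : H →L[ℂ] H} (hD : IsHilbertSchmidt D)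
    (X : Fin n → H →L[ℂ] H) :
    opTrace (secondQuant s (star D * D) n * tensorMap X) =
      (n.factorial : ℂ)⁻¹ * permTrace s fun l => star D * D * X l := by
  have hQ : IsHilbertSchmidt (tensorMap (fun _ => D) * symProj H s n) := (hD.tensorMap n).rmul _
  have hA : ∀ l, IsNuclear (star D * D * X l) := fun l => hD.isNuclear.rmul _
  set A : Fin n → H →L[ℂ] H := fun l => star D * D * X l with hAdef
  rw [secondQuant_star_mul_self, mul_assoc,
    hQ.opTrace_star_mul (hQ.rmul _) (productBasis (hilbertBasis H) n)]
  have e1 : ∀ v : HTensor H n,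
      ⟪(tensorMap (fun _ => D) * symProj H s n : HTensor H n →L[ℂ] HTensor H n) v,
      (tensorMap (fun _ => D) * symProj H s n * tensorMap X : HTensor H n →L[ℂ] HTensor H n) v⟫_ℂ =
      (n.factorial : ℂ)⁻¹ * ∑ π, permWeight s π * ⟪v, permOp π (tensorMap A v)⟫_ℂ := fun v => by
    have e2 : star (tensorMap (fun _ => D) * symProj H s n) *
        (tensorMap (fun _ => D) * symProj H s n * tensorMap X) =
        symProj H s n * tensorMap A := by
      rw [← mul_assoc, ← secondQuant_star_mul_self, secondQuant_eq, mul_assoc, tensorMap_mul]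
    rw [← ContinuousLinearMap.adjoint_inner_right, ← ContinuousLinearMap.star_eq_adjoint,
      ← mul_apply_eq_comp, e2, symProj_eq]
    simp [Finset.sum_mul, inner_smul_right, inner_sum]
  simp only [e1]
  rw [tsum_mul_left]
  congr 1
  have hπ : ∀ π : Equiv.Perm (Fin n), HasSum (fun I : Fin n → basisIndex H =>
      ⟪productBasis (hilbertBasis H) n I, permOp π (tensorMap A
        (productBasis (hilbertBasis H) n I))⟫_ℂ)
      (∑' J : Fin n → basisIndex H, ∏ l, ⟪hilbertBasis H (J l),
        A l (hilbertBasis H (J (π l)))⟫_ℂ) := fun π => by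
    -- The diagonal entry at `I` pairs b_{I l} with A_{π l} b_{I(π l)}; the substitution I = J ∘ π
    -- brings it to the form used in `permTrace`.
    have h := (Equiv.hasSum_iff (Equiv.arrowCongr π (Equiv.refl (basisIndex H)))).mpr
      (summable_prod_inner hA (hilbertBasis H) π).hasSum
    refine h.congr_fun fun I => ?_
    rw [productBasis_apply, tensorMap_tprod, permOp_tprod, inner_tprod, Function.comp_apply]
    conv_rhs => rw [← Equiv.prod_comp π]
    simp [hAdef]
  exact (hasSum_sum fun π _ => (hπ π).mul_left (permWeight s π)).tsum_eq

open scoped ComplexOrder in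
theorem permTrace_tensor_nonneg (s : ℤˣ) {D : H →L[ℂ] H} (hD : IsHilbertSchmidt D)
    {X : Fin n → H →L[ℂ] H} (hX : 0 ≤ tensorMap X) :
    0 ≤ permTrace s fun l => star D * D * X l := by
  have hQ : IsHilbertSchmidt (tensorMap (fun _ => D) * symProj H s n) := (hD.tensorMap n).rmul _
  have h := hQ.opTrace_star_mul_self_mul_nonneg hX
  rw [← secondQuant_star_mul_self, opTrace_secondQuant_mul_tensorMap s hD] at h
  have h2 := mul_nonneg (Nat.cast_nonneg (α := ℂ) n.factorial) h
  rwa [mul_inv_cancel_left₀ (by exact_mod_cast n.factorial_ne_zero)] at h2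

open scoped ComplexOrder in
theorem permTrace_const_nonneg (s : ℤˣ) {D : H →L[ℂ] H} (hD : IsHilbertSchmidt D)
    (ι : Type*) [Fintype ι] [DecidableEq ι] :
    0 ≤ permTrace s fun _ : ι => star D * D := by
  have h := permTrace_tensor_nonneg s hD (X := fun _ : Fin (Fintype.card ι) => 1)
    (by rw [tensorMap_one]; exact zero_le_one)
  simp only [mul_one] at h
  rwa [← permTrace_comp_equiv s (Fintype.equivFin ι).symm fun _ : ι => star D * D]

theorem norm_permTrace_le_fin (s : ℤˣ) {D : H →L[ℂ] H} (hD : IsHilbertSchmidt D)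
    (X : Fin n → H →L[ℂ] H) :
    ‖permTrace s fun l => star D * D * X l‖ ≤
      (∏ l, ‖X l‖) * (permTrace s fun _ : Fin n => star D * D).re := by
  have hQ : IsHilbertSchmidt (tensorMap (fun _ => D) * symProj H s n) := (hD.tensorMap n).rmul _
  have h := hQ.norm_opTrace_star_mul_self_mul_le (tensorMap X)
  have e := opTrace_secondQuant_mul_tensorMap s hD (fun _ : Fin n => 1)
  rw [tensorMap_one, mul_one] at e
  rw [← secondQuant_star_mul_self, opTrace_secondQuant_mul_tensorMap s hD, e] at h
  simp only [mul_one] at h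
  have hn : (0 : ℝ) < (n.factorial : ℝ)⁻¹ := by positivity
  have e2 : (n.factorial : ℂ)⁻¹ = (((n.factorial : ℝ)⁻¹ : ℝ) : ℂ) := by push_cast; rfl
  rw [e2, norm_mul, Complex.re_ofReal_mul, Complex.norm_real, Real.norm_of_nonneg hn.le,
    mul_left_comm] at h
  have h0 := le_of_mul_le_mul_left h hn
  have h1 := (Complex.nonneg_iff.mp (permTrace_const_nonneg s hD (Fin n))).1
  exact h0.trans (mul_le_mul_of_nonneg_right (norm_tensorMap_le X) h1)

theorem norm_permTrace_le (s : ℤˣ) {D : H →L[ℂ] H} (hD : IsHilbertSchmidt D)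
    {ι : Type*} [Fintype ι] [DecidableEq ι] (e : Fin n ≃ ι) (X : ι → H →L[ℂ] H) :
    ‖permTrace s fun l => star D * D * X l‖ ≤
      (∏ l, ‖X l‖) * (permTrace s fun _ : Fin n => star D * D).re := by
  have h := norm_permTrace_le_fin s hD fun l => X (e l)
  rwa [permTrace_comp_equiv s e (fun l => star D * D * X l), Equiv.prod_comp e fun l => ‖X l‖] at h

-- Expansion along one copy of σ leaves tr σ and, with sign s, n terms in which one σ has become σ².
-- These terms are nonnegative and at most ‖σ‖ times the term without the extra σ. Bosons use the
-- upper bound; for Fermions the terms enter negatively and are dropped.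
open scoped ComplexOrder in
theorem permTrace_const_succ_le (s : ℤˣ) {D : H →L[ℂ] H} (hD : IsHilbertSchmidt D) (n : ℕ) :
    (permTrace s fun _ : Fin (n + 1) => star D * D).re ≤
      ((opTrace (star D * D)).re + n * if s = 1 then ‖star D * D‖ else 0) *
        (permTrace s fun _ : Fin n => star D * D).re := by
  set τ := star D * D with hτ
  have hnuc : IsNuclear τ := hD.isNuclear
  have hτr : opTrace τ = (((opTrace τ).re : ℝ) : ℂ) := by
    rw [hτ, hD.opTrace_star_mul_self (hilbertBasis H), Complex.ofReal_re]
  have e : (permTrace s fun _ : Fin (n + 1) => τ) = permTrace s fun _ : Option (Fin n) => τ :=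
    permTrace_comp_equiv s (finSuccEquiv n) fun _ : Option (Fin n) => τ
  -- σ² in slot `x` is σ with the observable σ in that slot, so the positivity and norm bounds for
  -- observables apply.
  have e2 : ∀ x : Fin n, Function.update (fun _ : Fin n => τ) x (τ * τ) =
      fun l => τ * Function.update (fun _ : Fin n => (1 : H →L[ℂ] H)) x τ l := fun x => by
    funext l
    by_cases h : l = x
    · subst h; simp
    · simp [h]
  have h0 : ∀ x : Fin n, 0 ≤ permTrace s (Function.update (fun _ : Fin n => τ) x (τ * τ)) :=
    fun x => by
      rw [e2]
      refine permTrace_tensor_nonneg s hD ?_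
      rw [← slotHom_apply, hτ, map_mul, map_star]
      exact star_mul_self_nonneg _
  have h1 : ∀ x : Fin n, (permTrace s (Function.update (fun _ : Fin n => τ) x (τ * τ))).re ≤
      ‖τ‖ * (permTrace s fun _ : Fin n => τ).re := fun x => by
    rw [e2]
    refine (Complex.re_le_norm _).trans ((norm_permTrace_le_fin s hD _).trans ?_)
    refine mul_le_mul_of_nonneg_right ?_
      (Complex.nonneg_iff.mp (permTrace_const_nonneg s hD (Fin n))).1
    rw [← Finset.mul_prod_erase _ _ (Finset.mem_univ x), Function.update_self]
    refine mul_le_of_le_one_right (norm_nonneg _) (Finset.prod_le_one (fun _ _ => norm_nonneg _) ?_)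
    intro i hi
    rw [Function.update_of_ne (Finset.ne_of_mem_erase hi)]
    exact ContinuousLinearMap.norm_id_le
  rw [e, permTrace_option s fun _ => hnuc]
  rw [Complex.add_re]
  conv_lhs => rw [hτr, Complex.re_ofReal_mul]
  rw [add_mul]
  refine add_le_add_right ?_ _
  rcases Int.units_eq_one_or s with rfl | rfl
  · simp only [Units.val_one, Int.cast_one, one_mul, if_true, Complex.re_sum]
    refine (Finset.sum_le_sum fun x _ => h1 x).trans ?_
    simp [mul_assoc]
  · rw [if_neg (by decide)]
    simp only [Units.val_neg, Units.val_one, Int.cast_neg, Int.cast_one, neg_mul, one_mul,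
      mul_zero, zero_mul, Complex.neg_re, Complex.re_sum]
    exact neg_nonpos.mpr (Finset.sum_nonneg fun x _ => (Complex.nonneg_iff.mp (h0 x)).1)

-- Ratio test: successive quotients are bounded by (T + (k + m) q)/(m + 1), which tends to q < 1 and
-- is therefore eventually below (1 + q)/2.
open scoped ComplexOrder in
theorem summable_permTrace_const (s : ℤˣ) {D : H →L[ℂ] H} (hD : IsHilbertSchmidt D)
    (hBose : s = 1 → ‖star D * D‖ < 1) (k : ℕ) :
    Summable fun m : ℕ => (m.factorial : ℝ)⁻¹ *
      (permTrace s fun _ : Fin (k + m) => star D * D).re := by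
  set q : ℝ := if s = 1 then ‖star D * D‖ else 0 with hq
  set T : ℝ := (opTrace (star D * D)).re with hT
  have hq1 : q < 1 := by
    rw [hq]; split_ifs with h
    exacts [hBose h, one_pos]
  have h0 : ∀ m, 0 ≤ (permTrace s fun _ : Fin m => star D * D).re := fun m =>
    (Complex.nonneg_iff.mp (permTrace_const_nonneg s hD (Fin m))).1
  have hlim : Filter.Tendsto (fun m : ℕ => (T + ((k + m : ℕ) : ℝ) * q) / ((m + 1 : ℕ) : ℝ))
      Filter.atTop (nhds q) := by
    have h1 : Filter.Tendsto (fun m : ℕ => (1 : ℝ) / ((m : ℝ) + 1)) Filter.atTop (nhds 0) :=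
      tendsto_one_div_add_atTop_nhds_zero_nat
    have h2 := (h1.const_mul (T + k * q - q)).add_const q
    rw [mul_zero, zero_add] at h2
    refine h2.congr fun m => ?_
    have : ((m : ℝ) + 1) ≠ 0 := by positivity
    push_cast
    field_simp
    ring
  have hev : ∀ᶠ m : ℕ in Filter.atTop,
      (T + ((k + m : ℕ) : ℝ) * q) / ((m + 1 : ℕ) : ℝ) ≤ (1 + q) / 2 :=
    (hlim.eventually (gt_mem_nhds (show q < (1 + q) / 2 by linarith))).mono fun _ h => h.le
  refine summable_of_ratio_norm_eventually_le (r := (1 + q) / 2) (by linarith) ?_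
  filter_upwards [hev] with m hm
  have hz := permTrace_const_succ_le s hD (k + m)
  rw [Real.norm_of_nonneg (mul_nonneg (by positivity) (h0 _)),
    Real.norm_of_nonneg (mul_nonneg (by positivity) (h0 _)), Nat.factorial_succ]
  have hm' : T + ((k + m : ℕ) : ℝ) * q ≤ (1 + q) / 2 * ((m + 1 : ℕ) : ℝ) :=
    (div_le_iff₀ (by positivity)).mp hm
  have hf : (0 : ℝ) < (m.factorial : ℝ) := by positivity
  have hm1 : (0 : ℝ) < ((m + 1 : ℕ) : ℝ) := by positivity
  calc (((m + 1) * m.factorial : ℕ) : ℝ)⁻¹ *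
        (permTrace s fun _ : Fin (k + (m + 1)) => star D * D).re
      ≤ (((m + 1) * m.factorial : ℕ) : ℝ)⁻¹ * (((1 + q) / 2 * ((m + 1 : ℕ) : ℝ)) *
          (permTrace s fun _ : Fin (k + m) => star D * D).re) :=
        mul_le_mul_of_nonneg_left (hz.trans (mul_le_mul_of_nonneg_right hm' (h0 _)))
          (by positivity)
    _ = _ := by
        rw [Nat.cast_mul]
        field_simp

end FockTraces

/-! ### Summation over the number of unobserved particles -/

section ReducedTraces

variable {H : Type*} [NormedAddCommGroup H] [InnerProductSpace ℂ H] [CompleteSpace H]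
variable {ι : Type*} [Fintype ι] [DecidableEq ι]

omit [CompleteSpace H] in
theorem prod_inner_update {κ : Type*} (A : ι → H →L[ℂ] H) (j : ι) (B : H →L[ℂ] H) (b : κ → H)
    (π : Equiv.Perm ι) (I : ι → κ) :
    ∏ l, ⟪b (I l), Function.update A j B l (b (I (π l)))⟫_ℂ =
      ⟪b (I j), B (b (I (π j)))⟫_ℂ * ∏ l ∈ Finset.univ.erase j, ⟪b (I l), A l (b (I (π l)))⟫_ℂ := by
  rw [← Finset.mul_prod_erase _ _ (Finset.mem_univ j), Function.update_self]
  congr 1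
  exact Finset.prod_congr rfl fun l hl => by rw [Function.update_of_ne (Finset.ne_of_mem_erase hl)]

theorem permTrace_update_sub_smul (s : ℤˣ) {A : ι → H →L[ℂ] H} (hA : ∀ l, IsNuclear (A l)) (j : ι)
    {B C : H →L[ℂ] H} (hB : IsNuclear B) (hC : IsNuclear C) (c : ℂ) :
    permTrace s (Function.update A j (B - c • C)) =
      permTrace s (Function.update A j B) - c * permTrace s (Function.update A j C) := by
  have hupd : ∀ {B : H →L[ℂ] H}, IsNuclear B → ∀ l, IsNuclear (Function.update A j B l) :=
    fun hB l => by
      by_cases h : l = j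
      · subst h; simpa using hB
      · simpa [h] using hA l
  unfold permTrace
  rw [Finset.mul_sum, ← Finset.sum_sub_distrib]
  refine Finset.sum_congr rfl fun π _ => ?_
  have h1 := summable_prod_inner (hupd hB) (hilbertBasis H) π
  have h2 := summable_prod_inner (hupd hC) (hilbertBasis H) π
  rw [mul_left_comm, ← mul_sub, ← tsum_mul_left (a := c), ← h1.tsum_sub (h2.mul_left c)]
  congr 1
  refine tsum_congr fun I => ?_
  simp only [prod_inner_update, sub_apply, smul_apply, inner_sub_right, inner_smul_right]
  ring

/-- The operators `X` on some particles, summed over any number of further particles which are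
left alone. -/
noncomputable def reducedSum (s : ℤˣ) (τ : H →L[ℂ] H) (X : ι → H →L[ℂ] H) : ℂ :=
  ∑' m : ℕ, (m.factorial : ℂ)⁻¹ *
    permTrace s fun l : ι ⊕ Fin m => τ * Sum.elim X (fun _ => 1) l

theorem reducedSum_comp_equiv {ι' : Type*} [Fintype ι'] [DecidableEq ι'] (s : ℤˣ) (τ : H →L[ℂ] H)
    (f : ι ≃ ι') (X : ι' → H →L[ℂ] H) :
    reducedSum s τ (fun l => X (f l)) = reducedSum s τ X := by
  refine tsum_congr fun m => ?_
  rw [← permTrace_comp_equiv s (Equiv.sumCongr f (Equiv.refl (Fin m)))]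
  congr 2
  funext l
  rcases l with l | l <;> simp

theorem summable_norm_reducedSum (s : ℤˣ) {D : H →L[ℂ] H} (hD : IsHilbertSchmidt D)
    (hBose : s = 1 → ‖star D * D‖ < 1) (X : ι → H →L[ℂ] H) :
    Summable fun m : ℕ => ‖(m.factorial : ℂ)⁻¹ *
      permTrace s fun l : ι ⊕ Fin m => star D * D * Sum.elim X (fun _ => 1) l‖ := by
  refine Summable.of_nonneg_of_le (fun _ => norm_nonneg _) (fun m => ?_)
    ((summable_permTrace_const s hD hBose (Fintype.card ι)).mul_left (∏ l, ‖X l‖))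
  have h := norm_permTrace_le s hD
    ((Equiv.sumCongr (Fintype.equivFin ι) (Equiv.refl (Fin m))).trans finSumFinEquiv).symm
    (Sum.elim X fun _ : Fin m => 1)
  have h1 : ∏ l, ‖Sum.elim X (fun _ : Fin m => (1 : H →L[ℂ] H)) l‖ ≤ ∏ l, ‖X l‖ := by
    rw [Fintype.prod_sum_type]
    simp only [Sum.elim_inl, Sum.elim_inr]
    exact mul_le_of_le_one_right (Finset.prod_nonneg fun _ _ => norm_nonneg _)
      (Finset.prod_le_one (fun _ _ => norm_nonneg _) fun _ _ => ContinuousLinearMap.norm_id_le)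
  have h2 := (Complex.nonneg_iff.mp
    (permTrace_const_nonneg s hD (Fin (Fintype.card ι + m)))).1
  rw [norm_mul, mul_left_comm, norm_inv, Complex.norm_natCast]
  exact mul_le_mul_of_nonneg_left (h.trans (mul_le_mul_of_nonneg_right h1 h2)) (by positivity)

theorem hasSum_reducedSum (s : ℤˣ) {D : H →L[ℂ] H} (hD : IsHilbertSchmidt D)
    (hBose : s = 1 → ‖star D * D‖ < 1) (X : ι → H →L[ℂ] H) :
    HasSum (fun m : ℕ => (m.factorial : ℂ)⁻¹ *
      permTrace s fun l : ι ⊕ Fin m => star D * D * Sum.elim X (fun _ => 1) l)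
      (reducedSum s (star D * D) X) :=
  (summable_norm_reducedSum s hD hBose X).of_norm.hasSum

/-- Moving the adjoined point to the left summand. -/
def optionSumEquivLeft (α β : Type*) : Option (α ⊕ β) ≃ Option α ⊕ β where
  toFun := fun
    | none => .inl none
    | some (.inl x) => .inl (some x)
    | some (.inr y) => .inr y
  invFun := fun
    | .inl none => none
    | .inl (some x) => some (.inl x)
    | .inr y => some (.inr y)
  left_inv := by rintro (_ | _ | _) <;> rfl
  right_inv := by rintro ((_ | _) | _) <;> rfl

/-- Moving the adjoined point to the right summand. -/
def optionSumEquivRight (α β : Type*) : Option (α ⊕ β) ≃ α ⊕ Option β where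
  toFun := fun
    | none => .inr none
    | some (.inl x) => .inl x
    | some (.inr y) => .inr (some y)
  invFun := fun
    | .inr none => none
    | .inl x => some (.inl x)
    | .inr (some y) => some (.inr y)
  left_inv := by rintro (_ | _ | _) <;> rfl
  right_inv := by rintro (_ | _ | _) <;> rfl

/-- An unobserved particle on which `X₀` is placed is an additional observed one. After relabelling,
the value no longer depends on `j`. -/
theorem permTrace_update_inr (s : ℤˣ) (τ X₀ : H →L[ℂ] H) (X : ι → H →L[ℂ] H) {m : ℕ}
    (j : Fin (m + 1)) :
    permTrace s (Function.update
      (fun l : ι ⊕ Fin (m + 1) => τ * Sum.elim X (fun _ => 1) l) (.inr j) (τ * X₀)) =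
    permTrace s fun l : Option ι ⊕ Fin m => τ * Sum.elim (fun o => o.elim X₀ X) (fun _ => 1) l := by
  rw [← permTrace_comp_equiv s (((optionSumEquivLeft ι (Fin m)).symm.trans
    (optionSumEquivRight ι (Fin m))).trans
      (Equiv.sumCongr (Equiv.refl ι) (finSuccEquiv' j).symm))]
  congr 1
  funext l
  rcases l with (_ | x) | i
  · have : Equiv.sumCongr (Equiv.refl ι) (finSuccEquiv' j).symm (Sum.inr none) = Sum.inr j := by
      simp
    simp [optionSumEquivLeft, optionSumEquivRight, this, -Equiv.sumCongr_apply]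
  · simp [optionSumEquivLeft, optionSumEquivRight]
  · simp [optionSumEquivLeft, optionSumEquivRight]

/-- The expansion of `permTrace_option`, with the predecessors of the new particle sorted into
observed and unobserved ones. -/
theorem permTrace_option_sum (s : ℤˣ) {τ : H →L[ℂ] H} (hτ : IsNuclear τ) (X₀ : H →L[ℂ] H)
    (X : ι → H →L[ℂ] H) (m : ℕ) :
    permTrace s (fun l : Option ι ⊕ Fin m => τ * Sum.elim (fun o => o.elim X₀ X) (fun _ => 1) l) =
      opTrace (τ * X₀) * permTrace s (fun l : ι ⊕ Fin m => τ * Sum.elim X (fun _ => 1) l) +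
      ((s : ℤ) : ℂ) * (∑ x, permTrace s (fun l : ι ⊕ Fin m =>
        τ * Sum.elim (Function.update X x (X x * τ * X₀)) (fun _ => 1) l) +
      ∑ j : Fin m, permTrace s (Function.update
        (fun l : ι ⊕ Fin m => τ * Sum.elim X (fun _ => 1) l) (.inr j) (τ * (τ * X₀)))) := by
  rw [← permTrace_comp_equiv s (optionSumEquivLeft ι (Fin m)), permTrace_option s]
  · rw [Fintype.sum_sum_type]
    refine congrArg₂ (· + ·) ?_ (congrArg (((s : ℤ) : ℂ) * ·) (congrArg₂ (· + ·) ?_ ?_))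
    · congr 2
      funext l
      rcases l with l | l <;> simp [optionSumEquivLeft]
    · refine Finset.sum_congr rfl fun x _ => ?_
      congr 1
      funext l
      rcases l with l | l
      · by_cases h : l = x
        · subst h; simp [optionSumEquivLeft, mul_assoc]
        · simp [optionSumEquivLeft, h]
      · simp [optionSumEquivLeft]
    · refine Finset.sum_congr rfl fun x _ => ?_
      congr 1
      funext l
      rcases l with l | l
      · simp [optionSumEquivLeft]
      · by_cases h : l = x
        · subst h; simp [optionSumEquivLeft]
        · have : (Sum.inr l : ι ⊕ Fin m) ≠ Sum.inr x := by simpa using h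
          simp [optionSumEquivLeft, Function.update_of_ne this]
  · exact fun l => hτ.rmul _

theorem reducedSum_option (s : ℤˣ) {D : H →L[ℂ] H} (hD : IsHilbertSchmidt D)
    (hBose : s = 1 → ‖star D * D‖ < 1) (X₀ : H →L[ℂ] H) (X : ι → H →L[ℂ] H) :
    reducedSum s (star D * D) (fun o : Option ι => o.elim X₀ X) =
      opTrace (star D * D * X₀) * reducedSum s (star D * D) X +
      ((s : ℤ) : ℂ) * ∑ x, reducedSum s (star D * D)
        (Function.update X x (X x * (star D * D) * X₀)) +
      ((s : ℤ) : ℂ) * reducedSum s (star D * D)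
        (fun o : Option ι => o.elim (star D * D * X₀) X) := by
  set τ := star D * D with hτ
  have h1 := (hasSum_reducedSum s hD hBose X).mul_left (opTrace (τ * X₀))
  have h2 := (hasSum_sum fun x (_ : x ∈ Finset.univ) => hasSum_reducedSum s hD hBose
    (Function.update X x (X x * τ * X₀))).mul_left (((s : ℤ) : ℂ))
  have h3 : HasSum (fun m : ℕ => (m.factorial : ℂ)⁻¹ * ∑ j : Fin m, permTrace s (Function.update
        (fun l : ι ⊕ Fin m => τ * Sum.elim X (fun _ => 1) l) (.inr j) (τ * (τ * X₀))))
      (reducedSum s τ (fun o : Option ι => o.elim (τ * X₀) X)) := by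
    -- The term m = 0 is an empty sum. In the term m + 1 all m + 1 summands agree, and (m + 1)/(m +
    -- 1)! = 1/m! restores the weight of a series with m unobserved particles.
    rw [← hasSum_nat_add_iff' 1]
    simp only [Finset.range_one, Finset.sum_singleton, Finset.univ_eq_empty, Finset.sum_empty,
      mul_zero, sub_zero, permTrace_update_inr]
    refine (hasSum_reducedSum s hD hBose (fun o : Option ι => o.elim (τ * X₀) X)).congr_fun
      fun m => ?_
    rw [Finset.sum_const, Finset.card_univ, Fintype.card_fin, nsmul_eq_mul, Nat.factorial_succ,
      ← mul_assoc]
    congr 1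
    have : ((m.factorial : ℕ) : ℂ) ≠ 0 := by exact_mod_cast m.factorial_ne_zero
    have h' : ((m + 1 : ℕ) : ℂ) ≠ 0 := by exact_mod_cast m.succ_ne_zero
    rw [Nat.cast_mul]
    field_simp
  refine (hasSum_reducedSum s hD hBose fun o : Option ι => o.elim X₀ X).unique ?_
  refine ((h1.add h2).add (h3.mul_left ((s : ℤ) : ℂ))).congr_fun fun m => ?_
  rw [permTrace_option_sum s hD.isNuclear, ← Finset.mul_sum]
  ring

/-- The last term of `reducedSum_option` is moved to the left and absorbed by linearity in the
adjoined slot. -/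
theorem reducedSum_option_one_sub (s : ℤˣ) {D : H →L[ℂ] H} (hD : IsHilbertSchmidt D)
    (hBose : s = 1 → ‖star D * D‖ < 1) (X₀ : H →L[ℂ] H) (X : ι → H →L[ℂ] H) :
    reducedSum s (star D * D)
        (fun o : Option ι => o.elim ((1 - ((s : ℤ) : ℂ) • (star D * D)) * X₀) X) =
      opTrace (star D * D * X₀) * reducedSum s (star D * D) X +
      ((s : ℤ) : ℂ) * ∑ x, reducedSum s (star D * D)
        (Function.update X x (X x * (star D * D) * X₀)) := by
  set τ := star D * D with hτ
  have h := reducedSum_option s hD hBose X₀ X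
  rw [← hτ] at h
  rw [← sub_eq_iff_eq_add] at h
  rw [← h]
  refine (hasSum_reducedSum s hD hBose _).unique
    (((hasSum_reducedSum s hD hBose fun o : Option ι => o.elim X₀ X).sub
    ((hasSum_reducedSum s hD hBose
      fun o : Option ι => o.elim (τ * X₀) X).mul_left ((s : ℤ) : ℂ))).congr_fun fun m => ?_)
  have e : ∀ Y : H →L[ℂ] H, (fun l : Option ι ⊕ Fin m =>
      τ * Sum.elim (fun o => o.elim Y X) (fun _ => 1) l) = Function.update
      (fun l : Option ι ⊕ Fin m => τ * Sum.elim (fun o => o.elim 1 X) (fun _ => 1) l)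
      (.inl none) (τ * Y) := fun Y => by
    funext l
    rcases l with (_ | _) | _ <;> simp
  rw [← hτ, e (_ * X₀), e X₀, e (τ * X₀), sub_mul, one_mul, mul_sub, smul_mul_assoc, mul_smul_comm,
    permTrace_update_sub_smul s (fun l => hD.isNuclear.rmul _) _ (hD.isNuclear.rmul _)
      (hD.isNuclear.rmul _)]
  ring

/-- `1 - s σ` is invertible. -/
theorem isUnit_one_sub_smul (s : ℤˣ) {σ : H →L[ℂ] H} (hσ : 0 ≤ σ) (hBose : s = 1 → ‖σ‖ < 1) :
    IsUnit (1 - ((s : ℤ) : ℂ) • σ) := by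
  rcases Int.units_eq_one_or s with rfl | rfl
  · simpa using isUnit_one_sub_of_norm_lt_one (hBose rfl)
  · have : (1 : H →L[ℂ] H) ≤ 1 - (((-1 : ℤˣ) : ℤ) : ℂ) • σ := by
      simpa using hσ
    exact CStarAlgebra.isUnit_of_le 1 this isStrictlyPositive_one

theorem reducedSum_isEmpty [IsEmpty ι] (s : ℤˣ) {D : H →L[ℂ] H} (hD : IsHilbertSchmidt D)
    (X : ι → H →L[ℂ] H) : reducedSum s (star D * D) X = fockTrace s (star D * D) := by
  refine tsum_congr fun m => ?_
  have h := opTrace_secondQuant_mul_tensorMap s hD (fun _ : Fin m => 1)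
  rw [tensorMap_one, mul_one] at h
  rw [h, ← permTrace_comp_equiv s (Equiv.emptySum ι (Fin m)).symm]
  rfl

/-- Both sides satisfy the same recursion in the number of observed particles, and for none of them
the left side is the Fock trace. The geometric resummation of σ into σ̂ takes place here. -/
theorem reducedSum_eq (s : ℤˣ) {D : H →L[ℂ] H} (hD : IsHilbertSchmidt D)
    (hBose : s = 1 → ‖star D * D‖ < 1) (X : ι → H →L[ℂ] H) :
    reducedSum s (star D * D) X =
      fockTrace s (star D * D) * permTrace s fun l => sigmaHat s (star D * D) * X l := by
  have hu := isUnit_one_sub_smul s (star_mul_self_nonneg D) hBose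
  set τ := star D * D with hτ
  suffices ∀ (ι : Type _) [Finite ι] [Fintype ι] [DecidableEq ι] (X : ι → H →L[ℂ] H),
      reducedSum s τ X = fockTrace s τ * permTrace s fun l => sigmaHat s τ * X l from this ι X
  intro ι hι
  induction ι using Finite.induction_empty_option with
  | of_equiv e ih =>
    intro _ _ X
    classical
    have := Fintype.ofEquiv _ e.symm
    rw [← reducedSum_comp_equiv s τ e, ih, permTrace_comp_equiv s e fun l => sigmaHat s τ * X l]
  | h_empty =>
    intro _ _ X
    rw [reducedSum_isEmpty s hD, permTrace_isEmpty, mul_one]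
  | @h_option α _ ih =>
    intro i₁ i₂ X
    classical
    obtain rfl : i₁ = instFintypeOption := Subsingleton.elim _ _
    obtain rfl : i₂ = Option.instDecidableEq := Subsingleton.elim _ _
    -- `X none` is written as (1 − sτ) times (1 − sτ)⁻¹ `X none`, to match the left side of
    -- `reducedSum_option_one_sub`; there τ(1 − sτ)⁻¹ = σ̂ appears.
    have e : X = fun o : Option α => o.elim ((1 - ((s : ℤ) : ℂ) • τ) *
        (Ring.inverse (1 - ((s : ℤ) : ℂ) • τ) * X none)) fun x => X (some x) := by
      funext o
      rcases o with _ | x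
      · rw [Option.elim_none, ← mul_assoc, Ring.mul_inverse_cancel _ hu, one_mul]
      · rfl
    have hs : τ * (Ring.inverse (1 - ((s : ℤ) : ℂ) • τ) * X none) = sigmaHat s τ * X none := by
      rw [← mul_assoc]; rfl
    conv_lhs => rw [e]
    rw [reducedSum_option_one_sub s hD hBose, permTrace_option s]
    · simp only [← hτ, mul_assoc, ih, hs]
      rw [← Finset.mul_sum]
      have e2 : ∀ x : α, (fun l => sigmaHat s τ *
          Function.update (fun x => X (some x)) x (X (some x) * (sigmaHat s τ * X none)) l) =
          Function.update (fun l => sigmaHat s τ * X (some l)) x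
            (sigmaHat s τ * (X (some x) * (sigmaHat s τ * X none))) := fun x => by
        funext l
        by_cases h : l = x
        · subst h; simp
        · simp [h]
      simp only [e2]
      ring
    · intro l
      exact (hD.isNuclear.rmul _).rmul _

theorem hasSum_permTrace_sum (s : ℤˣ) {D : H →L[ℂ] H} (hD : IsHilbertSchmidt D)
    (hBose : s = 1 → ‖star D * D‖ < 1) (X : ι → H →L[ℂ] H) :
    HasSum (fun m : ℕ => (m.factorial : ℂ)⁻¹ *
      permTrace s fun l : ι ⊕ Fin m => star D * D * Sum.elim X (fun _ => 1) l)
      (fockTrace s (star D * D) * permTrace s fun l => sigmaHat s (star D * D) * X l) := by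
  rw [← reducedSum_eq s hD hBose]
  exact hasSum_reducedSum s hD hBose X

end ReducedTraces

/-! ### Reduced density operators -/

section ReducedDensity

variable {H : Type*} [NormedAddCommGroup H] [InnerProductSpace ℂ H] [CompleteSpace H]

theorem opTrace_mul_rankOne {E : Type*} [NormedAddCommGroup E] [InnerProductSpace ℂ E]
    [CompleteSpace E] (A : E →L[ℂ] E) (u v : E) :
    opTrace (A * InnerProductSpace.rankOne ℂ u v) = ⟪v, A u⟫_ℂ := by
  rw [← (hilbertBasis E).tsum_inner_mul_inner]
  refine tsum_congr fun i => ?_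
  rw [mul_apply_eq_comp, InnerProductSpace.rankOne_apply, map_smul, inner_smul_right]

omit [CompleteSpace H] in
theorem tensorMap_rankOne {k : ℕ} (x y : Fin k → H) :
    tensorMap (fun l => InnerProductSpace.rankOne ℂ (y l) (x l)) =
      InnerProductSpace.rankOne ℂ (tprod y) (tprod x) :=
  ext_inner_tprod_apply fun z w => by
    rw [tensorMap_tprod, inner_tprod, InnerProductSpace.rankOne_apply, inner_smul_right,
      inner_tprod, inner_tprod, ← Finset.prod_mul_distrib]
    exact Finset.prod_congr rfl fun i _ => by
      rw [InnerProductSpace.rankOne_apply, inner_smul_right]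

/-- The operator norm is at most the Hilbert–Schmidt norm: the coordinates of T* w are ⟪b_i, T* w⟫ =
⟪T b_i, w⟫. -/
theorem sq_norm_le_tsum {E E' κ : Type*} [NormedAddCommGroup E] [InnerProductSpace ℂ E]
    [CompleteSpace E] [NormedAddCommGroup E'] [InnerProductSpace ℂ E'] [CompleteSpace E']
    (b : HilbertBasis κ ℂ E) (T : E →L[ℂ] E') (h : Summable fun i => ‖T (b i)‖ ^ 2) :
    ‖T‖ ^ 2 ≤ ∑' i, ‖T (b i)‖ ^ 2 := by
  have h0 : 0 ≤ ∑' i, ‖T (b i)‖ ^ 2 := tsum_nonneg fun _ => sq_nonneg _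
  have : ‖T.adjoint‖ ≤ √(∑' i, ‖T (b i)‖ ^ 2) := by
    refine ContinuousLinearMap.opNorm_le_bound _ (Real.sqrt_nonneg _) fun w => ?_
    refine le_of_sq_le_sq ?_ (by positivity)
    rw [mul_pow, Real.sq_sqrt h0, ← (hasSum_norm_inner_sq b (T.adjoint w)).tsum_eq, ← tsum_mul_right]
    refine (hasSum_norm_inner_sq b (T.adjoint w)).summable.tsum_le_tsum (fun i => ?_)
      (h.mul_right _)
    rw [ContinuousLinearMap.adjoint_inner_right, ← mul_pow]
    exact pow_le_pow_left₀ (norm_nonneg _) (norm_inner_le_norm _ _) 2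
  rw [LinearIsometryEquiv.norm_map] at this
  calc ‖T‖ ^ 2 ≤ √(∑' i, ‖T (b i)‖ ^ 2) ^ 2 := pow_le_pow_left₀ (norm_nonneg _) this 2
    _ = _ := Real.sq_sqrt h0

variable {k m : ℕ}

/-- Joining the multi-indices of the last `m` and the first `k` factors. -/
def appendIndex (κ : Type*) (k m : ℕ) : (Fin m → κ) × (Fin k → κ) ≃ (Fin (k + m) → κ) :=
  (Equiv.prodComm _ _).trans (Fin.appendEquiv k m)

omit [CompleteSpace H] in
theorem productBasis_appendIndex {κ : Type*} (b : HilbertBasis κ ℂ H)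
    (p : (Fin m → κ) × (Fin k → κ)) : productBasis b (k + m) (appendIndex κ k m p) =
      appendOp (fun j => b (p.1 j)) (productBasis b k p.2) := by
  rw [productBasis_apply, productBasis_apply, appendOp_tprod]
  congr 1
  funext l
  refine Fin.addCases (fun i => ?_) (fun i => ?_) l <;> simp [Fin.appendEquiv, appendIndex]

/-- The summands of the partial trace. -/
noncomputable def partialTraceTerm (k m : ℕ) (A : HTensor H (k + m) →L[ℂ] HTensor H (k + m))
    (J : Fin m → basisIndex H) : HTensor H k →L[ℂ] HTensor H k :=
  (appendOp (n := k) fun j => hilbertBasis H (J j)).adjoint ∘L A ∘L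
    (appendOp (n := k) fun j => hilbertBasis H (J j))

theorem summable_sq_norm_append {Q : HTensor H (k + m) →L[ℂ] HTensor H (k + m)}
    (hQ : IsHilbertSchmidt Q) :
    Summable fun p : (Fin m → basisIndex H) × (Fin k → basisIndex H) =>
      ‖Q (appendOp (fun j => hilbertBasis H (p.1 j)) (productBasis (hilbertBasis H) k p.2))‖ ^ 2 :=
  ((Equiv.summable_iff (appendIndex (basisIndex H) k m)).mpr
    (hQ.summable (productBasis (hilbertBasis H) (k + m)))).congr fun p => by
      rw [Function.comp_apply, productBasis_appendIndex]

/-- Each summand of the partial trace is R*R with R = Q(· ⊗ e_J), and ‖R*R‖ = ‖R‖² is at most the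
squared Hilbert–Schmidt norm of R. Summed over J, the bounds add up to tr Q*Q, so the partial trace
converges absolutely in norm. -/
theorem norm_partialTraceTerm_le {Q : HTensor H (k + m) →L[ℂ] HTensor H (k + m)}
    (hQ : IsHilbertSchmidt Q) (J : Fin m → basisIndex H) :
    ‖partialTraceTerm k m (star Q * Q) J‖ ≤ ∑' I, ‖Q (appendOp (fun j => hilbertBasis H (J j))
      (productBasis (hilbertBasis H) k I))‖ ^ 2 := by
  have e : partialTraceTerm k m (star Q * Q) J =
      (Q ∘L appendOp (n := k) fun j => hilbertBasis H (J j)).adjoint ∘L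
        (Q ∘L appendOp (n := k) fun j => hilbertBasis H (J j)) := by
    rw [ContinuousLinearMap.adjoint_comp]
    rfl
  rw [e, ContinuousLinearMap.norm_adjoint_comp_self, ← sq]
  exact sq_norm_le_tsum (productBasis (hilbertBasis H) k) _
    ((summable_sq_norm_append hQ).prod_factor J)

theorem summable_norm_partialTraceTerm {Q : HTensor H (k + m) →L[ℂ] HTensor H (k + m)}
    (hQ : IsHilbertSchmidt Q) : Summable fun J => ‖partialTraceTerm k m (star Q * Q) J‖ :=
  Summable.of_nonneg_of_le (fun _ => norm_nonneg _) (norm_partialTraceTerm_le hQ)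
    (summable_sq_norm_append hQ).prod

theorem norm_partialTrace_le {Q : HTensor H (k + m) →L[ℂ] HTensor H (k + m)}
    (hQ : IsHilbertSchmidt Q) :
    ‖partialTrace k m (star Q * Q)‖ ≤ (opTrace (star Q * Q)).re := by
  have hs := summable_sq_norm_append hQ
  have e : (opTrace (star Q * Q)).re = ∑' J : Fin m → basisIndex H, ∑' I, ‖Q (appendOp
      (fun j => hilbertBasis H (J j)) (productBasis (hilbertBasis H) k I))‖ ^ 2 := by
    rw [hQ.opTrace_star_mul_self (productBasis (hilbertBasis H) (k + m)), Complex.ofReal_re,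
      ← Equiv.tsum_eq (appendIndex (basisIndex H) k m)]
    simp only [productBasis_appendIndex]
    exact hs.tsum_prod
  rw [e]
  exact tsum_of_norm_bounded hs.prod.hasSum (norm_partialTraceTerm_le hQ)

/-- The duality characterising the partial trace, tested on the rank one operators |y⟩⟨x|. It
reduces statements about reduced densities to traces against product operators. -/
theorem inner_partialTrace {Q : HTensor H (k + m) →L[ℂ] HTensor H (k + m)}
    (hQ : IsHilbertSchmidt Q) (x y : Fin k → H) :
    ⟪tprod x, partialTrace k m (star Q * Q) (tprod y)⟫_ℂ = opTrace (star Q * Q *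
      tensorMap (Fin.append (fun l => InnerProductSpace.rankOne ℂ (y l) (x l)) fun _ => 1)) := by
  set B : HTensor H (k + m) →L[ℂ] HTensor H (k + m) :=
    tensorMap (Fin.append (fun l => InnerProductSpace.rankOne ℂ (y l) (x l)) fun _ => 1) with hB
  have h1 := (summable_norm_partialTraceTerm hQ).of_norm.hasSum
  have h2 : HasSum (fun J => ⟪tprod x, partialTraceTerm k m (star Q * Q) J (tprod y)⟫_ℂ)
      ⟪tprod x, partialTrace k m (star Q * Q) (tprod y)⟫_ℂ :=
    (h1.mapL (ContinuousLinearMap.apply ℂ (HTensor H k) (tprod y))).mapL (innerSL ℂ (tprod x))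
  -- On the product basis the test operator produces the coefficient ⟪x, e_I⟫ and replaces e_I by y,
  -- so the sum over I is Parseval's identity.
  have hBapp : ∀ p : (Fin m → basisIndex H) × (Fin k → basisIndex H),
      B (appendOp (fun j => hilbertBasis H (p.1 j)) (productBasis (hilbertBasis H) k p.2)) =
        ⟪tprod x, productBasis (hilbertBasis H) k p.2⟫_ℂ •
          appendOp (fun j => hilbertBasis H (p.1 j)) (tprod y) := fun p => by
    have e : ∀ z : Fin k → H, B (appendOp (fun j => hilbertBasis H (p.1 j)) (tprod z)) =
        appendOp (fun j => hilbertBasis H (p.1 j)) (tensorMap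
          (fun l => InnerProductSpace.rankOne ℂ (y l) (x l)) (tprod z)) := fun z => by
      rw [appendOp_tprod, tensorMap_tprod, tensorMap_tprod, appendOp_tprod]
      congr 1
      funext l
      refine Fin.addCases (fun i => ?_) (fun i => ?_) l <;> simp
    rw [productBasis_apply, e, tensorMap_rankOne, InnerProductSpace.rankOne_apply, map_smul]
  have h3 : Summable fun p : (Fin m → basisIndex H) × (Fin k → basisIndex H) =>
      ⟪Q (appendOp (fun j => hilbertBasis H (p.1 j)) (productBasis (hilbertBasis H) k p.2)),
        (Q * B) (appendOp (fun j => hilbertBasis H (p.1 j))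
          (productBasis (hilbertBasis H) k p.2))⟫_ℂ :=
    ((Equiv.summable_iff (appendIndex (basisIndex H) k m)).mpr
      (hQ.summable_inner (hQ.rmul B) (productBasis (hilbertBasis H) (k + m)))).congr fun p => by
        rw [Function.comp_apply, productBasis_appendIndex]
  rw [← h2.tsum_eq, mul_assoc, hQ.opTrace_star_mul (hQ.rmul B)
    (productBasis (hilbertBasis H) (k + m)), ← Equiv.tsum_eq (appendIndex (basisIndex H) k m)]
  simp only [productBasis_appendIndex]
  refine Eq.trans (tsum_congr fun J => ?_) h3.tsum_prod.symm
  rw [← (productBasis (hilbertBasis H) k).tsum_inner_mul_inner]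
  refine tsum_congr fun I => ?_
  rw [mul_apply_eq_comp, hBapp, map_smul, inner_smul_right, partialTraceTerm,
    ContinuousLinearMap.comp_apply, ContinuousLinearMap.adjoint_inner_right,
    ContinuousLinearMap.comp_apply, mul_apply_eq_comp, ContinuousLinearMap.star_eq_adjoint,
    ContinuousLinearMap.adjoint_inner_right]

theorem partialTrace_smul (c : ℂ) {Q : HTensor H (k + m) →L[ℂ] HTensor H (k + m)}
    (hQ : IsHilbertSchmidt Q) :
    partialTrace k m (c • (star Q * Q)) = c • partialTrace k m (star Q * Q) := by
  refine HasSum.tsum_eq ?_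
  refine ((summable_norm_partialTraceTerm hQ).of_norm.hasSum.const_smul c).congr_fun fun J => ?_
  rw [partialTraceTerm]
  ext v
  simp

theorem IsHilbertSchmidt.quantized {D : H →L[ℂ] H} (hD : IsHilbertSchmidt D) (s : ℤˣ) (n : ℕ) :
    IsHilbertSchmidt (Beam.tensorMap (fun _ => D) * symProj H s n) :=
  (hD.tensorMap n).rmul _

-- The vacuum contributes 1 and all other terms are nonnegative.
open scoped ComplexOrder in
theorem one_le_fockTrace (s : ℤˣ) {D : H →L[ℂ] H} (hD : IsHilbertSchmidt D)
    (hBose : s = 1 → ‖star D * D‖ < 1) : 1 ≤ fockTrace s (star D * D) := by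
  have h := hasSum_permTrace_sum s hD hBose (fun _ : Fin 0 => 1)
  rw [permTrace_isEmpty, mul_one] at h
  have e : ∀ m : ℕ, (fun l : Fin 0 ⊕ Fin m => star D * D *
      Sum.elim (fun _ : Fin 0 => (1 : H →L[ℂ] H)) (fun _ => 1) l) = fun _ => star D * D :=
    fun m => by funext l; rcases l with l | l <;> simp
  simp only [e] at h
  have h0 := le_hasSum h 0 fun m _ => mul_nonneg (by
    rw [← Complex.ofReal_natCast, ← Complex.ofReal_inv]
    exact Complex.zero_le_real.mpr (by positivity)) (permTrace_const_nonneg s hD (Fin 0 ⊕ Fin m))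
  rwa [permTrace_isEmpty, Nat.factorial_zero, Nat.cast_one, inv_one, mul_one] at h0

theorem fockTrace_ne_zero (s : ℤˣ) {D : H →L[ℂ] H} (hD : IsHilbertSchmidt D)
    (hBose : s = 1 → ‖star D * D‖ < 1) : fockTrace s (star D * D) ≠ 0 := by
  intro h
  have := (Complex.le_def.mp (one_le_fockTrace s hD hBose)).1
  rw [h] at this
  simp at this
  linarith

theorem permTrace_fin_append (s : ℤˣ) (τ : H →L[ℂ] H) (X : Fin k → H →L[ℂ] H) :
    permTrace s (fun l => τ * Fin.append X (fun _ : Fin m => 1) l) =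
      permTrace s fun l : Fin k ⊕ Fin m => τ * Sum.elim X (fun _ => 1) l := by
  rw [← permTrace_comp_equiv s (finSumFinEquiv (m := k) (n := m))]
  congr 1
  funext l
  rcases l with l | l <;> simp

theorem choose_mul_inv_factorial (K : Type*) [Field K] [CharZero K] (k m : ℕ) :
    ((k + m).choose k : K) * ((k + m).factorial : K)⁻¹ =
      (k.factorial : K)⁻¹ * (m.factorial : K)⁻¹ := by
  have e : ((k + m).choose k : K) * (k.factorial : K) * (m.factorial : K) =
      ((k + m).factorial : K) := by
    rw [← Nat.add_choose_mul_factorial_mul_factorial k m, Nat.choose_symm_add, Nat.cast_mul,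
      Nat.cast_mul]
  have h1 : ((k + m).choose k : K) ≠ 0 := by
    exact_mod_cast (Nat.choose_pos (Nat.le_add_right k m)).ne'
  rw [← e, mul_inv, mul_inv, mul_assoc, mul_inv_cancel_left₀ h1]

/-- The norm of a partial trace is at most the full trace, and the binomial coefficient turns 1/(k +
m)! into 1/(k! m!), which leaves the series of the ratio test. -/
theorem summable_reducedDensity (s : ℤˣ) {D : H →L[ℂ] H} (hD : IsHilbertSchmidt D)
    (hBose : s = 1 → ‖star D * D‖ < 1) (k : ℕ) :
    Summable fun m => ((k + m).choose k : ℂ) •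
      partialTrace k m (quasiFree s (star D * D) (k + m)) := by
  refine Summable.of_norm_bounded ((summable_permTrace_const s hD hBose k).mul_left
    (‖(fockTrace s (star D * D))⁻¹‖ * (k.factorial : ℝ)⁻¹)) fun m => ?_
  have hQ := hD.quantized s (k + m)
  have e := opTrace_secondQuant_mul_tensorMap s hD (fun _ : Fin (k + m) => 1)
  rw [tensorMap_one, mul_one] at e
  simp only [mul_one] at e
  have h := norm_partialTrace_le hQ
  rw [← secondQuant_star_mul_self, e] at h
  have e2 : ((k + m).factorial : ℂ)⁻¹ = ((((k + m).factorial : ℝ)⁻¹ : ℝ) : ℂ) := by push_cast; rfl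
  rw [e2, Complex.re_ofReal_mul] at h
  have e3 : ((k + m).choose k : ℝ) * ((k + m).factorial : ℝ)⁻¹ =
      (k.factorial : ℝ)⁻¹ * (m.factorial : ℝ)⁻¹ := by
    exact choose_mul_inv_factorial ℝ k m
  rw [quasiFree, secondQuant_star_mul_self, partialTrace_smul _ hQ, ← secondQuant_star_mul_self,
    norm_smul, norm_smul, Complex.norm_natCast]
  calc _ ≤ ((k + m).choose k : ℝ) * (‖(fockTrace s (star D * D))⁻¹‖ *
        (((k + m).factorial : ℝ)⁻¹ * (permTrace s fun _ : Fin (k + m) => star D * D).re)) := by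
        gcongr
    _ = ((k + m).choose k : ℝ) * ((k + m).factorial : ℝ)⁻¹ *
        (‖(fockTrace s (star D * D))⁻¹‖ * (permTrace s fun _ : Fin (k + m) => star D * D).re) := by
        ring
    _ = _ := by rw [e3]; ring

/-- σ̂ is again positive and trace class, so that the trace formulas for σ also hold for σ̂. With U
= 1 − sσ ≥ 0 and R = U⁻¹, the operator √U R serves as U^{-1/2}, and D' = √U R D; `D` commutes with
`R` because it commutes with σ = D². -/
theorem exists_sigmaHat_eq (s : ℤˣ) {D : H →L[ℂ] H} (hD : IsHilbertSchmidt D) (hDs : star D = D)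
    (hBose : s = 1 → ‖star D * D‖ < 1) :
    ∃ D', IsHilbertSchmidt D' ∧ sigmaHat s (star D * D) = star D' * D' := by
  have hu := isUnit_one_sub_smul s (star_mul_self_nonneg D) hBose
  set U := 1 - ((s : ℤ) : ℂ) • (star D * D) with hU
  set R := Ring.inverse U with hR
  have hU0 : 0 ≤ U := by
    rcases Int.units_eq_one_or s with rfl | rfl
    · have h1 : star D * D ≤ 1 :=
        (CStarAlgebra.norm_le_one_iff_of_nonneg _ (star_mul_self_nonneg D)).mp (hBose rfl).le
      simpa [hU] using h1
    · have h0 := star_mul_self_nonneg D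
      have : (0 : H →L[ℂ] H) ≤ 1 + star D * D := add_nonneg zero_le_one h0
      simpa [hU] using this
  have hRU : R * U = 1 := Ring.inverse_mul_cancel _ hu
  have hUR : U * R = 1 := Ring.mul_inverse_cancel _ hu
  have hUs : star U = U := (IsSelfAdjoint.of_nonneg hU0).star_eq
  have hRs : star R = R := by rw [hR, ← Ring.inverse_star, hUs]
  have hUD : U * D = D * U := by
    rw [hU, hDs]
    simp [sub_mul, mul_sub, mul_assoc]
  have hRD : D * R = R * D := by
    calc D * R = R * U * (D * R) := by rw [hRU, one_mul]
      _ = R * (U * D) * R := by simp only [mul_assoc]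
      _ = R * D * (U * R) := by rw [hUD]; simp only [mul_assoc]
      _ = _ := by rw [hUR, mul_one]
  have hVs : star (CFC.sqrt U) = CFC.sqrt U :=
    (IsSelfAdjoint.of_nonneg (CFC.sqrt_nonneg U)).star_eq
  have hVV : CFC.sqrt U * CFC.sqrt U = U := CFC.sqrt_mul_sqrt_self U hU0
  refine ⟨CFC.sqrt U * R * D, hD.lmul _, ?_⟩
  rw [show sigmaHat s (star D * D) = star D * D * R from rfl, star_mul, star_mul, hVs, hRs, hDs]
  calc D * D * R = D * (D * R) := mul_assoc _ _ _
    _ = D * (R * U * R * D) := by rw [hRD, hRU, one_mul]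
    _ = D * (R * (CFC.sqrt U * CFC.sqrt U) * R * D) := by rw [hVV]
    _ = _ := by simp only [mul_assoc]

theorem isReducedDensity_quasiFree (s : ℤˣ) {D : H →L[ℂ] H} (hD : IsHilbertSchmidt D)
    (hDs : star D = D) (hBose : s = 1 → ‖star D * D‖ < 1) (k : ℕ) :
    IsReducedDensity (quasiFree s (star D * D)) k
      (secondQuant s (sigmaHat s (star D * D)) k) := by
  obtain ⟨D', hD', hσ'⟩ := exists_sigmaHat_eq s hD hDs hBose
  refine ⟨?_, ?_⟩
  · rw [hσ', secondQuant_star_mul_self, isTraceClass_star_mul_self_iff]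
    exact hD'.quantized s k
  have hT := (summable_reducedDensity s hD hBose k).hasSum
  convert! hT using 1
  -- Matrix elements between product vectors are traces against rank one product operators, to which
  -- the resummation formula applies.
  refine ext_inner_tprod_apply fun x y => ?_
  set Y : Fin k → H →L[ℂ] H := fun l => InnerProductSpace.rankOne ℂ (y l) (x l) with hY
  have h1 := (hT.mapL (ContinuousLinearMap.apply ℂ (HTensor H k) (tprod y))).mapL
    (innerSL ℂ (tprod x))
  refine Eq.trans (b := (k.factorial : ℂ)⁻¹ *
    permTrace s fun l => sigmaHat s (star D * D) * Y l) ?_ (h1.unique ?_).symm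
  · rw [hσ', ← opTrace_secondQuant_mul_tensorMap s hD', hY, tensorMap_rankOne, opTrace_mul_rankOne]
  · have h2 := (hasSum_permTrace_sum s hD hBose Y).mul_left
      ((fockTrace s (star D * D))⁻¹ * (k.factorial : ℂ)⁻¹)
    rw [mul_mul_mul_comm, inv_mul_cancel₀ (fockTrace_ne_zero s hD hBose), one_mul] at h2
    refine h2.congr_fun fun m => ?_
    have hQ := hD.quantized s (k + m)
    rw [ContinuousLinearMap.apply_apply, innerSL_apply_apply, quasiFree,
      secondQuant_star_mul_self, partialTrace_smul _ hQ, smul_apply, smul_apply, inner_smul_right,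
      inner_smul_right, inner_partialTrace hQ, ← secondQuant_star_mul_self,
      opTrace_secondQuant_mul_tensorMap s hD, ← hY, permTrace_fin_append]
    linear_combination ((fockTrace s (star D * D))⁻¹ * permTrace s fun l : Fin k ⊕ Fin m =>
      star D * D * Sum.elim Y (fun _ => 1) l) * choose_mul_inv_factorial ℂ k m

end ReducedDensity

/-! ### Densities of an observable -/

section Density

variable {X H : Type*} [MeasurableSpace X] [NormedAddCommGroup H] [InnerProductSpace ℂ H]
  [CompleteSpace H] (F : Observable X H)

namespace Observable

/-- Additivity on the constant sequence ∅ asserts convergence of a constant series, which must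
vanish. -/
theorem inner_op_empty (φ ψ : H) : ⟪φ, F.op ∅ ψ⟫_ℂ = 0 := by
  have h := F.hasSum_iUnion (fun _ => ∅) (fun _ => MeasurableSet.empty)
    (fun _ _ _ => disjoint_bot_left) φ ψ
  exact (summable_const_iff _).mp h.summable

theorem op_empty : F.op ∅ = 0 :=
  ContinuousLinearMap.ext fun ψ => ext_inner_left ℂ fun φ => by simp [F.inner_op_empty φ ψ]

theorem op_isPositive {A : Set X} (hA : MeasurableSet A) : (F.op A).IsPositive :=
  (ContinuousLinearMap.nonneg_iff_isPositive _).mp (F.nonneg A hA)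

theorem star_op {A : Set X} (hA : MeasurableSet A) : star (F.op A) = F.op A :=
  (IsSelfAdjoint.of_nonneg (F.nonneg A hA)).star_eq

theorem inner_op_comm {A : Set X} (hA : MeasurableSet A) (u v : H) :
    ⟪F.op A u, v⟫_ℂ = ⟪u, F.op A v⟫_ℂ :=
  (F.op_isPositive hA).inner_left_eq_inner_right u v

theorem re_inner_op_nonneg {A : Set X} (hA : MeasurableSet A) (v : H) :
    0 ≤ (⟪v, F.op A v⟫_ℂ).re :=
  (F.op_isPositive hA).re_inner_nonneg_right v

theorem ofReal_re_inner_op {A : Set X} (hA : MeasurableSet A) (v : H) :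
    (((⟪v, F.op A v⟫_ℂ).re : ℝ) : ℂ) = ⟪v, F.op A v⟫_ℂ := by
  open scoped ComplexOrder in
  exact (Complex.eq_re_of_ofReal_le (r := 0)
    (by simpa using (F.op_isPositive hA).inner_nonneg_right v)).symm

/-- The measure `A ↦ ⟪v, F(A) v⟫`. -/
noncomputable def vecMeasure (v : H) : Measure X :=
  Measure.ofMeasurable (fun A _ => ENNReal.ofReal (⟪v, F.op A v⟫_ℂ).re)
    (by simp [F.op_empty]) fun f hf hd => by
      have h := Complex.hasSum_re (F.hasSum_iUnion f hf hd v v)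
      rw [← ENNReal.ofReal_tsum_of_nonneg (fun i => F.re_inner_op_nonneg (hf i) v) h.summable,
        h.tsum_eq]

theorem vecMeasure_apply (v : H) {A : Set X} (hA : MeasurableSet A) :
    F.vecMeasure v A = ENNReal.ofReal (⟪v, F.op A v⟫_ℂ).re :=
  Measure.ofMeasurable_apply A hA

instance (v : H) : IsFiniteMeasure (F.vecMeasure v) :=
  ⟨by rw [F.vecMeasure_apply v MeasurableSet.univ]; exact ENNReal.ofReal_lt_top⟩

theorem ofReal_vecMeasure_real (v : H) {A : Set X} (hA : MeasurableSet A) :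
    (((F.vecMeasure v).real A : ℝ) : ℂ) = ⟪v, F.op A v⟫_ℂ := by
  rw [measureReal_def, F.vecMeasure_apply v hA,
    ENNReal.toReal_ofReal (F.re_inner_op_nonneg hA v), F.ofReal_re_inner_op hA]

/-- For a positive operator T, ⟪v, T v⟫ = ‖√T v‖². Null sets of the dominating measure thus
annihilate all vectors of the family and their combinations, which gives the absolute continuity
needed below. -/
theorem op_apply_eq_zero {A : Set X} (hA : MeasurableSet A) {v : H}
    (h : F.vecMeasure v A = 0) : F.op A v = 0 := by
  rw [F.vecMeasure_apply v hA, ENNReal.ofReal_eq_zero] at h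
  have h0 : ⟪v, F.op A v⟫_ℂ = 0 := by
    rw [← F.ofReal_re_inner_op hA, le_antisymm h (F.re_inner_op_nonneg hA v), Complex.ofReal_zero]
  have hs : star (CFC.sqrt (F.op A)) = CFC.sqrt (F.op A) :=
    (IsSelfAdjoint.of_nonneg (CFC.sqrt_nonneg _)).star_eq
  have hss := CFC.sqrt_mul_sqrt_self (F.op A) (F.nonneg A hA)
  have h1 := inner_star_mul_self (CFC.sqrt (F.op A)) v
  rw [hs, hss, h0] at h1
  have h2 : CFC.sqrt (F.op A) v = 0 := by
    have : ‖CFC.sqrt (F.op A) v‖ ^ 2 = 0 := by exact_mod_cast h1.symm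
    simpa using this
  rw [← hss, mul_apply_eq_comp, h2, map_zero]

/-- The measure `∑ i, ⟪u i, F(·) u i⟫`. -/
noncomputable def famMeasure {κ : Type*} (u : κ → H) : Measure X :=
  Measure.sum fun i => F.vecMeasure (u i)

theorem isFiniteMeasure_famMeasure {κ : Type*} {u : κ → H} (hu : Summable fun i => ‖u i‖ ^ 2) :
    IsFiniteMeasure (F.famMeasure u) := by
  refine ⟨?_⟩
  rw [famMeasure, Measure.sum_apply _ MeasurableSet.univ]
  have h : ∀ i, F.vecMeasure (u i) Set.univ ≤ ENNReal.ofReal (‖u i‖ ^ 2) := fun i => by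
    rw [F.vecMeasure_apply _ MeasurableSet.univ]
    refine ENNReal.ofReal_le_ofReal ?_
    have h1 := ((ContinuousLinearMap.le_def _ _).mp F.univ_le_one).re_inner_nonneg_right (u i)
    rw [sub_apply, inner_sub_right, one_apply_eq_self, inner_self_eq_norm_sq_to_K] at h1
    have h2 : (0 : ℝ) ≤ (((‖u i‖ : ℂ)) ^ 2 - ⟪u i, F.op Set.univ (u i)⟫_ℂ).re := h1
    rw [Complex.sub_re, ← Complex.ofReal_pow, Complex.ofReal_re] at h2
    linarith
  refine (ENNReal.tsum_le_tsum h).trans_lt ?_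
  rw [← ENNReal.ofReal_tsum_of_nonneg (fun i => sq_nonneg _) hu]
  exact ENNReal.ofReal_lt_top

theorem op_apply_eq_zero_of_famMeasure {κ : Type*} {u : κ → H} {A : Set X}
    (hA : MeasurableSet A) (h : F.famMeasure u A = 0) (i : κ) : F.op A (u i) = 0 := by
  rw [famMeasure, Measure.sum_apply _ hA] at h
  exact F.op_apply_eq_zero hA (ENNReal.tsum_eq_zero.mp h i)

theorem vecMeasure_absolutelyContinuous {κ : Type*} {u : κ → H} (i j : κ) (a b : ℂ) :
    F.vecMeasure (a • u i + b • u j) ≪ F.famMeasure u := by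
  refine Measure.AbsolutelyContinuous.mk fun A hA h => ?_
  rw [F.vecMeasure_apply _ hA, map_add, map_smul, map_smul,
    F.op_apply_eq_zero_of_famMeasure hA h i, F.op_apply_eq_zero_of_famMeasure hA h j]
  simp

/-- A version of the density of `⟪u i, F(·) u j⟫` with respect to `∑ i, ⟪u i, F(·) u i⟫`. -/
noncomputable def rawDensity {κ : Type*} (u : κ → H) (x : X) : Matrix κ κ ℂ := .of fun i j =>
  ((((F.vecMeasure ((1 : ℂ) • u j + (1 : ℂ) • u i)).rnDeriv (F.famMeasure u) x).toReal : ℂ) -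
    (((F.vecMeasure ((1 : ℂ) • u j + (-1 : ℂ) • u i)).rnDeriv (F.famMeasure u) x).toReal : ℂ) +
    Complex.I *
      (((F.vecMeasure ((1 : ℂ) • u j + Complex.I • u i)).rnDeriv (F.famMeasure u) x).toReal : ℂ) -
    Complex.I *
      (((F.vecMeasure ((1 : ℂ) • u j + (-Complex.I) • u i)).rnDeriv
        (F.famMeasure u) x).toReal : ℂ)) / 4

theorem measurable_rawDensity {κ : Type*} (u : κ → H) (i j : κ) :
    Measurable fun x => F.rawDensity u x i j := by
  have h : ∀ v : H, Measurable fun x =>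
      (((F.vecMeasure v).rnDeriv (F.famMeasure u) x).toReal : ℂ) := fun v =>
    Complex.measurable_ofReal.comp (Measure.measurable_rnDeriv _ _).ennreal_toReal
  exact ((((h _).sub (h _)).add ((h _).const_mul _)).sub ((h _).const_mul _)).div_const _

theorem integrable_rawDensity {κ : Type*} (u : κ → H) (i j : κ) :
    Integrable (fun x => F.rawDensity u x i j) (F.famMeasure u) := by
  have h : ∀ v : H, Integrable (fun x =>
      (((F.vecMeasure v).rnDeriv (F.famMeasure u) x).toReal : ℂ)) (F.famMeasure u) := fun v =>
    Measure.integrable_toReal_rnDeriv.ofReal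
  exact ((((h _).sub (h _)).add ((h _).const_mul _)).sub ((h _).const_mul _)).div_const _

theorem integral_polarization {μ : Measure X} {f g h k : X → ℂ} (hf : Integrable f μ)
    (hg : Integrable g μ) (hh : Integrable h μ) (hk : Integrable k μ) :
    ∫ x, (f x - g x + Complex.I * h x - Complex.I * k x) / 4 ∂μ =
      (∫ x, f x ∂μ - ∫ x, g x ∂μ + Complex.I * ∫ x, h x ∂μ - Complex.I * ∫ x, k x ∂μ) / 4 := by
  rw [integral_div, integral_sub (f := fun x => f x - g x + Complex.I * h x)
    ((hf.sub hg).add (hh.const_mul _)) (hk.const_mul _),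
    integral_add (f := fun x => f x - g x) (hf.sub hg) (hh.const_mul _), integral_sub hf hg,
    integral_const_mul, integral_const_mul]

theorem setIntegral_rawDensity {κ : Type*} {u : κ → H} (hu : Summable fun i => ‖u i‖ ^ 2)
    (i j : κ) {A : Set X} (hA : MeasurableSet A) :
    ∫ x in A, F.rawDensity u x i j ∂(F.famMeasure u) = ⟪u i, F.op A (u j)⟫_ℂ := by
  have := F.isFiniteMeasure_famMeasure hu
  have hI : ∀ v : H, Integrable (fun x =>
      (((F.vecMeasure v).rnDeriv (F.famMeasure u) x).toReal : ℂ))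
      ((F.famMeasure u).restrict A) := fun v =>
    Integrable.restrict Measure.integrable_toReal_rnDeriv.ofReal
  have hv : ∀ a : ℂ, ∫ x in A, (((F.vecMeasure ((1 : ℂ) • u j + a • u i)).rnDeriv
      (F.famMeasure u) x).toReal : ℂ) ∂(F.famMeasure u) =
      ⟪F.op A ((1 : ℂ) • u j + a • u i), (1 : ℂ) • u j + a • u i⟫_ℂ := fun a => by
    rw [F.inner_op_comm hA, ← F.ofReal_vecMeasure_real _ hA, integral_complex_ofReal,
      Measure.setIntegral_toReal_rnDeriv (F.vecMeasure_absolutelyContinuous j i 1 a)]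
  have hp := inner_map_polarization (F.op A : H →ₗ[ℂ] H) (u j) (u i)
  simp only [ContinuousLinearMap.coe_coe] at hp
  rw [F.inner_op_comm hA] at hp
  simp only [rawDensity, Matrix.of_apply]
  rw [integral_polarization (hI _) (hI _) (hI _) (hI _), hv, hv, hv, hv, hp]
  simp only [one_smul, neg_smul, ← sub_eq_add_neg]

-- For fixed coefficients the quadratic form is the density of ⟪v, F(·) v⟫, hence nonnegative almost
-- everywhere. The exceptional sets depend on the coefficients, so only countably many are used:
-- finite index sets and a dense sequence of coefficients, with continuity supplying the rest.
open scoped ComplexOrder in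
theorem ae_posSemidef_rawDensity {κ : Type*} [Countable κ] {u : κ → H}
    (hu : Summable fun i => ‖u i‖ ^ 2) :
    ∀ᵐ x ∂(F.famMeasure u), (F.rawDensity u x).PosSemidef := by
  have := F.isFiniteMeasure_famMeasure hu
  have hherm : ∀ᵐ x ∂(F.famMeasure u), ∀ i j,
      F.rawDensity u x i j = conj (F.rawDensity u x j i) := by
    refine ae_all_iff.mpr fun i => ae_all_iff.mpr fun j => ?_
    refine Integrable.ae_eq_of_forall_setIntegral_eq _ _ (F.integrable_rawDensity u i j)
      ((LinearIsometryEquiv.integrable_comp_iff Complex.conjLIE).mpr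
        (F.integrable_rawDensity u j i)) fun A hA _ => ?_
    have h : ∫ x in A, conj (F.rawDensity u x j i) ∂(F.famMeasure u) =
        conj (∫ x in A, F.rawDensity u x j i ∂(F.famMeasure u)) := integral_conj
    refine Eq.trans ?_ h.symm
    rw [F.setIntegral_rawDensity hu i j hA, F.setIntegral_rawDensity hu j i hA, inner_conj_symm,
      F.inner_op_comm hA]
  have hpos : ∀ᵐ x ∂(F.famMeasure u), ∀ (t : Finset κ) (n : ℕ),
      0 ≤ (∑ i ∈ t, ∑ j ∈ t, star (TopologicalSpace.denseSeq (κ → ℂ) n i) *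
        F.rawDensity u x i j * TopologicalSpace.denseSeq (κ → ℂ) n j).re := by
    refine ae_all_iff.mpr fun t => ae_all_iff.mpr fun n => ?_
    set d := TopologicalSpace.denseSeq (κ → ℂ) n
    have hI : ∀ i j, Integrable (fun x => star (d i) * F.rawDensity u x i j * d j)
        (F.famMeasure u) := fun i j => ((F.integrable_rawDensity u i j).const_mul _).mul_const _
    have hI' : Integrable (fun x => ∑ i ∈ t, ∑ j ∈ t, star (d i) * F.rawDensity u x i j * d j)
        (F.famMeasure u) :=
      integrable_finsetSum _ fun i _ => integrable_finsetSum _ fun j _ => hI i j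
    refine ae_nonneg_of_forall_setIntegral_nonneg hI'.re fun A hA _ => ?_
    have h1 : ∫ x in A, ∑ i ∈ t, ∑ j ∈ t, star (d i) * F.rawDensity u x i j * d j
        ∂(F.famMeasure u) = ⟪∑ i ∈ t, d i • u i, F.op A (∑ i ∈ t, d i • u i)⟫_ℂ := by
      rw [integral_finsetSum _ fun i _ => integrable_finsetSum _ fun j _ => (hI i j).restrict,
        sum_inner]
      refine Finset.sum_congr rfl fun i _ => ?_
      rw [integral_finsetSum _ fun j _ => (hI i j).restrict, map_sum, inner_sum]
      refine Finset.sum_congr rfl fun j _ => ?_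
      rw [integral_mul_const, integral_const_mul, F.setIntegral_rawDensity hu i j hA, map_smul,
        inner_smul_left, inner_smul_right]
      simp only [RCLike.star_def]
      ring
    refine (F.re_inner_op_nonneg hA (∑ i ∈ t, d i • u i)).trans_eq ?_
    rw [← h1]
    exact (integral_re (hI'.restrict (s := A))).symm
  filter_upwards [hherm, hpos] with x hx1 hx2
  have hherm' : (F.rawDensity u x).IsHermitian := Matrix.IsHermitian.ext fun i j => (hx1 i j).symm
  refine ⟨hherm', fun c => ?_⟩
  have hre : ∀ (t : Finset κ) (d : κ → ℂ),
      0 ≤ (∑ i ∈ t, ∑ j ∈ t, star (d i) * F.rawDensity u x i j * d j).re := fun t d => by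
    refine (TopologicalSpace.denseRange_denseSeq (κ → ℂ)).induction_on
      (p := fun d => 0 ≤ (∑ i ∈ t, ∑ j ∈ t, star (d i) * F.rawDensity u x i j * d j).re) d ?_
      (hx2 t)
    refine isClosed_le continuous_const (Complex.continuous_re.comp ?_)
    fun_prop
  rw [Complex.nonneg_iff]
  refine ⟨hre c.support c, ?_⟩
  rw [eq_comm, ← Complex.conj_eq_iff_im]
  simp only [Finsupp.sum, map_sum, map_mul]
  rw [Finset.sum_comm]
  refine Finset.sum_congr rfl fun i _ => Finset.sum_congr rfl fun j _ => ?_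
  rw [hx1 i j]
  simp
  ring

open scoped ComplexOrder in
/-- The operator valued measure `F`, compressed to a square summable family of vectors, has a
positive semidefinite matrix density with respect to a finite measure. -/
theorem exists_density {κ : Type*} [Countable κ] {u : κ → H}
    (hu : Summable fun i => ‖u i‖ ^ 2) :
    ∃ (m : Measure X) (t : X → Matrix κ κ ℂ), IsFiniteMeasure m ∧
      (∀ i j, Measurable fun x => t x i j) ∧ (∀ x, (t x).PosSemidef) ∧
      (∀ i j, Integrable (fun x => t x i j) m) ∧
      ∀ i j A, MeasurableSet A → ∫ x in A, t x i j ∂m = ⟪u i, F.op A (u j)⟫_ℂ := by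
  classical
  have hae := F.ae_posSemidef_rawDensity hu
  -- The density is set to 0 on a measurable null set, so that semidefiniteness holds everywhere and
  -- no exceptional sets accompany the later products.
  set N := toMeasurable (F.famMeasure u) {x | ¬ (F.rawDensity u x).PosSemidef} with hN
  have hNm : MeasurableSet N := measurableSet_toMeasurable _ _
  have hN0 : F.famMeasure u N = 0 := by rw [hN, measure_toMeasurable]; exact hae
  have hNs : ∀ x ∉ N, (F.rawDensity u x).PosSemidef := fun x hx => by
    by_contra h
    exact hx (subset_toMeasurable _ _ h)
  have hEq : ∀ i j, (fun x => (if x ∈ N then 0 else F.rawDensity u x) i j)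
      =ᵐ[F.famMeasure u] fun x => F.rawDensity u x i j := fun i j => by
    filter_upwards [measure_eq_zero_iff_ae_notMem.mp hN0] with x hx
    rw [if_neg hx]
  refine ⟨F.famMeasure u, fun x => if x ∈ N then 0 else F.rawDensity u x,
    F.isFiniteMeasure_famMeasure hu, fun i j => ?_, fun x => ?_, fun i j => ?_, fun i j A hA => ?_⟩
  · have h : (fun x => (if x ∈ N then 0 else F.rawDensity u x) i j) =
        fun x => if x ∈ N then 0 else F.rawDensity u x i j := by
      funext x; split_ifs <;> rfl
    rw [h]
    exact Measurable.ite hNm measurable_const (F.measurable_rawDensity u i j)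
  · change (if x ∈ N then 0 else F.rawDensity u x).PosSemidef
    split_ifs with h
    exacts [Matrix.PosSemidef.zero, hNs x h]
  · exact (F.integrable_rawDensity u i j).congr (hEq i j).symm
  · rw [← F.setIntegral_rawDensity hu i j hA]
    exact integral_congr_ae (ae_restrict_of_ae (hEq i j))

end Observable

end Density

/-! ### Existence of the counting statistics -/

section Existence

variable {X H : Type*} [MeasurableSpace X] [NormedAddCommGroup H] [InnerProductSpace ℂ H]
  [CompleteSpace H] (F : Observable X H)

namespace Observable

theorem completed_univ : F.completed Set.univ = 1 := by
  simp [completed]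

open Classical in
/-- The completed observable as an observable on `X ⊕ Unit`. -/
noncomputable def completion : Observable (X ⊕ Unit) H where
  op := F.completed
  nonneg B hB := by
    refine add_nonneg (F.nonneg _ (measurable_inl hB)) ?_
    split_ifs
    exacts [sub_nonneg.mpr F.univ_le_one, le_rfl]
  univ_le_one := F.completed_univ.le
  hasSum_iUnion A hA hd φ ψ := by
    have h1 := F.hasSum_iUnion (fun i => Sum.inl ⁻¹' A i) (fun i => measurable_inl (hA i))
      (fun i j hij => Disjoint.preimage _ (hd hij)) φ ψ
    rw [← Set.preimage_iUnion] at h1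
    simp only [completed, add_apply, inner_add_right]
    refine h1.add ?_
    by_cases h : Sum.inr () ∈ ⋃ i, A i
    · obtain ⟨i, hi⟩ := Set.mem_iUnion.mp h
      rw [if_pos h]
      have h2 := hasSum_single (f := fun j => ⟪φ, (if Sum.inr () ∈ A j then 1 - F.op Set.univ
        else 0 : H →L[ℂ] H) ψ⟫_ℂ) i fun j hj => by
          rw [if_neg fun hj' => Set.disjoint_left.mp (hd hj) hj' hi]
          simp
      rw [if_pos hi] at h2
      exact h2
    · rw [if_neg h]
      have h2 : ∀ i, Sum.inr () ∉ A i := fun i hi => h (Set.mem_iUnion.mpr ⟨i, hi⟩)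
      simp only [h2, if_false]
      simp

variable {Y : Type*} [MeasurableSpace Y] (G : Observable Y H)

theorem _root_.Beam.inner_apply_of_star_eq {E : Type*} [NormedAddCommGroup E]
    [InnerProductSpace ℂ E] [CompleteSpace E] {T : E →L[ℂ] E} (hT : star T = T) (u v : E) :
    ⟪T u, v⟫_ℂ = ⟪u, T v⟫_ℂ := by
  conv_lhs => rw [← hT, ContinuousLinearMap.star_eq_adjoint]
  exact ContinuousLinearMap.adjoint_inner_left T v u

open scoped ComplexOrder in
/-- The joint distribution of measurements on `n` particles in a vector state which is a finite
sum of product vectors. -/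
theorem exists_measure_tprod {n : ℕ} {α : Type*} [Fintype α] (v : α → Fin n → H) (c : α → ℂ) :
    ∃ μ : Measure (Fin n → Y), IsFiniteMeasure μ ∧
      ∀ B : Fin n → Set Y, (∀ i, MeasurableSet (B i)) →
        ((μ.real (Set.univ.pi B) : ℝ) : ℂ) =
          ⟪∑ a, c a • tprod (v a), tensorMap (fun i => G.op (B i)) (∑ a, c a • tprod (v a))⟫_ℂ := by
  obtain ⟨m, t, hm, hmeas, hpos, hint, hset⟩ :=
    G.exists_density (u := fun p : α × Fin n => v p.1 p.2) Summable.of_finite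
  -- The candidate density of the joint distribution. At each point it is the quadratic form, at
  -- `c`, of the entrywise product over `l` of blocks of t(x_l), hence nonnegative by Schur's
  -- product theorem.
  let d : (Fin n → Y) → ℂ := fun x =>
    ∑ a, ∑ a', star (c a) * c a' * ∏ l, t (x l) (a, l) (a', l)
  have hd0 : ∀ x, 0 ≤ d x := fun x => by
    have h := posSemidef_prod (𝕜 := ℂ) Finset.univ
      (fun l => (t (x l)).submatrix (fun a : α => (a, l)) fun a => (a, l))
      fun l => (hpos (x l)).submatrix _
    have h2 := h.dotProduct_mulVec_nonneg c
    simp only [dotProduct, Matrix.mulVec, Matrix.of_apply, Matrix.submatrix_apply, Pi.star_apply,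
      Finset.mul_sum] at h2
    refine h2.trans_eq (Finset.sum_congr rfl fun a _ => Finset.sum_congr rfl fun a' _ => ?_)
    ring
  have hd1 : ∀ x, (((d x).re : ℝ) : ℂ) = d x := fun x =>
    (Complex.eq_re_of_ofReal_le (r := 0) (by simpa using hd0 x)).symm
  have hti : ∀ a a', Integrable (fun x : Fin n → Y => ∏ l, t (x l) (a, l) (a', l))
      (Measure.pi fun _ => m) := fun a a' =>
    Integrable.fintype_prod_dep (f := fun l y => t y (a, l) (a', l)) fun l => hint _ _
  have hdi : Integrable d (Measure.pi fun _ => m) :=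
    integrable_finsetSum _ fun a _ => integrable_finsetSum _ fun a' _ => (hti a a').const_mul _
  have hre : Integrable (fun x => (d x).re) (Measure.pi fun _ => m) := hdi.re
  refine ⟨(Measure.pi fun _ => m).withDensity fun x => ENNReal.ofReal (d x).re, ?_, ?_⟩
  · exact isFiniteMeasure_withDensity_ofReal hre.2
  · intro B hB
    have hpi : MeasurableSet (Set.univ.pi B) := MeasurableSet.univ_pi hB
    rw [measureReal_def, withDensity_apply _ hpi, ← ofReal_integral_eq_lintegral_ofReal
      hre.restrict (Filter.Eventually.of_forall fun x => (Complex.nonneg_iff.mp (hd0 x)).1),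
      ENNReal.toReal_ofReal (integral_nonneg fun x => (Complex.nonneg_iff.mp (hd0 x)).1),
      ← integral_complex_ofReal]
    simp only [hd1]
    have hprod : ∀ a a', ∫ x in Set.univ.pi B, ∏ l, t (x l) (a, l) (a', l)
        ∂(Measure.pi fun _ => m) = ∏ l, ⟪v a l, G.op (B l) (v a' l)⟫_ℂ := fun a a' => by
      rw [Measure.restrict_pi_pi,
        integral_fintype_prod_eq_prod (fun l y => t y (a, l) (a', l))]
      exact Finset.prod_congr rfl fun l _ => hset _ _ _ (hB l)
    rw [integral_finsetSum _ fun a _ => integrable_finsetSum _ fun a' _ =>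
      ((hti a a').const_mul _).restrict, sum_inner]
    refine Finset.sum_congr rfl fun a _ => ?_
    rw [integral_finsetSum _ fun a' _ => ((hti a a').const_mul _).restrict, map_sum, inner_sum]
    refine Finset.sum_congr rfl fun a' _ => ?_
    rw [integral_const_mul, hprod, map_smul, inner_smul_left, inner_smul_right, tensorMap_tprod,
      inner_tprod, RCLike.star_def, mul_assoc]

/-- The joint distribution of measurements on `n` particles in a second quantized state. -/
theorem exists_measure_secondQuant {n : ℕ} (s : ℤˣ) {D : H →L[ℂ] H} (hD : IsHilbertSchmidt D) :
    ∃ μ : Measure (Fin n → Y), IsFiniteMeasure μ ∧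
      ∀ B : Fin n → Set Y, (∀ i, MeasurableSet (B i)) →
        ((μ.real (Set.univ.pi B) : ℝ) : ℂ) =
          opTrace (secondQuant s (star D * D) n * tensorMap fun i => G.op (B i)) := by
  let b := productBasis (hilbertBasis H) n
  have hQ := hD.quantized s n
  set Q : HTensor H n →L[ℂ] HTensor H n := tensorMap (fun _ => D) * symProj H s n with hQdef
  -- Q* maps a basis vector to a finite combination of product vectors, one for each permutation, so
  -- the trace is a sum of expectations in vectors covered by the preceding construction.
  have hw : ∀ I, star Q (b I) = ∑ π : Equiv.Perm (Fin n), ((n.factorial : ℂ)⁻¹ * permWeight s π) •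
      tprod fun i => star D (hilbertBasis H (I (π i))) := fun I => by
    rw [hQdef, star_mul, star_symProj, star_tensorMap, mul_apply_eq_comp, productBasis_apply,
      tensorMap_tprod, symProj_eq]
    simp only [smul_apply, sum_apply, permOp_tprod, Finset.smul_sum, smul_smul]
  choose μ hμ hμB using fun I : Fin n → basisIndex H =>
    G.exists_measure_tprod (fun (π : Equiv.Perm (Fin n)) i => star D (hilbertBasis H (I (π i))))
      fun π => (n.factorial : ℂ)⁻¹ * permWeight s π
  have hsum : ∀ B : Fin n → Set Y, (∀ i, MeasurableSet (B i)) →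
      HasSum (fun I => (((μ I).real (Set.univ.pi B) : ℝ) : ℂ))
        (opTrace (secondQuant s (star D * D) n * tensorMap fun i => G.op (B i))) := fun B hB => by
    set T : HTensor H n →L[ℂ] HTensor H n := tensorMap fun i => G.op (B i) with hT
    have hTs : star T = T := by
      rw [hT, star_tensorMap]
      congr 1
      funext i
      exact G.star_op (hB i)
    rw [secondQuant_star_mul_self, ← hQdef, mul_assoc, hQ.opTrace_star_mul (hQ.rmul T) b,
      hQ.tsum_inner_eq (hQ.rmul T) b b]
    refine ((hQ.rmul T).adj.summable_inner hQ.adj b).hasSum.congr_fun fun I => ?_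
    have h : star (Q * T) = T * star Q := by
      rw [show star (Q * T) = star T * star Q from star_mul Q T, hTs]
    rw [hμB I B hB, ← hw, h, mul_apply_eq_comp]
    exact (inner_apply_of_star_eq hTs _ _).symm
  have hreal : ∀ B : Fin n → Set Y, (∀ i, MeasurableSet (B i)) →
      Summable fun I => (μ I).real (Set.univ.pi B) := fun B hB =>
    Complex.summable_ofReal.mp (hsum B hB).summable
  have happ : ∀ B : Fin n → Set Y, (∀ i, MeasurableSet (B i)) →
      Measure.sum μ (Set.univ.pi B) = ENNReal.ofReal (∑' I, (μ I).real (Set.univ.pi B)) :=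
    fun B hB => by
      rw [Measure.sum_apply _ (MeasurableSet.univ_pi hB), ENNReal.ofReal_tsum_of_nonneg
        (fun _ => measureReal_nonneg) (hreal B hB)]
      exact tsum_congr fun I => (ofReal_measureReal (measure_ne_top _ _)).symm
  refine ⟨Measure.sum μ, ⟨?_⟩, fun B hB => ?_⟩
  · rw [← Set.pi_univ, happ _ fun _ => MeasurableSet.univ]
    exact ENNReal.ofReal_lt_top
  · rw [measureReal_def, happ B hB,
      ENNReal.toReal_ofReal (tsum_nonneg fun _ => measureReal_nonneg), Complex.ofReal_tsum]
    exact (hsum B hB).tsum_eq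

end Observable

/-- Lists of length `n` as configurations. -/
abbrev configMk {Y : Type*} (n : ℕ) (y : Fin n → Y) : Config Y := ⟨n, y⟩

theorem configMk_injective {Y : Type*} (n : ℕ) :
    Function.Injective (configMk n : (Fin n → Y) → Config Y) :=
  sigma_mk_injective (β := fun n => Fin n → Y)

theorem preimage_configMk_image_of_ne {Y : Type*} {n k : ℕ} (h : n ≠ k) (S : Set (Fin n → Y)) :
    configMk k ⁻¹' (configMk n '' S) = ∅ := by
  ext y
  simp [h]

theorem measurable_configMk {Y : Type*} [MeasurableSpace Y] (n : ℕ) :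
    Measurable (configMk n : (Fin n → Y) → Config Y) :=
  Measurable.of_le_map (iInf_le _ n)

theorem measurableSet_configMk_image {Y : Type*} [MeasurableSpace Y] (n : ℕ) {S : Set (Fin n → Y)}
    (hS : MeasurableSet S) : MeasurableSet (configMk n '' S : Set (Config Y)) := by
  refine MeasurableSpace.measurableSet_iInf.mpr fun k => ?_
  change MeasurableSet (configMk k ⁻¹' (configMk n '' S))
  by_cases h : n = k
  · subst h
    rwa [Set.preimage_image_eq _ (configMk_injective n)]
  · rw [preimage_configMk_image_of_ne h]
    exact MeasurableSet.empty

theorem opTrace_secondQuant_hasSum (s : ℤˣ) {D : H →L[ℂ] H} (hD : IsHilbertSchmidt D)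
    (hBose : s = 1 → ‖star D * D‖ < 1) :
    HasSum (fun n => opTrace (secondQuant s (star D * D) n)) (fockTrace s (star D * D)) := by
  have h := hasSum_permTrace_sum s hD hBose (fun _ : Fin 0 => (1 : H →L[ℂ] H))
  rw [permTrace_isEmpty, mul_one] at h
  refine h.congr_fun fun n => ?_
  have h2 := opTrace_secondQuant_mul_tensorMap s hD (fun _ : Fin n => (1 : H →L[ℂ] H))
  rw [tensorMap_one, mul_one] at h2
  rw [h2]
  congr 1
  rw [← permTrace_comp_equiv s (Equiv.emptySum (Fin 0) (Fin n))]
  congr 1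
  funext l
  rcases l with l | l
  · exact l.elim0
  · simp

-- The n-particle distributions are divided by tr Γ_s(σ) and placed on the disjoint components of
-- the configuration space. The total mass is 1 because the completed observable is normalised, so
-- that the n-th mass before division is the trace of the n-particle component.
open scoped ComplexOrder in
theorem exists_isCountingLaw (s : ℤˣ) {D : H →L[ℂ] H} (hD : IsHilbertSchmidt D)
    (hBose : s = 1 → ‖star D * D‖ < 1) :
    ∃ P, IsCountingLaw F (quasiFree s (star D * D)) P := by
  choose μ hμ hμB using fun n => F.completion.exists_measure_secondQuant (n := n) s hD
  have hZ := one_le_fockTrace s hD hBose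
  set Z := fockTrace s (star D * D) with hZdef
  have hZre : Z = ((Z.re : ℝ) : ℂ) := Complex.eq_re_of_ofReal_le (r := 1) (by simpa using hZ)
  have hZ1 : 1 ≤ Z.re := (Complex.le_def.mp hZ).1
  have hmass : HasSum (fun n => (μ n).real Set.univ) Z.re := by
    rw [← Complex.hasSum_ofReal, ← hZre]
    refine (opTrace_secondQuant_hasSum s hD hBose).congr_fun fun n => ?_
    rw [← Set.pi_univ, hμB n _ fun _ => MeasurableSet.univ]
    have : F.completion.op Set.univ = 1 := F.completed_univ
    simp only [this]
    rw [tensorMap_one, mul_one]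
  let P : Measure (Config (X ⊕ Unit)) :=
    Measure.sum fun n => ENNReal.ofReal Z.re⁻¹ • (μ n).map (configMk n)
  have hP : ∀ n S, MeasurableSet S → P (configMk n '' S) = ENNReal.ofReal Z.re⁻¹ * μ n S :=
    fun n S hS => by
      have h := measurableSet_configMk_image n hS
      rw [Measure.sum_apply _ h, tsum_eq_single n, Measure.smul_apply,
        Measure.map_apply (measurable_configMk n) h, Set.preimage_image_eq _ (configMk_injective n),
        smul_eq_mul]
      intro k hk
      rw [Measure.smul_apply, Measure.map_apply (measurable_configMk k) h,
        preimage_configMk_image_of_ne hk.symm, measure_empty, smul_zero]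
  refine ⟨P, ⟨⟨?_⟩, fun n B hB => ?_⟩⟩
  · rw [Measure.sum_apply _ MeasurableSet.univ]
    simp only [Measure.smul_apply, Measure.map_apply (measurable_configMk _) MeasurableSet.univ,
      Set.preimage_univ, smul_eq_mul]
    rw [ENNReal.tsum_mul_left, tsum_congr fun n => (ofReal_measureReal (measure_ne_top (μ n) _)).symm,
      ← ENNReal.ofReal_tsum_of_nonneg (fun _ => measureReal_nonneg) hmass.summable, hmass.tsum_eq,
      ← ENNReal.ofReal_mul (by positivity), inv_mul_cancel₀ (by positivity), ENNReal.ofReal_one]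
  · rw [measureReal_def, hP n _ (MeasurableSet.univ_pi hB), ENNReal.toReal_mul,
      ENNReal.toReal_ofReal (by positivity), Complex.ofReal_mul, ← measureReal_def, hμB n B hB,
      quasiFree, ← hZdef, Complex.ofReal_inv, ← hZre, smul_mul_assoc, opTrace, opTrace,
      ← tsum_mul_left]
    refine tsum_congr fun i => ?_
    rw [smul_apply, inner_smul_right]
    rfl

end Existence

/-! ### Factorial moments of point processes -/

section FactorialMoment

variable {X Y : Type*} [MeasurableSpace X] [MeasurableSpace Y]

theorem measurable_of_comp_configMk {Z : Type*} [MeasurableSpace Z] {f : Config Y → Z}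
    (hf : ∀ n, Measurable fun y => f (configMk n y)) : Measurable f := fun _ hS =>
  MeasurableSpace.measurableSet_iInf.mpr fun n => hf n hS

theorem measurable_sum_dirac (k : ℕ) : Measurable fun ω : Config Y =>
    ∑ i : Fin k ↪ Fin ω.1, Measure.dirac fun j => ω.2 (i j) := by
  refine measurable_of_comp_configMk fun n => Measure.measurable_of_measurable_coe _ fun S hS => ?_
  simp only [Measure.coe_finsetSum, Finset.sum_apply, Measure.dirac_apply' _ hS]
  change Measurable fun y : Fin n → Y =>
    ∑ i : Fin k ↪ Fin n, S.indicator (1 : (Fin k → Y) → ℝ≥0∞) fun j => y (i j)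
  refine Finset.measurable_sum _ fun i _ => ?_
  exact (measurable_one.indicator hS).comp (measurable_pi_lambda _ fun j => measurable_pi_apply _)

theorem bind_sum_dirac_apply (P : Measure (Config Y)) (k : ℕ) {S : Set (Fin k → Y)}
    (hS : MeasurableSet S) :
    (P.bind fun ω => ∑ i : Fin k ↪ Fin ω.1, Measure.dirac fun j => ω.2 (i j)) S =
      ∑' n, ∑ i : Fin k ↪ Fin n, P (configMk n '' {y | (fun j => y (i j)) ∈ S}) := by
  have hm : ∀ n (i : Fin k ↪ Fin n),
      MeasurableSet (configMk n '' {y : Fin n → Y | (fun j => y (i j)) ∈ S}) := fun n i =>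
    measurableSet_configMk_image n
      ((measurable_pi_lambda _ fun j => measurable_pi_apply (i j) : Measurable
        fun (y : Fin n → Y) j => y (i j)) hS)
  rw [Measure.bind_apply hS (measurable_sum_dirac k).aemeasurable]
  have hpt : ∀ ω : Config Y,
      (∑ i : Fin k ↪ Fin ω.1, Measure.dirac fun j => ω.2 (i j) : Measure (Fin k → Y)) S =
        ∑' n, ∑ i : Fin k ↪ Fin n,
          (configMk n '' {y | (fun j => y (i j)) ∈ S}).indicator (1 : Config Y → ℝ≥0∞) ω := by
    rintro ⟨m, y⟩
    rw [tsum_eq_single m]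
    · simp only [Measure.coe_finsetSum, Finset.sum_apply, Measure.dirac_apply' _ hS]
      refine Finset.sum_congr rfl fun i _ => ?_
      by_cases h : (fun j => y (i j)) ∈ S
      · rw [Set.indicator_of_mem h, Set.indicator_of_mem (s := configMk m '' _)
          ⟨y, h, rfl⟩]
        rfl
      · rw [Set.indicator_of_notMem h, Set.indicator_of_notMem]
        rintro ⟨z, hz, hzy⟩
        exact h (configMk_injective m hzy ▸ hz)
    · intro n hn
      refine Finset.sum_eq_zero fun i _ => Set.indicator_of_notMem ?_ _
      rintro ⟨z, -, hz⟩
      exact hn (congrArg Sigma.fst hz)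
  simp only [hpt]
  rw [lintegral_tsum fun n => (Finset.measurable_sum _ fun i _ =>
    measurable_one.indicator (hm n i)).aemeasurable]
  refine tsum_congr fun n => ?_
  rw [lintegral_finsetSum _ fun i _ => measurable_one.indicator (hm n i)]
  exact Finset.sum_congr rfl fun i _ => lintegral_indicator_one (hm n i)

/-- Makes the restriction by `comap` in the factorial moment computable. -/
theorem measurableEmbedding_pi_inl (k : ℕ) :
    MeasurableEmbedding fun (y : Fin k → X) j => (Sum.inl (y j) : X ⊕ Unit) where
  injective y z h := funext fun j => Sum.inl_injective (congrFun h j)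
  measurable := measurable_pi_lambda _ fun j => measurable_inl.comp (measurable_pi_apply j)
  measurableSet_image' S hS := by
    have hr : Set.range (fun (y : Fin k → X) j => (Sum.inl (y j) : X ⊕ Unit)) =
        Set.univ.pi fun _ => Set.range Sum.inl := by
      ext z
      simp only [Set.mem_range, Set.mem_univ_pi]
      refine ⟨?_, fun h => ?_⟩
      · rintro ⟨y, rfl⟩ j
        exact ⟨y j, rfl⟩
      · choose y hy using h
        exact ⟨y, funext hy⟩
    have hrm : MeasurableSet (Set.range fun (y : Fin k → X) j => (Sum.inl (y j) : X ⊕ Unit)) :=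
      hr ▸ MeasurableSet.univ_pi fun _ => measurableSet_range_inl
    -- The image of `S` is its preimage under a retraction onto the points of `X`, cut down to the
    -- range. The retraction sends the undetected outcome to an arbitrary `x₀`, so an empty `X` is
    -- treated separately.
    rcases isEmpty_or_nonempty X with hX | ⟨⟨x₀⟩⟩
    · rcases S.eq_empty_or_nonempty with rfl | hne
      · simp
      · rwa [Subsingleton.eq_univ_of_nonempty hne, Set.image_univ]
    · have hg : Measurable fun (z : Fin k → X ⊕ Unit) j => Sum.elim id (fun _ => x₀) (z j) :=
        measurable_pi_lambda _ fun j =>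
          (measurable_id.sumElim measurable_const).comp (measurable_pi_apply j)
      convert! (hg hS).inter hrm using 1
      ext z
      constructor
      · rintro ⟨y, hy, rfl⟩
        exact ⟨hy, y, rfl⟩
      · rintro ⟨hz, y, rfl⟩
        exact ⟨y, hz, rfl⟩

/-- Each injective choice of k particles contributes the probability of a rectangle: the chosen ones
are detected in the A_j, the others are unrestricted and may also go undetected. -/
theorem factorialMoment_apply_pi (P : Measure (Config (X ⊕ Unit))) (k : ℕ) {A : Fin k → Set X}
    (hA : ∀ j, MeasurableSet (A j)) :
    factorialMoment P k (Set.univ.pi A) = ∑' n, ∑ i : Fin k ↪ Fin n,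
      P (configMk n '' Set.univ.pi
        (Function.extend i (fun j => Sum.inl '' A j) fun _ => Set.univ)) := by
  have himg : (fun (y : Fin k → X) j => (Sum.inl (y j) : X ⊕ Unit)) '' Set.univ.pi A =
      Set.univ.pi fun j => Sum.inl '' A j := by
    ext z
    simp only [Set.mem_image, Set.mem_univ_pi]
    constructor
    · rintro ⟨y, hy, rfl⟩ j
      exact ⟨y j, hy j, rfl⟩
    · intro h
      choose y hy hyz using h
      exact ⟨y, hy, funext hyz⟩
  rw [factorialMoment, (measurableEmbedding_pi_inl k).comap_apply, himg,
    bind_sum_dirac_apply _ _ (MeasurableSet.univ_pi fun j => (hA j).inl_image)]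
  refine tsum_congr fun n => Finset.sum_congr rfl fun i _ => ?_
  congr 2
  ext y
  simp only [Set.mem_ofPred_eq, Set.mem_univ_pi]
  constructor
  · intro h l
    by_cases hl : ∃ j, i j = l
    · obtain ⟨j, rfl⟩ := hl
      rw [i.injective.extend_apply]
      exact h j
    · rw [Function.extend_apply' _ _ _ hl]
      trivial
  · intro h j
    have := h (i j)
    rwa [i.injective.extend_apply] at this

end FactorialMoment

/-! ### Factorial moments of quasi-free states -/

section QuasiFree

variable {X H : Type*} [MeasurableSpace X] [NormedAddCommGroup H] [InnerProductSpace ℂ H]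
  [CompleteSpace H] (F : Observable X H)

theorem exists_sum_equiv_extending {k m n : ℕ} (h : k + m = n) (i : Fin k ↪ Fin n) :
    ∃ e : Fin k ⊕ Fin m ≃ Fin n, ∀ j, e (Sum.inl j) = i j := by
  classical
  have hc : Fintype.card ((Set.range i)ᶜ : Set (Fin n)) = m := by
    rw [Fintype.card_compl_set, Set.card_range_of_injective i.injective]
    simp
    omega
  exact ⟨((Equiv.ofInjective i i.injective).sumCongr (Fintype.equivFinOfCardEq hc).symm).trans
    (Equiv.Set.sumCompl (Set.range i)), fun j => by simp⟩

/-- By relabelling, it does not matter which k of the n particles are observed. -/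
theorem permTrace_extend (s : ℤˣ) (τ : H →L[ℂ] H) {k m n : ℕ} (h : k + m = n) (i : Fin k ↪ Fin n)
    (X : Fin k → H →L[ℂ] H) :
    permTrace s (fun l => τ * Function.extend i X (fun _ => 1) l) =
      permTrace s fun l : Fin k ⊕ Fin m => τ * Sum.elim X (fun _ => 1) l := by
  obtain ⟨e, he⟩ := exists_sum_equiv_extending h i
  rw [← permTrace_comp_equiv s e]
  congr 1
  funext l
  rcases l with j | j
  · rw [he, i.injective.extend_apply, Sum.elim_inl]
  · rw [Function.extend_apply', Sum.elim_inr]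
    rintro ⟨j', hj'⟩
    rw [← he] at hj'
    exact Sum.inl_ne_inr (e.injective hj')

theorem card_embedding_mul_inv_factorial (k m : ℕ) :
    (Fintype.card (Fin k ↪ Fin (k + m)) : ℂ) * ((k + m).factorial : ℂ)⁻¹ =
      (m.factorial : ℂ)⁻¹ := by
  rw [Fintype.card_embedding_eq, Fintype.card_fin, Fintype.card_fin]
  have h := Nat.factorial_mul_descFactorial (Nat.le_add_right k m)
  rw [Nat.add_sub_cancel_left] at h
  have h1 : ((k + m).factorial : ℂ) ≠ 0 := by exact_mod_cast Nat.factorial_ne_zero _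
  have h2 : (m.factorial : ℂ) ≠ 0 := by exact_mod_cast Nat.factorial_ne_zero _
  field_simp
  rw [← h]
  push_cast
  ring

theorem opTrace_quasiFree_mul {E : Type*} [NormedAddCommGroup E] [InnerProductSpace ℂ E] (s : ℤˣ)
    (σ : E →L[ℂ] E) {n : ℕ} (T : HTensor E n →L[ℂ] HTensor E n) :
    opTrace (quasiFree s σ n * T) = (fockTrace s σ)⁻¹ * opTrace (secondQuant s σ n * T) := by
  rw [quasiFree, smul_mul_assoc, opTrace, opTrace, ← tsum_mul_left]
  refine tsum_congr fun i => ?_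
  rw [smul_apply, inner_smul_right]

theorem Observable.completed_inl_image (A : Set X) : F.completed (Sum.inl '' A) = F.op A := by
  simp [completed, Set.preimage_image_eq _ Sum.inl_injective]

variable {F} {s : ℤˣ} {D : H →L[ℂ] H} {P : Measure (Config (X ⊕ Unit))}

theorem IsCountingLaw.real_extend (hD : IsHilbertSchmidt D)
    (hP : IsCountingLaw F (quasiFree s (star D * D)) P) {k m n : ℕ} (h : k + m = n)
    (i : Fin k ↪ Fin n) {A : Fin k → Set X} (hA : ∀ j, MeasurableSet (A j)) :
    ((P.real (configMk n '' Set.univ.pi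
      (Function.extend i (fun j => Sum.inl '' A j) fun _ => Set.univ)) : ℝ) : ℂ) =
      (fockTrace s (star D * D))⁻¹ * ((n.factorial : ℂ)⁻¹ *
        permTrace s fun l : Fin k ⊕ Fin m =>
          star D * D * Sum.elim (fun j => F.op (A j)) (fun _ => 1) l) := by
  have hB : ∀ l, MeasurableSet (Function.extend i (fun j => (Sum.inl '' A j : Set (X ⊕ Unit)))
      (fun _ => Set.univ) l) := fun l => by
    by_cases hl : ∃ j, i j = l
    · obtain ⟨j, rfl⟩ := hl
      rw [i.injective.extend_apply]
      exact (hA j).inl_image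
    · rw [Function.extend_apply' _ _ _ hl]
      exact MeasurableSet.univ
  have hF : (fun l => F.completed (Function.extend i (fun j => Sum.inl '' A j)
      (fun _ => Set.univ) l)) = Function.extend i (fun j => F.op (A j)) fun _ => 1 := by
    funext l
    by_cases hl : ∃ j, i j = l
    · obtain ⟨j, rfl⟩ := hl
      rw [i.injective.extend_apply, i.injective.extend_apply, F.completed_inl_image]
    · rw [Function.extend_apply' _ _ _ hl, Function.extend_apply' _ _ _ hl, F.completed_univ]
  rw [← permTrace_extend s _ h i]
  refine (hP.rect n _ hB).trans ?_
  rw [hF, opTrace_quasiFree_mul, opTrace_secondQuant_mul_tensorMap s hD]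

/-- For n < k there are no injections. For n = k + m all (k + m)!/m! of them contribute equally,
which turns 1/n! into 1/m!; the series is then the resummed one, and its factor tr Γ_s(σ) cancels
the normalisation. -/
theorem IsCountingLaw.hasSum_moment (hD : IsHilbertSchmidt D) (hBose : s = 1 → ‖star D * D‖ < 1)
    (hP : IsCountingLaw F (quasiFree s (star D * D)) P) (k : ℕ) {A : Fin k → Set X}
    (hA : ∀ j, MeasurableSet (A j)) :
    HasSum (fun n => ((∑ i : Fin k ↪ Fin n, P.real (configMk n '' Set.univ.pi
      (Function.extend i (fun j => Sum.inl '' A j) fun _ => Set.univ)) : ℝ) : ℂ))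
      (permTrace s fun j => sigmaHat s (star D * D) * F.op (A j)) := by
  rw [← (add_right_injective k).hasSum_iff]
  · have h := (hasSum_permTrace_sum s hD hBose fun j => F.op (A j)).mul_left
      (fockTrace s (star D * D))⁻¹
    rw [inv_mul_cancel_left₀ (fockTrace_ne_zero s hD hBose)] at h
    refine h.congr_fun fun m => ?_
    simp only [Function.comp_apply, Complex.ofReal_sum, hP.real_extend hD rfl _ hA,
      Finset.sum_const, Finset.card_univ, nsmul_eq_mul]
    rw [← card_embedding_mul_inv_factorial k m]
    ring
  · intro n hn
    have : IsEmpty (Fin k ↪ Fin n) := by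
      refine Function.Embedding.isEmpty_of_card_lt ?_
      rw [Fintype.card_fin, Fintype.card_fin]
      by_contra! hkn
      exact hn ⟨n - k, by simp; omega⟩
    simp

theorem IsCountingLaw.factorialMoment_pi (hD : IsHilbertSchmidt D)
    (hBose : s = 1 → ‖star D * D‖ < 1) (hP : IsCountingLaw F (quasiFree s (star D * D)) P) (k : ℕ)
    {A : Fin k → Set X} (hA : ∀ j, MeasurableSet (A j)) :
    factorialMoment P k (Set.univ.pi A) ≠ ∞ ∧
      (((factorialMoment P k).real (Set.univ.pi A) : ℝ) : ℂ) =
        permTrace s fun j => sigmaHat s (star D * D) * F.op (A j) := by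
  have := hP.isProbabilityMeasure
  have h := hP.hasSum_moment hD hBose k hA
  have hs := Complex.summable_ofReal.mp h.summable
  have happ : factorialMoment P k (Set.univ.pi A) = ENNReal.ofReal (∑' n, ∑ i : Fin k ↪ Fin n,
      P.real (configMk n '' Set.univ.pi
        (Function.extend i (fun j => Sum.inl '' A j) fun _ => Set.univ))) := by
    rw [factorialMoment_apply_pi P k hA, ENNReal.ofReal_tsum_of_nonneg
      (fun n => Finset.sum_nonneg fun i _ => measureReal_nonneg) hs]
    refine tsum_congr fun n => ?_
    rw [ENNReal.ofReal_sum_of_nonneg fun i _ => measureReal_nonneg]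
    exact Finset.sum_congr rfl fun i _ => (ofReal_measureReal (measure_ne_top _ _)).symm
  refine ⟨happ ▸ ENNReal.ofReal_ne_top, ?_⟩
  rw [measureReal_def, happ, ENNReal.toReal_ofReal (tsum_nonneg fun n =>
    Finset.sum_nonneg fun i _ => measureReal_nonneg), Complex.ofReal_tsum]
  exact h.tsum_eq

theorem IsCountingLaw.isFiniteMeasure_factorialMoment (hD : IsHilbertSchmidt D)
    (hBose : s = 1 → ‖star D * D‖ < 1) (hP : IsCountingLaw F (quasiFree s (star D * D)) P) (k : ℕ) :
    IsFiniteMeasure (factorialMoment P k) := by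
  refine ⟨?_⟩
  rw [← Set.pi_univ]
  exact (hP.factorialMoment_pi hD hBose k fun _ => MeasurableSet.univ).1.lt_top

/-- The factorial moments are given by the reduced density operators. -/
theorem IsCountingLaw.factorialMoment_real_pi (hD : IsHilbertSchmidt D) (hDs : star D = D)
    (hBose : s = 1 → ‖star D * D‖ < 1) (hP : IsCountingLaw F (quasiFree s (star D * D)) P) (k : ℕ)
    {A : Fin k → Set X} (hA : ∀ j, MeasurableSet (A j)) :
    (((factorialMoment P k).real (Set.univ.pi A) : ℝ) : ℂ) = (k.factorial : ℂ) *
      opTrace (secondQuant s (sigmaHat s (star D * D)) k * tensorMap fun j => F.op (A j)) := by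
  obtain ⟨D', hD', h'⟩ := exists_sigmaHat_eq s hD hDs hBose
  rw [(hP.factorialMoment_pi hD hBose k hA).2, h', opTrace_secondQuant_mul_tensorMap s hD',
    mul_inv_cancel_left₀ (by exact_mod_cast Nat.factorial_ne_zero _)]

end QuasiFree

/-! ### Positive definite measures from positive semidefinite kernels -/

section PosSemidef

open scoped ComplexOrder

/-- Nonnegativity of the 2 × 2 minor with indices i, j. -/
theorem norm_apply_sq_le_of_posSemidef {κ : Type*} {T : Matrix κ κ ℂ} (hT : T.PosSemidef)
    (i j : κ) : ‖T i j‖ ^ 2 ≤ (T i i).re * (T j j).re := by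
  have h := (hT.submatrix ![i, j]).det_nonneg
  rw [Matrix.det_fin_two] at h
  simp only [Matrix.submatrix_apply, Matrix.cons_val_zero, Matrix.cons_val_one] at h
  have hji : T j i = conj (T i j) := (hT.1.apply j i).symm
  have hi := Complex.nonneg_iff.mp (hT.diag_nonneg (i := i))
  have h2 := (Complex.nonneg_iff.mp h).1
  rw [hji, Complex.mul_conj, Complex.sub_re, Complex.mul_re, ← hi.2, Complex.ofReal_re,
    Complex.normSq_eq_norm_sq] at h2
  linarith

/-- The minors of `S` and `T` bound the square by the product of S_ii T_jj and S_jj T_ii; then the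
arithmetic–geometric mean inequality. Summed over i and j, the bound is a product of traces. -/
theorem norm_mul_apply_le_of_posSemidef {κ : Type*} {S T : Matrix κ κ ℂ} (hS : S.PosSemidef)
    (hT : T.PosSemidef) (i j : κ) :
    ‖S i j * T j i‖ ≤ 2⁻¹ * ((S i i).re * (T j j).re + (S j j).re * (T i i).re) := by
  have h1 := norm_apply_sq_le_of_posSemidef hS i j
  have h2 := norm_apply_sq_le_of_posSemidef hT j i
  have p1 := (Complex.nonneg_iff.mp (hS.diag_nonneg (i := i))).1
  have p2 := (Complex.nonneg_iff.mp (hS.diag_nonneg (i := j))).1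
  have p3 := (Complex.nonneg_iff.mp (hT.diag_nonneg (i := i))).1
  have p4 := (Complex.nonneg_iff.mp (hT.diag_nonneg (i := j))).1
  refine le_of_sq_le_sq ?_ (by positivity)
  rw [norm_mul, mul_pow]
  refine (mul_le_mul h1 h2 (by positivity) (by positivity)).trans ?_
  nlinarith [sq_nonneg ((S i i).re * (T j j).re - (S j j).re * (T i i).re)]

/-- The sum is the quadratic form of the Schur product of S and Tᵀ at the all-ones vector. -/
theorem sum_mul_transpose_nonneg {κ : Type*} {S T : Matrix κ κ ℂ} (hS : S.PosSemidef)
    (hT : T.PosSemidef) (K : Finset κ) : 0 ≤ ∑ p ∈ K ×ˢ K, S p.1 p.2 * T p.2 p.1 := by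
  have h := ((hS.submatrix ((↑) : K → κ)).hadamard
    (hT.transpose.submatrix ((↑) : K → κ))).dotProduct_mulVec_nonneg 1
  simp only [dotProduct, Matrix.mulVec, Matrix.hadamard_apply, Matrix.submatrix_apply,
    Matrix.transpose_apply, Pi.star_apply, Pi.one_apply, star_one, one_mul, mul_one] at h
  rw [Finset.sum_product]
  rwa [← Finset.sum_coe_sort K, Finset.sum_congr rfl fun i _ => (Finset.sum_coe_sort K _).symm]

theorem ae_summable_of_lintegral {α κ : Type*} [MeasurableSpace α] [Countable κ] {μ : Measure α}
    {f : κ → α → ℂ} (hf : ∀ p, Integrable (f p) μ) (hfin : ∑' p, ∫⁻ z, ‖f p z‖ₑ ∂μ ≠ ∞) :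
    ∀ᵐ z ∂μ, Summable fun p => f p z := by
  have h : ∀ᵐ z ∂μ, Summable fun p => ‖f p z‖ :=
    summable_norm_of_tsum_eLpNorm_ne_top le_rfl (fun p => (hf p).1)
      (by simpa only [eLpNorm_one_eq_lintegral_enorm] using hfin)
  filter_upwards [h] with z hz using hz.of_norm

theorem integrable_tsum_of_lintegral {α κ : Type*} [MeasurableSpace α] [Countable κ]
    {μ : Measure α} {f : κ → α → ℂ} (hf : ∀ p, Integrable (f p) μ)
    (hfin : ∑' p, ∫⁻ z, ‖f p z‖ₑ ∂μ ≠ ∞) : Integrable (fun z => ∑' p, f p z) μ := by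
  refine ⟨aestronglyMeasurable_of_tendsto_ae (Filter.atTop : Filter (Finset κ))
    (f := fun K z => ∑ p ∈ K, f p z) (fun K => (integrable_finsetSum K fun p _ => hf p).1) ?_, ?_⟩
  · filter_upwards [ae_summable_of_lintegral hf hfin] with z hz using hz.hasSum
  · rw [hasFiniteIntegral_iff_enorm]
    calc ∫⁻ z, ‖∑' p, f p z‖ₑ ∂μ ≤ ∫⁻ z, ∑' p, ‖f p z‖ₑ ∂μ :=
          lintegral_mono fun z => enorm_tsum_le_tsum_enorm
      _ = ∑' p, ∫⁻ z, ‖f p z‖ₑ ∂μ := lintegral_tsum fun p => (hf p).1.enorm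
      _ < ∞ := hfin.lt_top

variable {X : Type*} [MeasurableSpace X] {κ : Type*} {m : Measure X}
  [IsFiniteMeasure m] {t : X → Matrix κ κ ℂ}

theorem summable_integral_norm_mul (hpos : ∀ x, (t x).PosSemidef)
    (hint : ∀ i j, Integrable (fun x => t x i j) m)
    (ht : Summable fun i => ∫ x, (t x i i).re ∂m) :
    Summable fun p : κ × κ => ∫ z, ‖t z.1 p.1 p.2 * t z.2 p.2 p.1‖ ∂m.prod m := by
  have h0 : ∀ i x, 0 ≤ (t x i i).re := fun i x =>
    (Complex.nonneg_iff.mp ((hpos x).diag_nonneg (i := i))).1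
  have hr : ∀ i, Integrable (fun x => (t x i i).re) m := fun i => (hint i i).re
  refine Summable.of_nonneg_of_le (fun _ => integral_nonneg fun _ => norm_nonneg _) (fun p => ?_)
    (ht.mul_of_nonneg ht (fun i => integral_nonneg (h0 i)) fun i => integral_nonneg (h0 i))
  refine (integral_mono ((hint p.1 p.2).mul_prod (hint p.2 p.1)).norm
    ((((hr p.1).mul_prod (hr p.2)).add ((hr p.2).mul_prod (hr p.1))).const_mul 2⁻¹) fun z =>
      norm_mul_apply_le_of_posSemidef (hpos z.1) (hpos z.2) p.1 p.2).trans_eq ?_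
  rw [integral_const_mul, integral_add' ((hr p.1).mul_prod (hr p.2)) ((hr p.2).mul_prod (hr p.1)),
    integral_prod_mul (fun x => (t x p.1 p.1).re) fun x => (t x p.2 p.2).re,
    integral_prod_mul (fun x => (t x p.2 p.2).re) fun x => (t x p.1 p.1).re]
  ring

/-- The measure `∑ᵢⱼ t(x)ᵢⱼ t(y)ⱼᵢ m(dx) m(dy)`. -/
theorem exists_measure_of_posSemidef [Countable κ] (hpos : ∀ x, (t x).PosSemidef)
    (hint : ∀ i j, Integrable (fun x => t x i j) m)
    (ht : Summable fun i => ∫ x, (t x i i).re ∂m) :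
    ∃ μ : Measure (X × X), IsFiniteMeasure μ ∧ ∀ (φ ψ : X → ℂ) (C : ℝ), Measurable φ →
      Measurable ψ → (∀ x, ‖φ x‖ ≤ C) → (∀ x, ‖ψ x‖ ≤ C) →
      HasSum (fun p : κ × κ => (∫ x, φ x * t x p.1 p.2 ∂m) * ∫ y, ψ y * t y p.2 p.1 ∂m)
        (∫ z, φ z.1 * ψ z.2 ∂μ) := by
  let f : κ × κ → X × X → ℂ := fun p z => t z.1 p.1 p.2 * t z.2 p.2 p.1
  have hf : ∀ p, Integrable (f p) (m.prod m) := fun p => (hint p.1 p.2).mul_prod (hint p.2 p.1)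
  have hfs : Summable fun p => ∫ z, ‖f p z‖ ∂m.prod m := summable_integral_norm_mul hpos hint ht
  have hfin : ∑' p, ∫⁻ z, ‖f p z‖ₑ ∂m.prod m ≠ ∞ := by
    simp only [← ofReal_integral_norm_eq_lintegral_enorm (hf _)]
    exact hfs.tsum_ofReal_ne_top
  have hsum : ∀ᵐ z ∂m.prod m, Summable fun p => f p z := ae_summable_of_lintegral hf hfin
  let g : X × X → ℂ := fun z => ∑' p, f p z
  have hg : Integrable g (m.prod m) := integrable_tsum_of_lintegral hf hfin
  have hg0 : ∀ᵐ z ∂m.prod m, 0 ≤ g z := by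
    filter_upwards [hsum] with z hz
    -- Partial sums are known to be nonnegative only over squares K × K, so the limit is taken along
    -- these, which are cofinal.
    have h1 : Filter.Tendsto (fun K : Finset κ => ∑ p ∈ K ×ˢ K, f p z) Filter.atTop
        (nhds (g z)) :=
      hz.hasSum.comp (Filter.tendsto_finsetProd_atTop.comp Filter.tendsto_atTop_diagonal)
    exact ge_of_tendsto' h1 fun K => sum_mul_transpose_nonneg (hpos z.1) (hpos z.2) K
  have hgre : Integrable (fun z => (g z).re) (m.prod m) := hg.re
  refine ⟨(m.prod m).withDensity fun z => ENNReal.ofReal (g z).re,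
    isFiniteMeasure_withDensity_ofReal hgre.2, fun φ ψ C hφ hψ hφC hψC => ?_⟩
  rw [integral_withDensity_eq_integral_toReal_smul₀ hgre.1.aemeasurable.ennreal_ofReal
    (Filter.Eventually.of_forall fun _ => ENNReal.ofReal_lt_top)]
  have e : ∫ z, (ENNReal.ofReal (g z).re).toReal • (φ z.1 * ψ z.2) ∂m.prod m =
      ∫ z, ∑' p : κ × κ, (φ z.1 * t z.1 p.1 p.2) * (ψ z.2 * t z.2 p.2 p.1) ∂m.prod m := by
    refine integral_congr_ae ?_
    filter_upwards [hg0] with z hz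
    have hz' := Complex.nonneg_iff.mp hz
    rw [ENNReal.toReal_ofReal hz'.1, Complex.real_smul,
      show (((g z).re : ℝ) : ℂ) = g z from Complex.ext rfl hz'.2, mul_comm, ← tsum_mul_left]
    refine tsum_congr fun p => ?_
    simp only [f]
    ring
  rw [e]
  have hφi : ∀ i j, Integrable (fun x => φ x * t x i j) m := fun i j =>
    (hint i j).bdd_mul hφ.aestronglyMeasurable (Filter.Eventually.of_forall hφC)
  have hψi : ∀ i j, Integrable (fun x => ψ x * t x i j) m := fun i j =>
    (hint i j).bdd_mul hψ.aestronglyMeasurable (Filter.Eventually.of_forall hψC)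
  have hi : ∀ p : κ × κ, Integrable (fun z : X × X =>
      (φ z.1 * t z.1 p.1 p.2) * (ψ z.2 * t z.2 p.2 p.1)) (m.prod m) := fun p =>
    (hφi p.1 p.2).mul_prod (hψi p.2 p.1)
  have h := hasSum_integral_of_summable_integral_norm hi
    (Summable.of_nonneg_of_le (fun _ => integral_nonneg fun _ => norm_nonneg _) (fun p => ?_)
      (hfs.mul_left (C ^ 2)))
  · refine h.congr_fun fun p => ?_
    exact (integral_prod_mul (fun x => φ x * t x p.1 p.2) fun y => ψ y * t y p.2 p.1).symm
  · rw [← integral_const_mul]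
    refine integral_mono (hi p).norm ((hf p).norm.const_mul _) fun z => ?_
    have hC : 0 ≤ C := (norm_nonneg _).trans (hφC z.1)
    simp only [f, norm_mul]
    calc ‖φ z.1‖ * ‖t z.1 p.1 p.2‖ * (‖ψ z.2‖ * ‖t z.2 p.2 p.1‖)
        = (‖φ z.1‖ * ‖ψ z.2‖) * (‖t z.1 p.1 p.2‖ * ‖t z.2 p.2 p.1‖) := by ring
      _ ≤ C ^ 2 * (‖t z.1 p.1 p.2‖ * ‖t z.2 p.2 p.1‖) := by
          rw [pow_two]
          gcongr
          exacts [hφC _, hψC _]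

/-- A positive definiteness property of measures passes from bounded to unbounded functions. -/
theorem integral_conj_mul_nonneg {μ : Measure (X × X)}
    (hμ : ∀ (f : X → ℂ) (C : ℝ), Measurable f → (∀ x, ‖f x‖ ≤ C) →
      0 ≤ ∫ z, conj (f z.1) * f z.2 ∂μ) {f : X → ℂ} (hf : Measurable f)
    (hfi : Integrable (fun z : X × X => conj (f z.1) * f z.2) μ) :
    0 ≤ ∫ z, conj (f z.1) * f z.2 ∂μ := by
  -- Truncation to {‖f‖ ≤ n}: the integrands are dominated by that of `f`, which is integrable by
  -- hypothesis.
  let F : ℕ → X → ℂ := fun n => {x | ‖f x‖ ≤ n}.indicator f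
  have hF : ∀ n, Measurable (F n) := fun n =>
    hf.indicator (measurableSet_le hf.norm measurable_const)
  have hFle : ∀ n x, ‖F n x‖ ≤ ‖f x‖ := fun n x => norm_indicator_le_norm_self _ _
  have hlim : ∀ x, Filter.Tendsto (fun n => F n x) Filter.atTop (nhds (f x)) := fun x => by
    obtain ⟨N, hN⟩ := exists_nat_ge ‖f x‖
    refine tendsto_const_nhds.congr' ?_
    filter_upwards [Filter.eventually_ge_atTop N] with n hn
    refine (Set.indicator_of_mem ?_ _).symm
    exact hN.trans (by exact_mod_cast hn)
  refine ge_of_tendsto' (tendsto_integral_of_dominated_convergence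
    (F := fun n z => conj (F n z.1) * F n z.2) (fun z => ‖conj (f z.1) * f z.2‖) (fun n => ?_)
    hfi.norm (fun n => Filter.Eventually.of_forall fun z => ?_)
    (Filter.Eventually.of_forall fun z => ?_)) fun n => hμ (F n) n (hF n) fun x => ?_
  · exact ((Complex.continuous_conj.measurable.comp ((hF n).comp measurable_fst)).mul
      ((hF n).comp measurable_snd)).aestronglyMeasurable
  · simp only [norm_mul, RCLike.norm_conj]
    exact mul_le_mul (hFle n _) (hFle n _) (norm_nonneg _) (norm_nonneg _)
  · exact ((Complex.continuous_conj.tendsto _).comp (hlim z.1)).mul (hlim z.2)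
  · by_cases hx : ‖f x‖ ≤ n
    · exact (hFle n x).trans hx
    · rw [show F n x = 0 from Set.indicator_of_notMem (s := {x | ‖f x‖ ≤ n}) hx _, norm_zero]
      exact Nat.cast_nonneg n

end PosSemidef

/-! ### The exchange term -/

section Exchange

variable {X H : Type*} [MeasurableSpace X] [NormedAddCommGroup H] [InnerProductSpace ℂ H]
  [CompleteSpace H]

/-- Cyclicity turns the trace into that of the product of the Hilbert–Schmidt operators D S D* and D
T D*, whose matrix entries are those of `S` and `T` in the vectors D* b_i. -/
theorem IsHilbertSchmidt.opTrace_exchange {D : H →L[ℂ] H} (hD : IsHilbertSchmidt D)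
    {S T : H →L[ℂ] H} (hS : star S = S) (b : HilbertBasis (basisIndex H) ℂ H) :
    opTrace (star D * D * S * (star D * D) * T) = ∑' p : basisIndex H × basisIndex H,
      ⟪star D (b p.1), S (star D (b p.2))⟫_ℂ * ⟪star D (b p.2), T (star D (b p.1))⟫_ℂ := by
  have hM : IsHilbertSchmidt (D * S * star D) := (hD.rmul S).rmul _
  have hN : IsHilbertSchmidt (D * T * star D) := (hD.rmul T).rmul _
  have hMs : star (D * S * star D) = D * S * star D := by
    rw [star_mul, star_mul, star_star, hS, mul_assoc]
  have e1 : opTrace (star D * D * S * (star D * D) * T) =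
      opTrace (star (D * S * star D) * (D * T * star D)) := by
    have h := hD.adj.opTrace_mul_comm (((hD.rmul S).rmul (star D)).rmul (D * T))
    rw [hMs]
    simpa only [mul_assoc] using h
  have e2 : ∀ p : basisIndex H × basisIndex H,
      ⟪star D (b p.1), S (star D (b p.2))⟫_ℂ * ⟪star D (b p.2), T (star D (b p.1))⟫_ℂ =
        ⟪(D * S * star D) (b p.1), b p.2⟫_ℂ * ⟪b p.2, (D * T * star D) (b p.1)⟫_ℂ := fun p => by
    rw [inner_apply_of_star_eq hMs]
    simp only [mul_apply_eq_comp, ContinuousLinearMap.star_eq_adjoint,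
      ContinuousLinearMap.adjoint_inner_left]
  rw [e1, hM.opTrace_star_mul hN b, tsum_congr e2, (hM.summable_prod hN b b).tsum_prod]
  exact tsum_congr fun i => (b.tsum_inner_mul_inner _ _).symm

variable (F : Observable X H)

open scoped ComplexOrder in
/-- The exchange term is a positive definite measure. -/
theorem Observable.exists_exchange_measure {D : H →L[ℂ] H} (hD : IsHilbertSchmidt D) :
    ∃ μ : Measure (X × X), IsFiniteMeasure μ ∧
      (∀ A B, MeasurableSet A → MeasurableSet B → ((μ.real (A ×ˢ B) : ℝ) : ℂ) =
        opTrace (star D * D * F.op A * (star D * D) * F.op B)) ∧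
      ∀ f : X → ℂ, Measurable f → Integrable (fun z : X × X => conj (f z.1) * f z.2) μ →
        0 ≤ ∫ z, conj (f z.1) * f z.2 ∂μ := by
  let b := hilbertBasis H
  have hs : Summable fun i => ‖star D (b i)‖ ^ 2 := hD.adj
  -- Only countably many of the vectors D* b_i are nonzero; countability is what the matrix density
  -- requires, even if H is not separable.
  let K : Set (basisIndex H) := Function.support fun i => ‖star D (b i)‖ ^ 2
  have hK : Countable K := hs.countable_support.to_subtype
  let u : K → H := fun i => star D (b i)
  have hu : Summable fun i => ‖u i‖ ^ 2 := hs.comp_injective Subtype.val_injective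
  obtain ⟨m, t, hm, -, hpos, hint, hset⟩ := F.exists_density hu
  have ht : Summable fun i => ∫ x, (t x i i).re ∂m := by
    refine Summable.of_norm_bounded (hu.mul_left ‖F.op Set.univ‖) fun i => ?_
    have h1 : ∫ x, (t x i i).re ∂m = (∫ x, t x i i ∂m).re := integral_re (hint i i)
    rw [h1, ← setIntegral_univ, hset i i _ MeasurableSet.univ]
    refine (Complex.abs_re_le_norm _).trans ((norm_inner_le_norm _ _).trans ?_)
    have := (F.op Set.univ).le_opNorm (u i)
    nlinarith [norm_nonneg (u i)]
  obtain ⟨μ, hμ, hμs⟩ := exists_measure_of_posSemidef hpos hint ht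
  refine ⟨μ, hμ, fun A B hA hB => ?_, fun f hf hfi => ?_⟩
  · have h := hμs (A.indicator fun _ => 1) (B.indicator fun _ => 1) 1
      (measurable_const.indicator hA) (measurable_const.indicator hB)
      (fun x => (norm_indicator_le_norm_self _ _).trans (by simp))
      fun x => (norm_indicator_le_norm_self _ _).trans (by simp)
    have e1 : ∀ {A : Set X}, MeasurableSet A → ∀ i j,
        ∫ x, A.indicator (fun _ => (1 : ℂ)) x * t x i j ∂m = ⟪u i, F.op A (u j)⟫_ℂ :=
      fun {A} hA i j => by
        rw [← hset i j A hA, ← integral_indicator hA]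
        refine integral_congr_ae (Filter.Eventually.of_forall fun x => ?_)
        by_cases hx : x ∈ A <;> simp [hx]
    have e2 : ∫ z : X × X, A.indicator (fun _ => (1 : ℂ)) z.1 * B.indicator (fun _ => 1) z.2 ∂μ =
        ((μ.real (A ×ˢ B) : ℝ) : ℂ) := by
      have := integral_indicator_const (μ := μ) (1 : ℂ) (hA.prod hB)
      rw [Complex.real_smul, mul_one] at this
      rw [← this]
      refine integral_congr_ae (Filter.Eventually.of_forall fun z => ?_)
      by_cases h1 : z.1 ∈ A <;> by_cases h2 : z.2 ∈ B <;> simp [h1, h2]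
    rw [e2] at h
    simp only [e1 hA, e1 hB] at h
    rw [← h.tsum_eq, hD.opTrace_exchange (F.star_op hA) b]
    -- The discarded indices have D* b_i = 0 and contribute nothing to the trace.
    refine (Function.Injective.tsum_eq (g := Prod.map Subtype.val Subtype.val)
      (Subtype.val_injective.prodMap Subtype.val_injective)
      (f := fun p => ⟪star D (b p.1), F.op A (star D (b p.2))⟫_ℂ *
        ⟪star D (b p.2), F.op B (star D (b p.1))⟫_ℂ) fun p hp => ?_)
    refine ⟨(⟨p.1, fun h0 => hp ?_⟩, ⟨p.2, fun h0 => hp ?_⟩), rfl⟩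
    all_goals
      have h1 : star D (b _) = 0 := norm_eq_zero.mp (pow_eq_zero_iff two_ne_zero |>.mp h0)
      simp [h1]
  · refine integral_conj_mul_nonneg (fun f C hf hfC => ?_) hf hfi
    have h := hμs (fun x => conj (f x)) f C (Complex.continuous_conj.measurable.comp hf) hf
      (fun x => by rw [RCLike.norm_conj]; exact hfC x) hfC
    -- As t is Hermitian, the two factors of each summand are conjugate, so the integral is a sum of
    -- squared moduli.
    refine h.nonneg fun p => ?_
    have e : ∫ x, conj (f x) * t x p.1 p.2 ∂m = conj (∫ x, f x * t x p.2 p.1 ∂m) := by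
      rw [← integral_conj]
      refine integral_congr_ae (Filter.Eventually.of_forall fun x => ?_)
      have := (hpos x).1.apply p.1 p.2
      simp only [map_mul]
      rw [← this]
      rfl
    rw [e]
    exact star_mul_self_nonneg _

end Exchange

/-! ### The first two moments -/

section Moments

variable {X H : Type*} [MeasurableSpace X] [NormedAddCommGroup H] [InnerProductSpace ℂ H]
  [CompleteSpace H]

theorem permTrace_fin_one (s : ℤˣ) {T : Fin 1 → H →L[ℂ] H} (hT : ∀ l, IsNuclear (T l)) :
    permTrace s T = opTrace (T 0) := by
  rw [← permTrace_comp_equiv s (finSuccEquiv 0).symm, permTrace_option s fun _ => hT _]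
  simp [permTrace_isEmpty]

theorem permTrace_fin_two (s : ℤˣ) {T : Fin 2 → H →L[ℂ] H} (hT : ∀ l, IsNuclear (T l)) :
    permTrace s T = opTrace (T 0) * opTrace (T 1) + ((s : ℤ) : ℂ) * opTrace (T 1 * T 0) := by
  rw [← permTrace_comp_equiv s (finSuccEquiv 1).symm, permTrace_option s fun _ => hT _]
  simp only [finSuccEquiv_symm_none, finSuccEquiv_symm_some, Fin.sum_univ_one]
  rw [permTrace_fin_one s fun _ => hT _, permTrace_fin_one]
  · simp
  · intro l
    obtain rfl := Subsingleton.elim l 0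
    rw [Function.update_self]
    exact (hT _).rmul _

variable {F : Observable X H} {s : ℤˣ} {D : H →L[ℂ] H} {P : Measure (Config (X ⊕ Unit))}

theorem moment₁_real (P : Measure (Config (X ⊕ Unit))) {A : Set X} (hA : MeasurableSet A) :
    (moment₁ P).real A = (factorialMoment P 1).real (Set.univ.pi fun _ => A) := by
  rw [moment₁, map_measureReal_apply (measurable_pi_apply 0) hA]
  congr 1
  ext y
  simp [Fin.forall_fin_one]

theorem moment₂_real (P : Measure (Config (X ⊕ Unit))) {A B : Set X} (hA : MeasurableSet A)
    (hB : MeasurableSet B) :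
    (moment₂ P).real (A ×ˢ B) = (factorialMoment P 2).real (Set.univ.pi ![A, B]) := by
  rw [moment₂, map_measureReal_apply
    ((measurable_pi_apply 0).prodMk (measurable_pi_apply 1)) (hA.prod hB)]
  congr 1
  ext y
  simp [Fin.forall_fin_two]

theorem IsCountingLaw.moment₁_real (hD : IsHilbertSchmidt D) (hDs : star D = D)
    (hBose : s = 1 → ‖star D * D‖ < 1) (hP : IsCountingLaw F (quasiFree s (star D * D)) P)
    {A : Set X} (hA : MeasurableSet A) :
    (((moment₁ P).real A : ℝ) : ℂ) = opTrace (sigmaHat s (star D * D) * F.op A) := by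
  obtain ⟨D', hD', h'⟩ := exists_sigmaHat_eq s hD hDs hBose
  rw [Beam.moment₁_real P hA, (hP.factorialMoment_pi hD hBose 1 fun _ => hA).2,
    permTrace_fin_one s fun l => by rw [h']; exact hD'.isNuclear.rmul _]

theorem IsCountingLaw.moment₂_real (hD : IsHilbertSchmidt D) (hDs : star D = D)
    (hBose : s = 1 → ‖star D * D‖ < 1) (hP : IsCountingLaw F (quasiFree s (star D * D)) P)
    {A B : Set X} (hA : MeasurableSet A) (hB : MeasurableSet B) :
    (((moment₂ P).real (A ×ˢ B) : ℝ) : ℂ) =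
      (((moment₁ P).real A : ℝ) : ℂ) * (((moment₁ P).real B : ℝ) : ℂ) + ((s : ℤ) : ℂ) *
        opTrace (sigmaHat s (star D * D) * F.op A * sigmaHat s (star D * D) * F.op B) := by
  have hAB : ∀ j, MeasurableSet ((![A, B] : Fin 2 → Set X) j) := by
    simp [Fin.forall_fin_two, hA, hB]
  rw [hP.moment₁_real hD hDs hBose hA, hP.moment₁_real hD hDs hBose hB]
  obtain ⟨D', hD', h'⟩ := exists_sigmaHat_eq s hD hDs hBose
  rw [Beam.moment₂_real P hA hB, (hP.factorialMoment_pi hD hBose 2 hAB).2,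
    permTrace_fin_two s fun l => by rw [h']; exact hD'.isNuclear.rmul _]
  simp only [Matrix.cons_val_zero, Matrix.cons_val_one]
  -- The expansion yields the product with `B` first; cyclicity restores the order in the statement.
  rw [h', ((hD'.lmul (star D')).rmul (F.op B)).opTrace_mul_comm
    ((hD'.lmul (star D')).rmul (F.op A)), ← mul_assoc]

theorem IsCountingLaw.isFiniteMeasure_moment₁ (hD : IsHilbertSchmidt D)
    (hBose : s = 1 → ‖star D * D‖ < 1) (hP : IsCountingLaw F (quasiFree s (star D * D)) P) :
    IsFiniteMeasure (moment₁ P) := by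
  have := hP.isFiniteMeasure_factorialMoment hD hBose 1
  exact Measure.isFiniteMeasure_map _ _

theorem IsCountingLaw.isFiniteMeasure_moment₂ (hD : IsHilbertSchmidt D)
    (hBose : s = 1 → ‖star D * D‖ < 1) (hP : IsCountingLaw F (quasiFree s (star D * D)) P) :
    IsFiniteMeasure (moment₂ P) := by
  have := hP.isFiniteMeasure_factorialMoment hD hBose 2
  exact Measure.isFiniteMeasure_map _ _

end Moments

/-! ### Bunching and antibunching -/

section Bunching

variable {X : Type*} [MeasurableSpace X]

theorem ext_real_prod {μ μ' : Measure (X × X)} [IsFiniteMeasure μ] [IsFiniteMeasure μ']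
    (h : ∀ A B, MeasurableSet A → MeasurableSet B → μ.real (A ×ˢ B) = μ'.real (A ×ˢ B)) :
    μ = μ' :=
  Measure.ext_prod fun {A B} hA hB => (measureReal_eq_measureReal_iff).mp (h A B hA hB)

theorem ae_le_of_withDensity_le {α : Type*} [MeasurableSpace α] {ν : Measure α} [SigmaFinite ν]
    {f g : α → ℝ≥0∞} (hf : Measurable f) (h : ν.withDensity f ≤ ν.withDensity g) : f ≤ᵐ[ν] g :=
  ae_le_of_forall_setLIntegral_le_of_sigmaFinite hf fun S hS _ => by
    have := h S
    rwa [withDensity_apply _ hS, withDensity_apply _ hS] at this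

variable {ν : Measure X} {h₁ : X → ℝ≥0∞} {h₂ : X × X → ℝ≥0∞} {m₁ : Measure X}
  [IsFiniteMeasure m₁] {m₂ : Measure (X × X)}

/-- An infinite value of h⁽¹⁾ would make the quotient g⁽²⁾ degenerate and break the lower bound;
finiteness of m̂_1 excludes it almost everywhere. -/
theorem ae_ne_top_of_withDensity (hm₁ : Measurable h₁) (e₁ : m₁ = ν.withDensity h₁) :
    ∀ᵐ z ∂ν.prod ν, h₁ z.1 ≠ ∞ ∧ h₁ z.2 ≠ ∞ := by
  have h : ∀ᵐ x ∂ν, h₁ x ≠ ∞ := by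
    have := measure_ne_top m₁ Set.univ
    rw [e₁, withDensity_apply _ MeasurableSet.univ, Measure.restrict_univ] at this
    filter_upwards [ae_lt_top hm₁ this] with x hx using hx.ne
  exact (Measure.quasiMeasurePreserving_fst.ae h).and (Measure.quasiMeasurePreserving_snd.ae h)

theorem one_le_g2_of_prod_le [SigmaFinite ν] (hm₁ : Measurable h₁) (e₁ : m₁ = ν.withDensity h₁)
    (e₂ : m₂ = (ν.prod ν).withDensity h₂) (h : m₁.prod m₁ ≤ m₂) :
    ∀ᵐ z ∂ν.prod ν, h₁ z.1 ≠ 0 → h₁ z.2 ≠ 0 → 1 ≤ g2 h₁ h₂ z := by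
  have hfin := ae_ne_top_of_withDensity hm₁ e₁
  have : SigmaFinite (ν.withDensity h₁) := e₁ ▸ inferInstance
  rw [e₂, e₁, prod_withDensity hm₁ hm₁] at h
  filter_upwards [ae_le_of_withDensity_le ((hm₁.comp measurable_fst).mul
    (hm₁.comp measurable_snd)) h, hfin] with z hz hz' h0 h0'
  rw [g2, ENNReal.le_div_iff_mul_le (.inl (mul_ne_zero h0 h0'))
    (.inl (ENNReal.mul_ne_top hz'.1 hz'.2)), one_mul]
  exact hz

theorem g2_le_one_of_le_prod [SigmaFinite ν] (hm₁ : Measurable h₁) (hm₂ : Measurable h₂)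
    (e₁ : m₁ = ν.withDensity h₁) (e₂ : m₂ = (ν.prod ν).withDensity h₂) (h : m₂ ≤ m₁.prod m₁) :
    ∀ᵐ z ∂ν.prod ν, h₁ z.1 ≠ 0 → h₁ z.2 ≠ 0 → g2 h₁ h₂ z ≤ 1 := by
  have : SigmaFinite (ν.withDensity h₁) := e₁ ▸ inferInstance
  rw [e₂, e₁, prod_withDensity hm₁ hm₁] at h
  filter_upwards [ae_le_of_withDensity_le hm₂ h] with z hz _ _
  rw [g2]
  exact ENNReal.div_le_of_le_mul (by rwa [one_mul])

end Bunching

end Beam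

/-! ### Assembly of the statements for σ = D*D -/

theorem mainTheorem5 {H : Type*} [NormedAddCommGroup H] [InnerProductSpace ℂ H] [CompleteSpace H]
    {X : Type*} [MeasurableSpace X]
    (s : ℤˣ) (σ : H →L[ℂ] H) (hσ : 0 ≤ σ) (hσ_trace : Beam.IsTraceClass σ)
    (hBose : s = 1 → ‖σ‖ < 1) (F : Beam.Observable X H) :
    -- the reduced density operators
    (∀ k, Beam.IsReducedDensity (Beam.quasiFree s σ) k
      (Beam.secondQuant s (Beam.sigmaHat s σ) k)) ∧
    -- existence of the counting statistics
    (∃ P, Beam.IsCountingLaw F (Beam.quasiFree s σ) P) ∧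
    ∀ P, Beam.IsCountingLaw F (Beam.quasiFree s σ) P →
      -- the factorial moments
      (∀ k, IsFiniteMeasure (Beam.factorialMoment P k) ∧
        ∀ A : Fin k → Set X, (∀ j, MeasurableSet (A j)) →
          (((Beam.factorialMoment P k).real (Set.univ.pi A) : ℝ) : ℂ) =
            (k.factorial : ℂ) * Beam.opTrace
              (Beam.secondQuant s (Beam.sigmaHat s σ) k * Beam.tensorMap fun j => F.op (A j))) ∧
      -- the first and the second factorial moment
      (∀ A, MeasurableSet A →
        (((Beam.moment₁ P).real A : ℝ) : ℂ) = Beam.opTrace (Beam.sigmaHat s σ * F.op A)) ∧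
      (∀ A B, MeasurableSet A → MeasurableSet B →
        (((Beam.moment₂ P).real (A ×ˢ B) : ℝ) : ℂ) =
          (((Beam.moment₁ P).real A : ℝ) : ℂ) * (((Beam.moment₁ P).real B : ℝ) : ℂ) +
            ((s : ℤ) : ℂ) * Beam.opTrace
              (Beam.sigmaHat s σ * F.op A * Beam.sigmaHat s σ * F.op B)) ∧
      -- the last term is a positive and positive definite measure
      (∃ μ : Measure (X × X), IsFiniteMeasure μ ∧
        (∀ A B, MeasurableSet A → MeasurableSet B →
          ((μ.real (A ×ˢ B) : ℝ) : ℂ) = Beam.opTrace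
            (Beam.sigmaHat s σ * F.op A * Beam.sigmaHat s σ * F.op B)) ∧
        (s = 1 → Beam.moment₂ P = (Beam.moment₁ P).prod (Beam.moment₁ P) + μ) ∧
        (s = -1 → Beam.moment₂ P + μ = (Beam.moment₁ P).prod (Beam.moment₁ P)) ∧
        ∀ f : X → ℂ, Measurable f → Integrable (fun z : X × X => conj (f z.1) * f z.2) μ →
          0 ≤ (∫ z, conj (f z.1) * f z.2 ∂μ).re ∧ (∫ z, conj (f z.1) * f z.2 ∂μ).im = 0) ∧
      -- bunching and antibunching
      ∀ (ν : Measure X) [SigmaFinite ν] (h₁ : X → ℝ≥0∞) (h₂ : X × X → ℝ≥0∞),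
        Measurable h₁ → Measurable h₂ →
        Beam.moment₁ P = ν.withDensity h₁ → Beam.moment₂ P = (ν.prod ν).withDensity h₂ →
          (s = 1 → ∀ᵐ z ∂ν.prod ν, h₁ z.1 ≠ 0 → h₁ z.2 ≠ 0 → 1 ≤ Beam.g2 h₁ h₂ z) ∧
          (s = -1 → ∀ᵐ z ∂ν.prod ν, h₁ z.1 ≠ 0 → h₁ z.2 ≠ 0 → Beam.g2 h₁ h₂ z ≤ 1) := by
  obtain ⟨D, -, hDs, rfl, hD⟩ := Beam.exists_sqrt_of_isTraceClass hσ hσ_trace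
  nth_rewrite 1 [← hDs] at hBose
  have e : D * D = star D * D := by rw [hDs]
  rw [e]
  refine ⟨Beam.isReducedDensity_quasiFree s hD hDs hBose,
    Beam.exists_isCountingLaw F s hD hBose, fun P hP => ?_⟩
  obtain ⟨D', hD', hσ'⟩ := Beam.exists_sigmaHat_eq s hD hDs hBose
  have hm₁ := fun A (hA : MeasurableSet A) => hP.moment₁_real hD hDs hBose hA
  have hm₂ := fun A B (hA : MeasurableSet A) (hB : MeasurableSet B) =>
    hP.moment₂_real hD hDs hBose hA hB
  have hf₁ := hP.isFiniteMeasure_moment₁ hD hBose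
  have hf₂ := hP.isFiniteMeasure_moment₂ hD hBose
  -- The exchange measure is taken for a factor of σ̂, not of σ.
  obtain ⟨μ, hμ, hμr, hμp⟩ := F.exists_exchange_measure hD'
  rw [← hσ'] at hμr
  have hbose : s = 1 → Beam.moment₂ P = (Beam.moment₁ P).prod (Beam.moment₁ P) + μ := by
    rintro rfl
    refine Beam.ext_real_prod fun A B hA hB => Complex.ofReal_injective ?_
    rw [hm₂ A B hA hB, measureReal_add_apply, measureReal_prod_prod, Complex.ofReal_add,
      Complex.ofReal_mul, hμr A B hA hB]
    simp
  -- For Fermions μ is added on the left, so that the identity remains one between positive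
  -- measures.
  have hfermi : s = -1 → Beam.moment₂ P + μ = (Beam.moment₁ P).prod (Beam.moment₁ P) := by
    rintro rfl
    refine Beam.ext_real_prod fun A B hA hB => Complex.ofReal_injective ?_
    rw [measureReal_add_apply, measureReal_prod_prod, Complex.ofReal_add, hm₂ A B hA hB,
      Complex.ofReal_mul, hμr A B hA hB]
    simp
  refine ⟨fun k => ⟨hP.isFiniteMeasure_factorialMoment hD hBose k, fun A hA =>
    hP.factorialMoment_real_pi hD hDs hBose k hA⟩, hm₁, hm₂, ⟨μ, hμ, hμr, hbose, hfermi,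
    fun f hf hfi => ?_⟩, fun ν _ h₁ h₂ hh₁ hh₂ e₁ e₂ => ⟨fun hs => ?_, fun hs => ?_⟩⟩
  · have h := Complex.nonneg_iff.mp (hμp f hf hfi)
    exact ⟨h.1, h.2.symm⟩
  · exact Beam.one_le_g2_of_prod_le hh₁ e₁ e₂ (hbose hs ▸ Measure.le_add_right le_rfl)
  · exact Beam.g2_le_one_of_le_prod hh₁ hh₂ e₁ e₂ (hfermi hs ▸ Measure.le_add_right le_rfl)
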